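/- **Setting.** An instance of *MAB superprocess with preemption and unit processing times* (no bridge nodes) consists of $n$ arms, a finite set $A$ of actions and a budget of $B$ time steps. Arm $i$ has a finite node set $\mathcal S_i$ with a root $\rho_i$, rewards $r^a_u\ge 0$ and transition probabilities $p^a_{u,v}\ge 0$ with $\sum_{v\in\mathcal S_i} p^a_{u,v}=1$ ($u\in\mathcal S_i$, $a\in A$). It is layered: there is a function $\mathrm{depth}$ with values in $\{0,1,\dots\}$ such that $\mathrm{depth}(\rho_i)=0$, and $p^a_{u,v}>0$ implies $\mathrm{depth}(v)=\mathrm{depth}(u)+1$ whenever $\mathrm{depth}(u)<B$ (deeper nodes cannot be played within the budget). Each arm starts on its root. In each of the $B$ time steps at most one arm $i$ is played, with one action $a$; if it is on node $u$, the reward $r^a_u$ is collected and the arm moves to node $v$ with probability $p^a_{u,v}$, which is observed before the next time step. Let $\mathcal S=\bigsqcup_i\mathcal S_i$, $\boldsymbol{\mathcal S}=\mathcal S_1\times\dots\times\mathcal S_n$, $[B]=\{1,\dots,B\}$, and for $\pi\in\boldsymbol{\mathcal S}$, $u\in\mathcal S_i$ let $\pi^u$ be $\pi$ with its $i$-th component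 replaced by $u$. Let $\mathrm{OPT}_{\mathtt{PolyLP}}$ be the optimum of $$\begin{aligned}(\mathtt{PolyLP})\quad\max\ &\sum_{u\in\mathcal S}\sum_{a\in A}r^a_u\sum_{t=1}^B x^a_{u,t}\quad\text{s.t.}\quad \sum_{u\in\mathcal S}\sum_{a\in A}x^a_{u,t}\le 1,\quad \sum_{a\in A}x^a_{u,t}\le s_{u,t},\quad x^a_{u,t}\ge 0\quad(t\in[B]),\\ &s_{\rho_i,1}=1,\qquad s_{u,1}=0\ \ (u\in\mathcal S\setminus\{\rho_1,\dots,\rho_n\}),\\ &s_{u,t}=s_{u,t-1}-\sum_{a\in A}x^a_{u,t-1}+\sum_{v,a}x^a_{v,t-1}\,p^a_{v,u}\quad(1<t\le B),\end{aligned}$$ where $v$ ranges over the nodes of the arm of $u$, and let $\mathrm{OPT}_{\mathtt{ExpLP}}$ be the optimum of the linear program whose solutions are the adaptive policies, $$\begin{aligned}(\mathtt{ExpLP})\quad\max\ &\sum_{\pi\in\boldsymbol{\mathcal S}}\sum_{i=1}^n\sum_{a\in A}r^a_{\pi_i}\sum_{t=1}^B z^a_{\pi,i,t}\quad\text{s.t.}\quad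 \sum_{\pi,i,a}z^a_{\pi,i,t}\le 1,\quad \sum_{i,a}z^a_{\pi,i,t}\le y_{\pi,t},\quad z^a_{\pi,i,t}\ge 0\quad(t\in[B]),\\ &y_{(\rho_1,\dots,\rho_n),1}=1,\qquad y_{\pi,1}=0\ \ (\pi\ne(\rho_1,\dots,\rho_n)),\\ &y_{\pi,t}=y_{\pi,t-1}-\sum_{i,a}z^a_{\pi,i,t-1}+\sum_{i}\sum_{u\in\mathcal S_i}\sum_{a\in A}z^a_{\pi^u,i,t-1}\,p^a_{u,\pi_i}\quad(1<t\le B).\end{aligned}$$ **Theorem.** (1) There is a $(\mathtt{PolyLP})$-relative $\frac{4}{27}$-approximation algorithm for MAB superprocess with preemption and unit processing times. That is, there are a single randomized algorithm (a program for a real RAM that can also toss coins of computed bias and play arms) and a polynomial $T$ such that, on every instance and every feasible solution $(x,s)$ of $(\mathtt{PolyLP})$ for it, the algorithm, given the instance and $x$, makes in every run at most $T(n+|A|+B+|\mathcal S|)$ steps, counting unit cost for arithmetic operations, and collects within the budget an expected reward of at least $\frac{4}{27}\sum_{u\in\mathcal S}\sum_{a\in A}r^a_u\sum_{t=1}^Bx^a_{u,t}$.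 In particular, if $(x,s)$ is an optimal solution, then the expected reward is at least $\frac{4}{27}\mathrm{OPT}_{\mathtt{PolyLP}}$, and at least $\frac{4}{27}\mathrm{OPT}_{\mathtt{ExpLP}}$. (2) For every instance, $(\mathtt{PolyLP})$ has an optimal solution, and $\mathrm{OPT}_{\mathtt{ExpLP}}\le\mathrm{OPT}_{\mathtt{PolyLP}}$. (3) Consequently the projection gap of $(\mathtt{PolyLP})$ in the absence of bridge nodes, that is, the supremum of $\mathrm{OPT}_{\mathtt{PolyLP}}/\mathrm{OPT}_{\mathtt{ExpLP}}$ over all such instances (with $0/0$ read as $0$, and $c/0$ as $\infty$ for $c>0$), is at most $\frac{27}{4}$. -/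

import Mathlib

/-!
MAB superprocesses with preemption and unit processing times, their two linear programs, and a
randomized real-RAM on which a (PolyLP)-relative algorithm is run and timed.
-/

/-- An instance of MAB superprocess with preemption in which every transition takes one time step
(so there are no bridge nodes). Arm `i` is a Markov decision process with finitely many nodes; the
actions are common to all arms.  The arms are layered by `depth`.  A node of depth `d` cannot be
reached before `d` time steps have elapsed, so the (finite) arms are only required to be layered
below depth `budget`: what the transitions out of deeper nodes do can never matter. -/
structure MABInstance where
  numArms : ℕ
  numActions : ℕ
  /-- the number `B` of time steps -/
  budget : ℕ
  /-- the number of nodes of each arm; the node set `𝒮ᵢ` is `Fin (numNodes i)` -/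
  numNodes : Fin numArms → ℕ
  root : ∀ i, Fin (numNodes i)
  depth : ∀ i, Fin (numNodes i) → ℕ
  /-- `reward i u a` is the reward for playing action `a` on node `u` of arm `i` -/
  reward : ∀ i, Fin (numNodes i) → Fin numActions → ℝ
  /-- `trans i u a v` is the probability of moving from `u` to `v` when `a` is played -/
  trans : ∀ i, Fin (numNodes i) → Fin numActions → Fin (numNodes i) → ℝ
  reward_nonneg : ∀ i u a, 0 ≤ reward i u a
  trans_nonneg : ∀ i u a v, 0 ≤ trans i u a v
  trans_sum : ∀ i u a, ∑ v, trans i u a v = 1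
  depth_root : ∀ i, depth i (root i) = 0
  depth_trans : ∀ i u a v, depth i u < budget → 0 < trans i u a v →
    depth i v = depth i u + 1

namespace MABInstance

/-- The size of an instance: arms + actions + time steps + nodes. -/
def size (I : MABInstance) : ℕ :=
  I.numArms + I.numActions + I.budget + ∑ i, I.numNodes i

/-! ### The polynomial-sized relaxation (PolyLP); time steps are `1, …, B` -/

/-- Variables `x^a_{u,t}`: probability of playing action `a` on node `u` at time `t`. -/
abbrev PlayVar (I : MABInstance) : Type :=
  ∀ i : Fin I.numArms, Fin (I.numNodes i) → Fin I.numActions → ℕ → ℝ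

/-- Variables `s_{u,t}`: probability that the arm is on node `u` at the beginning of time `t`. -/
abbrev NodeVar (I : MABInstance) : Type :=
  ∀ i : Fin I.numArms, Fin (I.numNodes i) → ℕ → ℝ

/-- The constraints of (PolyLP). -/
structure PolyFeasible (I : MABInstance) (x : I.PlayVar) (s : I.NodeVar) : Prop where
  one_play : ∀ t ∈ Finset.Icc 1 I.budget, ∑ i, ∑ u, ∑ a, x i u a t ≤ 1
  play_le : ∀ t ∈ Finset.Icc 1 I.budget, ∀ i u, ∑ a, x i u a t ≤ s i u t
  nonneg : ∀ t ∈ Finset.Icc 1 I.budget, ∀ i u a, 0 ≤ x i u a t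
  start_root : ∀ i, s i (I.root i) 1 = 1
  start_other : ∀ i u, u ≠ I.root i → s i u 1 = 0
  update : ∀ t ∈ Finset.Icc 2 I.budget, ∀ i u,
    s i u t = s i u (t - 1) - ∑ a, x i u a (t - 1)
      + ∑ v, ∑ a, x i v a (t - 1) * I.trans i v a u

/-- The objective of (PolyLP). -/
def polyValue (I : MABInstance) (x : I.PlayVar) : ℝ :=
  ∑ i, ∑ u, ∑ a, I.reward i u a * ∑ t ∈ Finset.Icc 1 I.budget, x i u a t

/-- An optimal solution of (PolyLP). -/
def PolyOptimal (I : MABInstance) (x : I.PlayVar) (s : I.NodeVar) : Prop :=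
  I.PolyFeasible x s ∧ ∀ x' s', I.PolyFeasible x' s' → I.polyValue x' ≤ I.polyValue x

/-- `OPT_PolyLP`. -/
noncomputable def optPoly (I : MABInstance) : ℝ :=
  sSup {w | ∃ x s, I.PolyFeasible x s ∧ w = I.polyValue x}

/-! ### The exponential-sized program (ExpLP), whose solutions are the adaptive policies -/

/-- Joint nodes: one node for each arm. -/
abbrev Joint (I : MABInstance) : Type := ∀ i : Fin I.numArms, Fin (I.numNodes i)

/-- The constraints of (ExpLP): `y π t` is the probability that the arms are on the joint node `π`
at the beginning of time `t`, and `z π i a t` the probability that, on `π` at time `t`, action `a`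
is played on arm `i`. -/
structure ExpFeasible (I : MABInstance) (z : I.Joint → Fin I.numArms → Fin I.numActions → ℕ → ℝ)
    (y : I.Joint → ℕ → ℝ) : Prop where
  one_play : ∀ t ∈ Finset.Icc 1 I.budget, ∑ π, ∑ i, ∑ a, z π i a t ≤ 1
  play_le : ∀ t ∈ Finset.Icc 1 I.budget, ∀ π, ∑ i, ∑ a, z π i a t ≤ y π t
  nonneg : ∀ t ∈ Finset.Icc 1 I.budget, ∀ π i a, 0 ≤ z π i a t
  start_root : y I.root 1 = 1
  start_other : ∀ π, π ≠ I.root → y π 1 = 0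
  update : ∀ t ∈ Finset.Icc 2 I.budget, ∀ π,
    y π t = y π (t - 1) - ∑ i, ∑ a, z π i a (t - 1)
      + ∑ i, ∑ u, ∑ a, z (Function.update π i u) i a (t - 1) * I.trans i u a (π i)

/-- The objective of (ExpLP). -/
def expValue (I : MABInstance)
    (z : I.Joint → Fin I.numArms → Fin I.numActions → ℕ → ℝ) : ℝ :=
  ∑ π : I.Joint, ∑ i, ∑ a, I.reward i (π i) a * ∑ t ∈ Finset.Icc 1 I.budget, z π i a t

/-- `OPT_ExpLP`, the optimum over all adaptive policies. -/
noncomputable def optExp (I : MABInstance) : ℝ :=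
  sSup {w | ∃ z y, I.ExpFeasible z y ∧ w = I.expValue z}

/-- The projection gap of (PolyLP) in the absence of bridge nodes: the supremum of
`OPT_PolyLP / OPT_ExpLP` over all instances.  In `ℝ≥0∞`, `c / 0 = ∞` for `c > 0`, and `0 / 0 = 0`:
an instance where both optima are `0` does not count. -/
noncomputable def projectionGap : ENNReal :=
  ⨆ I : MABInstance, ENNReal.ofReal I.optPoly / ENNReal.ofReal I.optExp

/-- The law of the next node when action `a` is played on node `u` of arm `i`. -/
noncomputable def transPMF (I : MABInstance) (i : Fin I.numArms) (u : Fin (I.numNodes i))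
    (a : Fin I.numActions) : PMF (Fin (I.numNodes i)) :=
  PMF.ofFintype (fun v => ENNReal.ofReal (I.trans i u a v)) (by
    rw [← ENNReal.ofReal_sum_of_nonneg (fun v _ => I.trans_nonneg i u a v), I.trans_sum,
      ENNReal.ofReal_one])

end MABInstance

/-! ### The machine

A randomized real-RAM.  Its memory consists of arrays of natural numbers and arrays of real
numbers, addressed by an array name (a number) and a list of indices (the empty list for a scalar).
Natural numbers can be added, subtracted and compared, real numbers also multiplied and divided.
There are only bounded loops, so that every program halts.  The program can toss a coin whose bias
is a number it has computed, and it can play an action on an arm, whereupon it is told the node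
that the arm moves to. -/

/-- The two kinds of memory. -/
structure Memory where
  nat : ℕ → List ℕ → ℕ
  real : ℕ → List ℕ → ℝ

inductive NatExpr : Type
  | const (c : ℕ)
  | read (A : ℕ) {d : ℕ} (idx : Fin d → NatExpr)
  | add (e f : NatExpr)
  | sub (e f : NatExpr)

/-- Subtraction is truncated at `0`. -/
def NatExpr.eval (m : Memory) : NatExpr → ℕ
  | const c => c
  | read A idx => m.nat A (List.ofFn fun j => (idx j).eval m)
  | add e f => e.eval m + f.eval m
  | sub e f => e.eval m - f.eval m

inductive RealExpr : Type
  | const (c : ℚ)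
  | read (A : ℕ) {d : ℕ} (idx : Fin d → NatExpr)
  | add (e f : RealExpr)
  | sub (e f : RealExpr)
  | mul (e f : RealExpr)
  | div (e f : RealExpr)

/-- Division by `0` gives `0`. -/
noncomputable def RealExpr.eval (m : Memory) : RealExpr → ℝ
  | const c => (c : ℝ)
  | read A idx => m.real A (List.ofFn fun j => (idx j).eval m)
  | add e f => e.eval m + f.eval m
  | sub e f => e.eval m - f.eval m
  | mul e f => e.eval m * f.eval m
  | div e f => e.eval m / f.eval m

inductive Test : Type
  | natLe (e f : NatExpr)
  | realLe (e f : RealExpr)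
  | not (b : Test)
  | and (b c : Test)

def Test.holds (m : Memory) : Test → Prop
  | natLe e f => e.eval m ≤ f.eval m
  | realLe e f => e.eval m ≤ f.eval m
  | not b => ¬ b.holds m
  | and b c => b.holds m ∧ c.holds m

inductive Cmd : Type
  | skip
  /-- write a natural number to the cell `A[idx]` -/
  | setNat (A : ℕ) {d : ℕ} (idx : Fin d → NatExpr) (e : NatExpr)
  /-- write a real number to the cell `A[idx]` -/
  | setReal (A : ℕ) {d : ℕ} (idx : Fin d → NatExpr) (e : RealExpr)
  | seq (c d : Cmd)
  | ite (b : Test) (c d : Cmd)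
  /-- for `A = 0, …, e - 1` do `c`, where `e` is evaluated once, at the start -/
  | loop (A : ℕ) (e : NatExpr) (c : Cmd)
  /-- toss a coin of bias `e`, and write `1` (heads) or `0` (tails) to the scalar `A` -/
  | toss (A : ℕ) (e : RealExpr)
  /-- use the next time step to play action `act` on arm `arm`, and write the node that the arm
  moves to to the scalar `A` -/
  | play (arm act : NatExpr) (A : ℕ)

/-- A configuration: the memory, which the program can access, and the true state of the arms, the
number of elapsed time steps, the reward accrued so far and the number of computation steps so far,
which it cannot access. -/
structure Config (I : MABInstance) where
  mem : Memory
  node : I.Joint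
  clock : ℕ
  gain : ℝ
  steps : ℕ

namespace Config

variable {I : MABInstance}

def tick (σ : Config I) : Config I := { σ with steps := σ.steps + 1 }

def setNat (σ : Config I) (A : ℕ) (idx : List ℕ) (k : ℕ) : Config I :=
  { σ with mem := { σ.mem with
      nat := Function.update σ.mem.nat A (Function.update (σ.mem.nat A) idx k) } }

noncomputable def setReal (σ : Config I) (A : ℕ) (idx : List ℕ) (w : ℝ) : Config I :=
  { σ with mem := { σ.mem with
      real := Function.update σ.mem.real A (Function.update (σ.mem.real A) idx w) } }

/-- Play action `k` on arm `j` in the next time step.  If there is no such arm or no such action,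
the time step passes without a play.  Once the budget is exhausted nothing is gained any more. -/
noncomputable def play (σ : Config I) (j k A : ℕ) : PMF (Config I) :=
  if h : j < I.numArms ∧ k < I.numActions ∧ σ.clock < I.budget then
    (I.transPMF ⟨j, h.1⟩ (σ.node ⟨j, h.1⟩) ⟨k, h.2.1⟩).map fun v =>
      { σ.setNat A [] v.val with
        node := Function.update σ.node ⟨j, h.1⟩ v
        clock := σ.clock + 1
        gain := σ.gain + I.reward ⟨j, h.1⟩ (σ.node ⟨j, h.1⟩) ⟨k, h.2.1⟩ }
  else PMF.pure { σ with clock := σ.clock + 1 }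

end Config

/-- A coin with heads (`true`) of probability `q`, which is clamped to `[0, 1]`. -/
noncomputable def coin (q : ℝ) : PMF Bool :=
  PMF.ofFintype
    (fun b => ENNReal.ofReal (if b then max 0 (min 1 q) else 1 - max 0 (min 1 q))) (by
    have h : max 0 (min 1 q) ≤ 1 := max_le zero_le_one (min_le_left _ _)
    rw [← ENNReal.ofReal_sum_of_nonneg]
    · simp
    · intro b _
      cases b
      · simp
      · simp)

open Classical in
/-- The law of the configuration after the execution of a command.  Every elementary command, every
branching, every loop and every round of a loop costs one step (the expressions in a fixed program
have bounded size). -/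
noncomputable def Cmd.exec {I : MABInstance} : Cmd → Config I → PMF (Config I)
  | skip, σ => PMF.pure σ.tick
  | setNat A idx e, σ =>
      PMF.pure (σ.tick.setNat A (List.ofFn fun j => (idx j).eval σ.mem) (e.eval σ.mem))
  | setReal A idx e, σ =>
      PMF.pure (σ.tick.setReal A (List.ofFn fun j => (idx j).eval σ.mem) (e.eval σ.mem))
  | seq c d, σ => (c.exec σ).bind d.exec
  | ite b c d, σ => if b.holds σ.mem then c.exec σ.tick else d.exec σ.tick
  | loop A e c, σ =>
      Nat.rec (PMF.pure σ.tick)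
        (fun k law => law.bind fun τ => c.exec (τ.tick.setNat A [] k)) (e.eval σ.mem)
  | toss A e, σ => (coin (e.eval σ.mem)).map fun b => σ.tick.setNat A [] (if b then 1 else 0)
  | play arm act A, σ => σ.tick.play (arm.eval σ.mem) (act.eval σ.mem) A

namespace MABInstance

/-- The input, as laid out in the memory: the instance and numbers `x^a_{u,t}`.  Natural-number
arrays: `0[]`, `1[]`, `2[]` are the numbers of arms, of actions and of time steps, `3[i]` is the
number of nodes of arm `i`, `4[i]` its root, `5[i,u]` the depth of node `u`.  Real arrays:
`0[i,u,a]` is the reward, `1[i,u,a,v]` the transition probability, `2[i,u,a,t]` is `x^a_{u,t}`.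
All other cells hold `0`. -/
noncomputable def input (I : MABInstance) (x : I.PlayVar) : Memory where
  nat
    | 0, [] => I.numArms
    | 1, [] => I.numActions
    | 2, [] => I.budget
    | 3, [i] => if h : i < I.numArms then I.numNodes ⟨i, h⟩ else 0
    | 4, [i] => if h : i < I.numArms then I.root ⟨i, h⟩ else 0
    | 5, [i, u] =>
        if h : ∃ h : i < I.numArms, u < I.numNodes ⟨i, h⟩ then I.depth ⟨i, h.1⟩ ⟨u, h.2⟩ else 0
    | _, _ => 0
  real
    | 0, [i, u, a] =>
        if h : (∃ h : i < I.numArms, u < I.numNodes ⟨i, h⟩) ∧ a < I.numActions then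
          I.reward ⟨i, h.1.1⟩ ⟨u, h.1.2⟩ ⟨a, h.2⟩ else 0
    | 1, [i, u, a, v] =>
        if h : (∃ h : i < I.numArms, u < I.numNodes ⟨i, h⟩ ∧ v < I.numNodes ⟨i, h⟩) ∧
            a < I.numActions then
          I.trans ⟨i, h.1.1⟩ ⟨u, h.1.2.1⟩ ⟨a, h.2⟩ ⟨v, h.1.2.2⟩ else 0
    | 2, [i, u, a, t] =>
        if h : (∃ h : i < I.numArms, u < I.numNodes ⟨i, h⟩) ∧ a < I.numActions ∧
            1 ≤ t ∧ t ≤ I.budget then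
          x ⟨i, h.1.1⟩ ⟨u, h.1.2⟩ ⟨a, h.2.1⟩ t else 0
    | _, _ => 0

/-- At the start all arms are on their roots. -/
noncomputable def start (I : MABInstance) (x : I.PlayVar) : Config I where
  mem := I.input x
  node := I.root
  clock := 0
  gain := 0
  steps := 0

/-- The law of the final configuration of a program on the instance `I` and the numbers `x`. -/
noncomputable def outcome (I : MABInstance) (P : Cmd) (x : I.PlayVar) : PMF (Config I) :=
  P.exec (I.start x)

/-- The expected reward that a program collects within the budget.  (The law of the final
configuration has finite support, so the sum is a finite one.) -/
noncomputable def expectedReward (I : MABInstance) (P : Cmd) (x : I.PlayVar) : ℝ :=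
  ∑' σ, (I.outcome P x σ).toReal * σ.gain

end MABInstance

/-!
The algorithm, and why it earns `4/27` of the value of a feasible solution `(x, s)` of (PolyLP).

*Policies of the single arms.* A solution describes, for each arm, a randomized policy that ignores
the other arms: on node `u` at its time `t`, play action `a` with probability `x^a_{u,t} / s_{u,t}`.
The policy of an arm is then on node `u` at time `t` with probability `s_{u,t}`
(`PolyFeasible.occupancy_policy`), so together the policies earn the value of the solution
(`PolyFeasible.sum_future_policy`) and they make at most `t` plays up to time `t` in expectation
(`PolyFeasible.sum_expectedPlays_le`).

*The algorithm.* Each arm is selected with probability `1/3`, independently.  A selected arm has a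
virtual time `τ`, the number of time steps of its policy that have been simulated, and a number `c`
of plays; simulated steps without a play take no real time.  In round `t = 0, …, B - 1`, each
selected arm in turn is advanced as long as `τ ≤ t` or `τ < 2 c`.  If the budget were unlimited, then
the arms would remain independent of each other, and each would run its policy to the end.

*The analysis.* Let an arm be advanced in round `t`, and let `K = ⌊t/2⌋ + 1`.  Its own plays satisfy
`c ≤ τ - t / 2` by the rule (`ArmPolicy.lawAt_support`), so within the budget there is room for one
more play unless the other arms have made `K` plays or more.  The number of plays of another arm,
capped at `K`, has mean at most `1/3 K`, and at most `1/3` of the expected plays of its policy up to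
time `t + 1`, because an arm can get ahead of the rounds only through many plays
(`ArmPolicy.sum_lawAt_mul_min_le`).  The means sum up to at most `(t + 1) / 3 ≤ 2/3 K`.  Hence the
other arms have used up the room with probability at most `5/9`: a sum of independent nonnegative
variables with means at most `1/3` and total mean at most `2/3` reaches `1` with probability at most
`5/9` (`prodExp_overload_le`).  For this, the variables are grouped into three bins of mean at most
`1/3` each; for three variables the laws may be taken to be two-point laws
(`sum_mul_le_of_two_point`), and these reduce to weighted Bernoulli variables (`overloadProb_le`).
So every simulated step earns `4/9` of what the policy earns, and with the selection probability this
gives `1/3 * 4/9 = 4/27` (`le_selectValue`).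

*The program.* `MABProgram.program` first tabulates `s` from `x`.  Its expected reward is computed by
following, backwards through the program, the mean of the reward so far plus the expected future
reward as a function of the states of the arms (`Cmd.Achieves`).  Its loops are bounded by
entries of the input, hence the polynomial bound on the steps (`Cmd.steps_le`).

*The linear programs.* The marginals of a solution of (ExpLP) solve (PolyLP)
(`ExpFeasible.exists_polyFeasible`), and (PolyLP) has an optimal solution by compactness.  Conversely,
no program earns more than `OPT_ExpLP`: by dynamic programming its expected reward is at most that of
a greedy adaptive policy, whose law solves (ExpLP) (`MABInstance.expectedReward_le_optExp`).  So the
approximation guarantee, applied to an optimal solution of (PolyLP), bounds the projection gap.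
-/

/-! ### The overload probability of three Bernoulli variables -/

/-- The indicator of `1 ≤ s`. -/
noncomputable def overload (s : ℝ) : ℝ := if 1 ≤ s then 1 else 0

/-- The probability that `d₁ B₁ + d₂ B₂ + d₃ B₃ ≥ 1`, for independent Bernoulli variables `Bᵢ` of
means `pᵢ`. -/
noncomputable def overloadProb (p₁ d₁ p₂ d₂ p₃ d₃ : ℝ) : ℝ :=
  p₁ * p₂ * p₃ * overload (d₁ + d₂ + d₃) + p₁ * p₂ * (1 - p₃) * overload (d₁ + d₂)
    + p₁ * (1 - p₂) * p₃ * overload (d₁ + d₃) + (1 - p₁) * p₂ * p₃ * overload (d₂ + d₃)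
    + p₁ * (1 - p₂) * (1 - p₃) * overload d₁ + (1 - p₁) * p₂ * (1 - p₃) * overload d₂
    + (1 - p₁) * (1 - p₂) * p₃ * overload d₃

theorem overloadProb_swap_left (p₁ d₁ p₂ d₂ p₃ d₃ : ℝ) :
    overloadProb p₁ d₁ p₂ d₂ p₃ d₃ = overloadProb p₂ d₂ p₁ d₁ p₃ d₃ := by
  unfold overloadProb
  rw [add_comm d₂ d₁]
  ring

theorem overloadProb_swap_right (p₁ d₁ p₂ d₂ p₃ d₃ : ℝ) :
    overloadProb p₁ d₁ p₂ d₂ p₃ d₃ = overloadProb p₁ d₁ p₃ d₃ p₂ d₂ := by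
  unfold overloadProb
  rw [add_comm d₃ d₂, add_right_comm d₁ d₃ d₂]
  ring

/-- The case where each variable alone, when it does not vanish, is an overload: the probability that
all three vanish is at least `4/9`. -/
theorem prod_compl_ge {θ e₁ e₂ e₃ : ℝ} (hθ : 1 / 3 ≤ θ) (h₁ : 0 ≤ e₁) (h₂ : 0 ≤ e₂) (h₃ : 0 ≤ e₃)
    (k₁ : e₁ ≤ θ) (k₂ : e₂ ≤ θ) (k₃ : e₃ ≤ θ) (hs : e₁ + e₂ + e₃ ≤ 1 - θ) :
    4 / 9 ≤ (1 - e₁) * (1 - e₂) * (1 - e₃) := by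
  -- a coordinate `x` above `1/3` alone forces `θ > 1/3`, and then leaves little for the other two
  have big : ∀ x y z : ℝ, 0 ≤ x → 0 ≤ y → 0 ≤ z → x ≤ θ → x + y + z ≤ 1 - θ → 1 / 3 ≤ x →
      4 / 9 ≤ (1 - x) * (1 - y) * (1 - z) := by
    intro x y z hx hy hz hxθ hsum hx3
    have h1 : 2 * x ≤ (1 - y) * (1 - z) := by nlinarith [mul_nonneg hy hz]
    have h2 : x ≤ 2 / 3 := by linarith
    nlinarith [mul_le_mul_of_nonneg_left h1 (by linarith : 0 ≤ 1 - x),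
      mul_nonneg (sub_nonneg.2 hx3) (sub_nonneg.2 h2)]
  by_cases c₁ : 1 / 3 ≤ e₁
  · exact big e₁ e₂ e₃ h₁ h₂ h₃ k₁ hs c₁
  by_cases c₂ : 1 / 3 ≤ e₂
  · have := big e₂ e₁ e₃ h₂ h₁ h₃ k₂ (by linarith) c₂
    linarith
  by_cases c₃ : 1 / 3 ≤ e₃
  · have := big e₃ e₁ e₂ h₃ h₁ h₂ k₃ (by linarith) c₃
    linarith
  push Not at c₁ c₂ c₃
  have h12 : 4 / 9 + 2 / 3 * e₃ ≤ (1 - e₁) * (1 - e₂) := by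
    nlinarith [mul_nonneg (sub_nonneg.2 c₁.le) (sub_nonneg.2 c₂.le)]
  nlinarith [mul_le_mul_of_nonneg_right h12 (by linarith : 0 ≤ 1 - e₃),
    mul_nonneg h₃ (sub_nonneg.2 c₃.le)]

/-- The case where an overload needs two variables `δ` and `1 - δ` at once. -/
theorem prob_pair_le_half {θ p P δ : ℝ} (hθ : 1 / 3 ≤ θ) (hp : 0 ≤ p) (hp1 : p ≤ 1)
    (hP1 : P ≤ 1) (hδ : 1 / 3 ≤ δ) (hδ1 : δ < 1) (hx : p * δ ≤ θ)
    (hs : p * δ + P * (1 - δ) ≤ 1 - θ) : p * P ≤ 1 / 2 := by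
  set X := p * δ with hX
  have hX0 : 0 ≤ X := by positivity
  have hXδ : X ≤ δ := by nlinarith
  have hpos : 0 < δ * (1 - δ) := by nlinarith
  by_cases h : X ≤ δ - θ
  · have : p ≤ 1 / 2 := by nlinarith
    nlinarith
  push Not at h
  have key : X * (1 - θ - X) ≤ 1 / 2 * (δ * (1 - δ)) := by
    by_cases hX3 : 1 / 3 ≤ X
    · -- concavity of `δ * (1 - δ)` between `X` and `X + θ`
      have h1 : (1 - 2 * X - θ) * (δ - X) + X * (1 - X) ≤ δ * (1 - δ) := by nlinarith
      by_cases h2 : 0 ≤ 1 - 2 * X - θ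
      · nlinarith [mul_nonneg h2 (sub_nonneg.2 hXδ)]
      · push Not at h2
        nlinarith [mul_nonneg hX0 (sub_nonneg.2 hX3), mul_le_mul_of_nonneg_left h.le hX0,
          mul_nonneg (neg_nonneg.2 h2.le) (sub_nonneg.2 h.le),
          mul_nonneg (neg_nonneg.2 h2.le) (by linarith : 0 ≤ X + θ - δ)]
    · push Not at hX3
      nlinarith [mul_nonneg (sub_nonneg.2 hδ) (by linarith : 0 ≤ X + θ - δ),
        mul_nonneg hX0 (sub_nonneg.2 hθ), sq_nonneg (X - 1 / 3),
        mul_nonneg (sub_nonneg.2 hδ) (sub_nonneg.2 hX3.le)]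
  have h3 : (p * P) * (δ * (1 - δ)) ≤ X * (1 - θ - X) := by
    have : (p * P) * (δ * (1 - δ)) = X * (P * (1 - δ)) := by rw [hX]; ring
    rw [this]
    exact mul_le_mul_of_nonneg_left (by linarith) hX0
  by_contra hc
  push Not at hc
  nlinarith

/-- The case where an overload needs the first variable, or the other two, `δ` and `1 - δ`, at once. -/
theorem prob_single_or_pair_le {θ e₁ p₁ p₂ p₃ δ : ℝ} (hθ : 1 / 3 ≤ θ) (hp₁ : 0 ≤ p₁)
    (h₁ : p₁ ≤ e₁) (k₁ : e₁ ≤ θ) (hp₂ : 0 ≤ p₂) (hp₂1 : p₂ ≤ 1)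
    (hp₃ : 0 ≤ p₃) (hp₃1 : p₃ ≤ 1) (hδ : 0 < δ) (hδ1 : δ < 1) (k₂ : p₂ * δ ≤ θ)
    (k₃ : p₃ * (1 - δ) ≤ θ) (hs : e₁ + p₂ * δ + p₃ * (1 - δ) ≤ 1 - θ) :
    p₁ + (1 - p₁) * (p₂ * p₃) ≤ 5 / 9 := by
  have he : 0 ≤ e₁ := hp₁.trans h₁
  have hP0 : 0 ≤ p₂ * p₃ := by positivity
  have hP1 : p₂ * p₃ ≤ 1 := mul_le_one₀ hp₂1 hp₃ hp₃1
  -- a bound on `p₂ * p₃` in terms of the masses `x`, `y` of the two variables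
  have fin : ∀ P x y : ℝ, 0 ≤ P → P ≤ 1 → 0 ≤ x → 0 ≤ y → P * (1 - x) ≤ y → y ≤ θ →
      e₁ + x + y ≤ 1 - θ → p₁ + (1 - p₁) * P ≤ 5 / 9 := by
    intro P x y hP0 hP1 hx0 hy0 hxy hyθ hsum
    have hD : 0 ≤ 1 - P := by linarith
    have a1 : θ + e₁ ≤ 1 - P := by nlinarith [mul_nonneg hD hx0]
    have a2 : P * (θ + e₁) ≤ θ * (1 - P) := by
      nlinarith [mul_le_mul_of_nonneg_right hyθ hD,
        mul_le_mul_of_nonneg_left (by linarith : θ + e₁ + y ≤ 1 - x) hP0]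
    suffices h : 4 / 9 ≤ (1 - e₁) * (1 - P) by
      nlinarith [mul_le_mul_of_nonneg_right h₁ hD]
    by_cases c1 : 1 / 3 ≤ e₁
    · have h2 : 2 * e₁ ≤ 1 - P := by linarith
      have h3 : e₁ ≤ 2 / 3 := by linarith
      nlinarith [mul_le_mul_of_nonneg_left h2 (by linarith : 0 ≤ 1 - e₁),
        mul_nonneg (sub_nonneg.2 c1) (sub_nonneg.2 h3)]
    push Not at c1
    have hD0 : 0 < 1 - P := by linarith
    have h2 : e₁ * (1 - P) ≤ (θ + e₁) * (2 * (1 - P) - 1) := by nlinarith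
    have h3 : 0 ≤ 2 * (1 - P) - 1 := by
      by_contra hc
      push Not at hc
      nlinarith [mul_nonneg he hD]
    have h4 : e₁ * (1 - P) ≤ (1 - P) * (2 * (1 - P) - 1) :=
      h2.trans (mul_le_mul_of_nonneg_right a1 h3)
    have h5 : e₁ ≤ 2 * (1 - P) - 1 := by
      rw [mul_comm] at h4
      exact le_of_mul_le_mul_left h4 hD0
    have h6 : (1 + e₁) / 2 ≤ 1 - P := by linarith
    nlinarith [mul_le_mul_of_nonneg_left h6 (by linarith : 0 ≤ 1 - e₁),
      mul_nonneg (sub_nonneg.2 c1.le) (by linarith : 0 ≤ 1 / 3 + e₁)]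
  have hx : 0 ≤ p₂ * δ := by positivity
  have hy : 0 ≤ p₃ * (1 - δ) := mul_nonneg hp₃ (by linarith)
  have hpos : 0 < δ * (1 - δ) := mul_pos hδ (by linarith)
  -- `δ (1 - δ)` is concave, and `δ` lies between `p₂ δ` and `1 - p₃ (1 - δ)`
  by_cases c : p₂ * δ ≤ 1 - δ
  · refine fin _ _ _ hP0 hP1 hx hy ?_ k₃ hs
    have h2 : p₂ * (1 - p₂ * δ) ≤ 1 - δ := by nlinarith [mul_nonneg (sub_nonneg.2 hp₂1) (sub_nonneg.2 c)]
    nlinarith [mul_le_mul_of_nonneg_left h2 hp₃]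
  · push Not at c
    refine fin _ _ _ hP0 hP1 hy hx ?_ k₂ (by linarith)
    have c' : p₃ * (1 - δ) ≤ δ := by linarith
    have h2 : p₃ * (1 - p₃ * (1 - δ)) ≤ δ := by
      nlinarith [mul_nonneg (sub_nonneg.2 hp₃1) (sub_nonneg.2 c')]
    nlinarith [mul_le_mul_of_nonneg_left h2 hp₂]

/-- The case where an overload needs two of the three variables: those of probabilities `a` and `b`
are at least `1 - δ` and the one of probability `p` is at least `δ`; here `φ = θ / (1 - δ)`. -/
theorem prob_two_of_three_le {p a b φ : ℝ} (hp : 1 / 2 ≤ p) (hp1 : p ≤ 1) (ha : 0 ≤ a) (hb : 0 ≤ b)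
    (haφ : a ≤ φ) (hbφ : b ≤ φ) (h : p * (a + b) ≤ p + φ - 2 * p * φ) :
    p * (a + b) + (1 - 2 * p) * (a * b) ≤ 5 / 9 := by
  have hab : 0 ≤ a * b := by positivity
  by_cases c1 : 1 ≤ φ
  · nlinarith
  push Not at c1
  by_cases c2 : φ ≤ 1 / 3
  · nlinarith [mul_nonneg (sub_nonneg.2 (haφ.trans c2)) (sub_nonneg.2 (hbφ.trans c2)),
      mul_nonneg (sub_nonneg.2 hp1) ha, mul_nonneg (sub_nonneg.2 hp1) hb]
  push Not at c2
  by_cases c3 : a + b ≤ φ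
  · nlinarith
  push Not at c3
  have h1 : φ * (a + b - φ) ≤ a * b := by nlinarith [mul_nonneg (sub_nonneg.2 haφ) (sub_nonneg.2 hbφ)]
  have h2 : p * (a + b) + (1 - 2 * p) * (a * b) ≤
      (a + b) * (p - (2 * p - 1) * φ) + (2 * p - 1) * φ ^ 2 := by nlinarith
  have h3 : 0 ≤ p - (2 * p - 1) * φ := by nlinarith
  have h4 : p * ((a + b) * (p - (2 * p - 1) * φ)) ≤ (p + φ - 2 * p * φ) * (p - (2 * p - 1) * φ) := by
    nlinarith
  have h5 : p * (3 * φ - 1) ≤ φ := by nlinarith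
  have h6 : (p + φ - 2 * p * φ) * (p - (2 * p - 1) * φ) + p * ((2 * p - 1) * φ ^ 2) ≤ 5 / 9 * p := by
    have hA : 0 ≤ 1 - 4 * φ + 6 * φ ^ 2 := by nlinarith [sq_nonneg (3 * φ - 1)]
    -- the left side is convex in `p`: compare with the chord over `[1/2, 1]` or `[1/2, 2/3]`
    by_cases c4 : φ ≤ 2 / 3
    · have e1 := mul_nonneg hA (mul_nonneg (sub_nonneg.2 hp) (sub_nonneg.2 hp1))
      have e2 := mul_nonneg (sub_nonneg.2 hp) (mul_nonneg (sub_nonneg.2 c2.le) (sub_nonneg.2 c4))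
      linarith
    · push Not at c4
      have hp2 : p ≤ 2 / 3 := by nlinarith
      have e1 := mul_nonneg hA (mul_nonneg (sub_nonneg.2 hp) (sub_nonneg.2 hp2))
      have e2 := mul_nonneg (sub_nonneg.2 hp) (mul_nonneg (sub_nonneg.2 c4.le) (sub_nonneg.2 c1.le))
      have e3 := mul_nonneg (sub_nonneg.2 hp) (sub_nonneg.2 c1.le)
      linarith
  nlinarith

theorem prob_two_of_three_le_of_lt_half {p a b φ : ℝ} (hp : 0 ≤ p) (hp1 : p ≤ 1 / 2) (ha : 0 ≤ a)
    (hb : 0 ≤ b) (haφ : a ≤ φ) (hbφ : b ≤ φ) (h : a + b + φ ≤ 2 - p) :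
    p * (a + b) + (1 - 2 * p) * (a * b) ≤ 5 / 9 := by
  have h1 : a + b ≤ (4 - 2 * p) / 3 := by linarith
  have h2 : a * b ≤ (2 - p) ^ 2 / 9 := by nlinarith [sq_nonneg (a - b)]
  have h3 := mul_le_mul_of_nonneg_left h1 hp
  have h4 := mul_le_mul_of_nonneg_left h2 (by linarith : 0 ≤ 1 - 2 * p)
  nlinarith [mul_nonneg hp (sub_nonneg.2 hp1), mul_nonneg hp (mul_nonneg hp (sub_nonneg.2 hp1))]

theorem mul_add_le_of_split {θ p a b δ : ℝ} (hp1 : p ≤ 1) (hp : 0 ≤ p) (hδ1 : δ < 1)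
    (k : p * δ ≤ θ) (hs : p * δ + (a + b) * (1 - δ) ≤ 1 - θ) :
    p * (a + b) ≤ p + θ / (1 - δ) - 2 * p * (θ / (1 - δ)) := by
  have hx : 0 < 1 - δ := by linarith
  have e : p + θ / (1 - δ) - 2 * p * (θ / (1 - δ)) = (p * (1 - δ) + θ - 2 * p * θ) / (1 - δ) := by
    field_simp
  rw [e, le_div_iff₀ hx]
  nlinarith [mul_le_mul_of_nonneg_left hs hp, mul_nonneg (sub_nonneg.2 k) (sub_nonneg.2 hp1)]

/-- For ordered values `d₃ ≤ d₂ ≤ d₁`, there are few possibilities for the sets of variables that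
amount to an overload. -/
theorem overloadProb_le_of_sorted {θ p₁ d₁ p₂ d₂ p₃ d₃ : ℝ} (hθ : 1 / 3 ≤ θ)
    (hp₁ : 0 ≤ p₁) (hq₁ : p₁ ≤ 1) (hp₂ : 0 ≤ p₂) (hq₂ : p₂ ≤ 1) (hp₃ : 0 ≤ p₃) (hq₃ : p₃ ≤ 1)
    (h₃ : 0 ≤ d₃) (h₂ : d₃ ≤ d₂) (h₁ : d₂ ≤ d₁)
    (k₁ : p₁ * d₁ ≤ θ) (k₂ : p₂ * d₂ ≤ θ) (k₃ : p₃ * d₃ ≤ θ)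
    (hs : p₁ * d₁ + p₂ * d₂ + p₃ * d₃ ≤ 1 - θ) :
    overloadProb p₁ d₁ p₂ d₂ p₃ d₃ ≤ 5 / 9 := by
  have e₁ : 0 ≤ p₁ * d₁ := mul_nonneg hp₁ (by linarith)
  have e₂ : 0 ≤ p₂ * d₂ := mul_nonneg hp₂ (by linarith)
  have e₃ : 0 ≤ p₃ * d₃ := mul_nonneg hp₃ h₃
  have le_of_one_le : ∀ p d : ℝ, 0 ≤ p → 1 ≤ d → p ≤ p * d := fun p d hp hd =>
    le_mul_of_one_le_right hp hd
  have m12 : p₁ * p₂ ≤ 1 := mul_le_one₀ hq₁ hp₂ hq₂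
  have pos : ∀ {s : ℝ}, 1 ≤ s → overload s = 1 := fun h => if_pos h
  have neg : ∀ {s : ℝ}, s < 1 → overload s = 0 := fun h => if_neg (not_le.2 h)
  unfold overloadProb
  by_cases c2 : 1 ≤ d₂
  · have f1 := le_of_one_le p₁ d₁ hp₁ (by linarith)
    have f2 := le_of_one_le p₂ d₂ hp₂ c2
    rw [pos (by linarith : 1 ≤ d₁ + d₂ + d₃), pos (by linarith : 1 ≤ d₁ + d₂),
      pos (by linarith : 1 ≤ d₁ + d₃), pos (by linarith : 1 ≤ d₂ + d₃),
      pos (by linarith : 1 ≤ d₁), pos c2]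
    have g12 : (1 - p₁ * d₁) * (1 - p₂ * d₂) ≤ (1 - p₁) * (1 - p₂) :=
      mul_le_mul (by linarith) (by linarith) (by linarith) (by linarith)
    by_cases c3 : 1 ≤ d₃
    · have f3 := le_of_one_le p₃ d₃ hp₃ c3
      rw [pos c3]
      have := prod_compl_ge hθ e₁ e₂ e₃ k₁ k₂ k₃ hs
      have : (1 - p₁ * d₁) * (1 - p₂ * d₂) * (1 - p₃ * d₃) ≤ (1 - p₁) * (1 - p₂) * (1 - p₃) :=
        mul_le_mul g12 (by linarith) (by linarith)
          (mul_nonneg (by linarith) (by linarith))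
      linarith
    · rw [neg (not_le.1 c3)]
      have := prod_compl_ge hθ e₁ e₂ le_rfl k₁ k₂ (by linarith) (by linarith)
      linarith
  push Not at c2
  rw [neg c2, neg (h₂.trans_lt c2)]
  by_cases c1 : 1 ≤ d₁
  · have f1 := le_of_one_le p₁ d₁ hp₁ c1
    rw [pos (by linarith : 1 ≤ d₁ + d₂ + d₃), pos (by linarith : 1 ≤ d₁ + d₂),
      pos (by linarith : 1 ≤ d₁ + d₃), pos c1]
    by_cases c : 1 ≤ d₂ + d₃
    · rw [pos c]
      have g3 : p₃ * (1 - d₂) ≤ p₃ * d₃ := mul_le_mul_of_nonneg_left (by linarith) hp₃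
      have := prob_single_or_pair_le hθ hp₁ f1 k₁ hp₂ hq₂ hp₃ hq₃ (by linarith) c2 k₂
        (by linarith) (by linarith)
      linarith
    · rw [neg (not_le.1 c)]
      linarith
  push Not at c1
  rw [neg c1]
  by_cases c23 : 1 ≤ d₂ + d₃
  · rw [pos (by linarith : 1 ≤ d₁ + d₂ + d₃), pos (by linarith : 1 ≤ d₁ + d₂),
      pos (by linarith : 1 ≤ d₁ + d₃), pos c23]
    -- the least of the three values may be lowered to `1/2`
    obtain ⟨δ, hδ0, hδ3, hδh, hδ2⟩ : ∃ δ : ℝ, 0 ≤ δ ∧ δ ≤ d₃ ∧ δ ≤ 1 / 2 ∧ 1 - δ ≤ d₂ := by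
      by_cases c : d₃ ≤ 1 / 2
      · exact ⟨d₃, h₃, le_rfl, c, by linarith⟩
      · exact ⟨1 / 2, by norm_num, by linarith, le_rfl, by linarith⟩
    have hx : 0 < 1 - δ := by linarith
    have g1 : p₁ * (1 - δ) ≤ p₁ * d₁ := mul_le_mul_of_nonneg_left (by linarith) hp₁
    have g2 : p₂ * (1 - δ) ≤ p₂ * d₂ := mul_le_mul_of_nonneg_left hδ2 hp₂
    have g3 : p₃ * δ ≤ p₃ * d₃ := mul_le_mul_of_nonneg_left hδ3 hp₃
    have i1 : p₁ ≤ θ / (1 - δ) := (le_div_iff₀ hx).2 (by linarith)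
    have i2 : p₂ ≤ θ / (1 - δ) := (le_div_iff₀ hx).2 (by linarith)
    have key : p₃ * (p₁ + p₂) + (1 - 2 * p₃) * (p₁ * p₂) ≤ 5 / 9 := by
      by_cases c : 1 / 2 ≤ p₃
      · exact prob_two_of_three_le c hq₃ hp₁ hp₂ i1 i2
          (mul_add_le_of_split hq₃ hp₃ (by linarith) (by linarith) (by linarith))
      · refine prob_two_of_three_le_of_lt_half hp₃ (by linarith) hp₁ hp₂ i1 i2 ?_
        have e : p₁ + p₂ + θ / (1 - δ) = ((p₁ + p₂) * (1 - δ) + θ) / (1 - δ) := by field_simp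
        rw [e, div_le_iff₀ hx]
        nlinarith [mul_nonneg (sub_nonneg.2 hq₃) (by linarith : 0 ≤ 1 - 2 * δ)]
    linarith
  rw [neg (not_le.1 c23)]
  by_cases c13 : 1 ≤ d₁ + d₃
  · rw [pos (by linarith : 1 ≤ d₁ + d₂ + d₃), pos (by linarith : 1 ≤ d₁ + d₂), pos c13]
    have hx : 0 < 1 - d₁ := by linarith
    have g2 : p₂ * (1 - d₁) ≤ p₂ * d₂ := mul_le_mul_of_nonneg_left (by linarith) hp₂
    have g3 : p₃ * (1 - d₁) ≤ p₃ * d₃ := mul_le_mul_of_nonneg_left (by linarith) hp₃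
    have hq : 0 ≤ (1 - p₂) * (1 - p₃) := mul_nonneg (by linarith) (by linarith)
    by_cases c : 1 / 2 ≤ p₁
    · have := prob_two_of_three_le c hq₁ hp₂ hp₃ ((le_div_iff₀ hx).2 (by linarith))
        ((le_div_iff₀ hx).2 (by linarith))
        (mul_add_le_of_split hq₁ hp₁ c1 k₁ (by linarith))
      nlinarith [mul_nonneg (sub_nonneg.2 hq₁) (mul_nonneg hp₂ hp₃)]
    · nlinarith [mul_nonneg hp₁ hq]
  rw [neg (not_le.1 c13)]
  by_cases c12 : 1 ≤ d₁ + d₂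
  · rw [pos (by linarith : 1 ≤ d₁ + d₂ + d₃), pos c12]
    have g2 : p₂ * (1 - d₁) ≤ p₂ * d₂ := mul_le_mul_of_nonneg_left (by linarith) hp₂
    have := prob_pair_le_half hθ hp₁ hq₁ hq₂ (by linarith) c1 k₁ (by linarith)
    linarith
  rw [neg (not_le.1 c12)]
  by_cases c123 : 1 ≤ d₁ + d₂ + d₃
  · rw [pos c123]
    have hP : 0 ≤ p₂ * p₃ := mul_nonneg hp₂ hp₃
    have hP1 : p₂ * p₃ ≤ 1 := mul_le_one₀ hq₂ hp₃ hq₃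
    have g2 : p₂ * p₃ * d₂ ≤ p₂ * d₂ :=
      mul_le_mul_of_nonneg_right (mul_le_of_le_one_right hp₂ hq₃) (by linarith)
    have g3 : p₂ * p₃ * d₃ ≤ p₃ * d₃ :=
      mul_le_mul_of_nonneg_right (mul_le_of_le_one_left hp₃ hq₂) h₃
    have g : p₂ * p₃ * (1 - d₁) ≤ p₂ * p₃ * (d₂ + d₃) :=
      mul_le_mul_of_nonneg_left (by linarith) hP
    have := prob_pair_le_half hθ hp₁ hq₁ hP1 (by linarith) c1 k₁ (by linarith)
    linarith
  · rw [neg (not_le.1 c123)]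
    linarith

/-- Three independent Bernoulli variables with weights `dᵢ` have an overload with probability at most
`5/9 = 1 - (2/3)²`, if their means are at most `θ ≥ 1/3` and sum up to at most `1 - θ`. -/
theorem overloadProb_le {θ p₁ d₁ p₂ d₂ p₃ d₃ : ℝ} (hθ : 1 / 3 ≤ θ)
    (hp₁ : 0 ≤ p₁) (hq₁ : p₁ ≤ 1) (hp₂ : 0 ≤ p₂) (hq₂ : p₂ ≤ 1) (hp₃ : 0 ≤ p₃) (hq₃ : p₃ ≤ 1)
    (h₁ : 0 ≤ d₁) (h₂ : 0 ≤ d₂) (h₃ : 0 ≤ d₃)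
    (k₁ : p₁ * d₁ ≤ θ) (k₂ : p₂ * d₂ ≤ θ) (k₃ : p₃ * d₃ ≤ θ)
    (hs : p₁ * d₁ + p₂ * d₂ + p₃ * d₃ ≤ 1 - θ) :
    overloadProb p₁ d₁ p₂ d₂ p₃ d₃ ≤ 5 / 9 := by
  rcases le_total d₁ d₂ with a | a <;> rcases le_total d₂ d₃ with b | b <;>
    rcases le_total d₁ d₃ with c | c
  · rw [overloadProb_swap_left, overloadProb_swap_right, overloadProb_swap_left]
    exact overloadProb_le_of_sorted hθ hp₃ hq₃ hp₂ hq₂ hp₁ hq₁ h₁ a b k₃ k₂ k₁ (by linarith)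
  · rw [overloadProb_swap_left, overloadProb_swap_right, overloadProb_swap_left]
    exact overloadProb_le_of_sorted hθ hp₃ hq₃ hp₂ hq₂ hp₁ hq₁ h₁ a b k₃ k₂ k₁ (by linarith)
  · rw [overloadProb_swap_left, overloadProb_swap_right]
    exact overloadProb_le_of_sorted hθ hp₂ hq₂ hp₃ hq₃ hp₁ hq₁ h₁ c b k₂ k₃ k₁ (by linarith)
  · rw [overloadProb_swap_left]
    exact overloadProb_le_of_sorted hθ hp₂ hq₂ hp₁ hq₁ hp₃ hq₃ h₃ c a k₂ k₁ k₃ (by linarith)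
  · rw [overloadProb_swap_right, overloadProb_swap_left]
    exact overloadProb_le_of_sorted hθ hp₃ hq₃ hp₁ hq₁ hp₂ hq₂ h₂ a c k₃ k₁ k₂ (by linarith)
  · rw [overloadProb_swap_right]
    exact overloadProb_le_of_sorted hθ hp₁ hq₁ hp₃ hq₃ hp₂ hq₂ h₂ b c k₁ k₃ k₂ (by linarith)
  · exact overloadProb_le_of_sorted hθ hp₁ hq₁ hp₂ hq₂ hp₃ hq₃ h₃ b a k₁ k₂ k₃ (by linarith)
  · exact overloadProb_le_of_sorted hθ hp₁ hq₁ hp₂ hq₂ hp₃ hq₃ h₃ b a k₁ k₂ k₃ (by linarith)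

/-! ### Three independent variables -/

open Finset in
/-- An upper bound for the expectation of `g` under every two-point law on `[0, ∞)` of mean at most
`m` holds for every finite law on `[0, ∞)` of mean at most `m`: the bound on the two-point laws
provides a line through `(m, C)` above the graph of `g`. -/
theorem sum_mul_le_of_two_point {Ω : Type*} [Fintype Ω] {w y : Ω → ℝ} {m C : ℝ} {g : ℝ → ℝ}
    (hw : ∀ i, 0 ≤ w i) (hw1 : ∑ i, w i = 1) (hy : ∀ i, 0 ≤ y i) (hm : ∑ i, w i * y i ≤ m)
    (h : ∀ p l u : ℝ, 0 ≤ p → p ≤ 1 → 0 ≤ l → l ≤ u → (1 - p) * l + p * u ≤ m →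
      (1 - p) * g l + p * g u ≤ C) :
    ∑ i, w i * g (y i) ≤ C := by
  classical
  have point : ∀ i, y i ≤ m → g (y i) ≤ C := fun i hi => by
    simpa using h 0 (y i) (y i) le_rfl zero_le_one (hy i) le_rfl (by linarith)
  suffices hκ : ∃ κ : ℝ, 0 ≤ κ ∧ ∀ i, g (y i) ≤ C + κ * (y i - m) by
    obtain ⟨κ, hκ0, hκ⟩ := hκ
    calc ∑ i, w i * g (y i) ≤ ∑ i, w i * (C + κ * (y i - m)) :=
          sum_le_sum fun i _ => mul_le_mul_of_nonneg_left (hκ i) (hw i)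
      _ = (∑ i, w i) * (C - κ * m) + κ * ∑ i, w i * y i := by
          rw [sum_mul, mul_sum, ← sum_add_distrib]
          exact sum_congr rfl fun i _ => by ring
      _ ≤ C := by rw [hw1]; nlinarith [mul_le_mul_of_nonneg_left hm hκ0]
  rcases (univ.filter fun i => m < y i).eq_empty_or_nonempty with hU | hU
  · refine ⟨0, le_rfl, fun i => ?_⟩
    have : ¬ m < y i := fun hi => by
      have : i ∈ univ.filter fun i => m < y i := by simp [hi]
      simp [hU] at this
    simpa using point i (not_lt.1 this)
  obtain ⟨b, hb, hmax⟩ := exists_max_image _ (fun i => (g (y i) - C) / (y i - m)) hU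
  have hbm : 0 < y b - m := by simpa using hb
  set κ := (g (y b) - C) / (y b - m) with hκ
  have hgb : g (y b) = C + κ * (y b - m) := by
    rw [hκ, div_mul_cancel₀ _ hbm.ne']
    ring
  have up : ∀ i, m < y i → g (y i) ≤ C + κ * (y i - m) := fun i hi => by
    have := hmax i (by simp [hi])
    rw [div_le_iff₀ (by linarith)] at this
    linarith
  by_cases hκ0 : 0 ≤ κ
  · refine ⟨κ, hκ0, fun i => ?_⟩
    by_cases hi : m < y i
    · exact up i hi
    push Not at hi
    have hpos : 0 < y b - y i := by linarith
    have := h ((m - y i) / (y b - y i)) (y i) (y b) (div_nonneg (by linarith) hpos.le)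
      ((div_le_one hpos).2 (by linarith)) (hy i) (by linarith) (by
        apply le_of_eq
        field_simp
        ring)
    have e : (1 - (m - y i) / (y b - y i)) * g (y i) + (m - y i) / (y b - y i) * g (y b)
        = ((y b - m) * g (y i) + (m - y i) * g (y b)) / (y b - y i) := by
      field_simp
      ring
    rw [e, div_le_iff₀ hpos, hgb] at this
    have h2 : (y b - m) * g (y i) ≤ (y b - m) * (C + κ * (y i - m)) := by linarith
    exact le_of_mul_le_mul_left h2 hbm
  · push Not at hκ0
    refine ⟨0, le_rfl, fun i => ?_⟩
    rw [zero_mul, add_zero]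
    by_cases hi : m < y i
    · nlinarith [up i hi]
    · exact point i (not_lt.1 hi)

/-- The bound for three two-point laws: subtracting the lower values and rescaling the threshold to `1`
turns them into weighted Bernoulli variables. -/
theorem overload_two_point_le {m₁ m₂ m₃ p₁ p₂ p₃ l₁ l₂ l₃ u₁ u₂ u₃ : ℝ}
    (b₁ : m₁ ≤ 1 / 3) (b₂ : m₂ ≤ 1 / 3) (b₃ : m₃ ≤ 1 / 3) (hm : m₁ + m₂ + m₃ ≤ 2 / 3)
    (hp₁ : 0 ≤ p₁) (hq₁ : p₁ ≤ 1) (hp₂ : 0 ≤ p₂) (hq₂ : p₂ ≤ 1) (hp₃ : 0 ≤ p₃) (hq₃ : p₃ ≤ 1)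
    (hl₁ : 0 ≤ l₁) (hl₂ : 0 ≤ l₂) (hl₃ : 0 ≤ l₃) (h₁ : l₁ ≤ u₁) (h₂ : l₂ ≤ u₂) (h₃ : l₃ ≤ u₃)
    (k₁ : (1 - p₁) * l₁ + p₁ * u₁ ≤ m₁) (k₂ : (1 - p₂) * l₂ + p₂ * u₂ ≤ m₂)
    (k₃ : (1 - p₃) * l₃ + p₃ * u₃ ≤ m₃) :
    (1 - p₃) * ((1 - p₂) * ((1 - p₁) * overload (l₁ + l₂ + l₃) + p₁ * overload (u₁ + l₂ + l₃))
        + p₂ * ((1 - p₁) * overload (l₁ + u₂ + l₃) + p₁ * overload (u₁ + u₂ + l₃)))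
      + p₃ * ((1 - p₂) * ((1 - p₁) * overload (l₁ + l₂ + u₃) + p₁ * overload (u₁ + l₂ + u₃))
        + p₂ * ((1 - p₁) * overload (l₁ + u₂ + u₃) + p₁ * overload (u₁ + u₂ + u₃))) ≤ 5 / 9 := by
  have g₁ : p₁ * (u₁ - l₁) ≤ m₁ - l₁ := by linarith
  have g₂ : p₂ * (u₂ - l₂) ≤ m₂ - l₂ := by linarith
  have g₃ : p₃ * (u₃ - l₃) ≤ m₃ - l₃ := by linarith
  have n₁ : 0 ≤ p₁ * (u₁ - l₁) := mul_nonneg hp₁ (by linarith)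
  have n₂ : 0 ≤ p₂ * (u₂ - l₂) := mul_nonneg hp₂ (by linarith)
  have n₃ : 0 ≤ p₃ * (u₃ - l₃) := mul_nonneg hp₃ (by linarith)
  -- what is left below the threshold once the lower values are subtracted
  obtain ⟨c, hc⟩ : ∃ c, c = 1 - l₁ - l₂ - l₃ := ⟨_, rfl⟩
  have hc0 : 0 < c := by linarith
  have scale : ∀ s t : ℝ, s = l₁ + l₂ + l₃ + t → overload s = overload (t / c) := fun s t h => by
    unfold overload
    refine if_congr ?_ rfl rfl
    rw [le_div_iff₀ hc0]
    constructor <;> intro <;> linarith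
  rw [scale (l₁ + l₂ + l₃) 0 (by ring), scale (u₁ + l₂ + l₃) (u₁ - l₁) (by ring),
    scale (l₁ + u₂ + l₃) (u₂ - l₂) (by ring), scale (l₁ + l₂ + u₃) (u₃ - l₃) (by ring),
    scale (u₁ + u₂ + l₃) ((u₁ - l₁) + (u₂ - l₂)) (by ring),
    scale (u₁ + l₂ + u₃) ((u₁ - l₁) + (u₃ - l₃)) (by ring),
    scale (l₁ + u₂ + u₃) ((u₂ - l₂) + (u₃ - l₃)) (by ring),
    scale (u₁ + u₂ + u₃) ((u₁ - l₁) + (u₂ - l₂) + (u₃ - l₃)) (by ring)]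
  have h0 : overload (0 / c) = 0 := by
    rw [zero_div]
    exact if_neg (by norm_num)
  have hθ : 1 / 3 / c * c = 1 / 3 := div_mul_cancel₀ _ hc0.ne'
  have key := overloadProb_le (θ := 1 / 3 / c) (p₁ := p₁) (d₁ := (u₁ - l₁) / c) (p₂ := p₂)
    (d₂ := (u₂ - l₂) / c) (p₃ := p₃) (d₃ := (u₃ - l₃) / c)
    ((le_div_iff₀ hc0).2 (by linarith)) hp₁ hq₁ hp₂ hq₂ hp₃ hq₃
    (div_nonneg (by linarith) hc0.le) (div_nonneg (by linarith) hc0.le)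
    (div_nonneg (by linarith) hc0.le)
    (by rw [← mul_div_assoc]; exact div_le_div_of_nonneg_right (by linarith) hc0.le)
    (by rw [← mul_div_assoc]; exact div_le_div_of_nonneg_right (by linarith) hc0.le)
    (by rw [← mul_div_assoc]; exact div_le_div_of_nonneg_right (by linarith) hc0.le)
    (by
      rw [← mul_div_assoc, ← mul_div_assoc, ← mul_div_assoc, ← add_div, ← add_div,
        div_le_iff₀ hc0, sub_mul, hθ]
      linarith)
  unfold overloadProb at key
  rw [← add_div, ← add_div, ← add_div, ← add_div] at key
  rw [h0]
  linarith

open Finset in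
/-- A case of Samuels' conjecture: the sum of three independent nonnegative variables whose means
are at most `1/3`, with total at most `2/3`, reaches `1` with probability at most `5/9`.
Two indicators of probability `1/3` attain the bound. -/
theorem three_indep_overload_le {Ω₁ Ω₂ Ω₃ : Type*} [Fintype Ω₁] [Fintype Ω₂] [Fintype Ω₃]
    {w₁ y₁ : Ω₁ → ℝ} {w₂ y₂ : Ω₂ → ℝ} {w₃ y₃ : Ω₃ → ℝ} {m₁ m₂ m₃ : ℝ}
    (hw₁ : ∀ i, 0 ≤ w₁ i) (hw₂ : ∀ i, 0 ≤ w₂ i) (hw₃ : ∀ i, 0 ≤ w₃ i)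
    (s₁ : ∑ i, w₁ i = 1) (s₂ : ∑ i, w₂ i = 1) (s₃ : ∑ i, w₃ i = 1)
    (hy₁ : ∀ i, 0 ≤ y₁ i) (hy₂ : ∀ i, 0 ≤ y₂ i) (hy₃ : ∀ i, 0 ≤ y₃ i)
    (e₁ : ∑ i, w₁ i * y₁ i ≤ m₁) (e₂ : ∑ i, w₂ i * y₂ i ≤ m₂) (e₃ : ∑ i, w₃ i * y₃ i ≤ m₃)
    (b₁ : m₁ ≤ 1 / 3) (b₂ : m₂ ≤ 1 / 3) (b₃ : m₃ ≤ 1 / 3) (hm : m₁ + m₂ + m₃ ≤ 2 / 3) :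
    ∑ i, w₁ i * ∑ j, w₂ j * ∑ k, w₃ k * overload (y₁ i + y₂ j + y₃ k) ≤ 5 / 9 := by
  refine sum_mul_le_of_two_point (g := fun t => ∑ j, w₂ j * ∑ k, w₃ k * overload (t + y₂ j + y₃ k))
    hw₁ s₁ hy₁ e₁ ?_
  intro p₁ l₁ u₁ hp₁ hq₁ hl₁ h₁ k₁
  have r : (1 - p₁) * (∑ j, w₂ j * ∑ k, w₃ k * overload (l₁ + y₂ j + y₃ k))
      + p₁ * (∑ j, w₂ j * ∑ k, w₃ k * overload (u₁ + y₂ j + y₃ k))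
      = ∑ j, w₂ j * ((1 - p₁) * (∑ k, w₃ k * overload (l₁ + y₂ j + y₃ k))
        + p₁ * ∑ k, w₃ k * overload (u₁ + y₂ j + y₃ k)) := by
    rw [mul_sum, mul_sum, ← sum_add_distrib]
    exact sum_congr rfl fun j _ => by ring
  refine r.trans_le (sum_mul_le_of_two_point
    (g := fun t => (1 - p₁) * (∑ k, w₃ k * overload (l₁ + t + y₃ k))
        + p₁ * ∑ k, w₃ k * overload (u₁ + t + y₃ k)) hw₂ s₂ hy₂ e₂ ?_)
  intro p₂ l₂ u₂ hp₂ hq₂ hl₂ h₂ k₂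
  have r : (1 - p₂) * ((1 - p₁) * (∑ k, w₃ k * overload (l₁ + l₂ + y₃ k))
        + p₁ * ∑ k, w₃ k * overload (u₁ + l₂ + y₃ k))
      + p₂ * ((1 - p₁) * (∑ k, w₃ k * overload (l₁ + u₂ + y₃ k))
        + p₁ * ∑ k, w₃ k * overload (u₁ + u₂ + y₃ k))
      = ∑ k, w₃ k * ((1 - p₂) * ((1 - p₁) * overload (l₁ + l₂ + y₃ k)
        + p₁ * overload (u₁ + l₂ + y₃ k)) + p₂ * ((1 - p₁) * overload (l₁ + u₂ + y₃ k)
        + p₁ * overload (u₁ + u₂ + y₃ k))) := by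
    simp only [mul_sum, ← sum_add_distrib]
    exact sum_congr rfl fun j _ => by ring
  refine r.trans_le (sum_mul_le_of_two_point
    (g := fun t => (1 - p₂) * ((1 - p₁) * overload (l₁ + l₂ + t)
        + p₁ * overload (u₁ + l₂ + t)) + p₂ * ((1 - p₁) * overload (l₁ + u₂ + t)
        + p₁ * overload (u₁ + u₂ + t))) hw₃ s₃ hy₃ e₃ ?_)
  intro p₃ l₃ u₃ hp₃ hq₃ hl₃ h₃ k₃
  exact overload_two_point_le b₁ b₂ b₃ hm hp₁ hq₁ hp₂ hq₂ hp₃ hq₃ hl₁ hl₂ hl₃ h₁ h₂ h₃ k₁ k₂ k₃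

/-! ### Independent coordinates -/

/-- A probability weight on a finite type. -/
structure IsLaw {S : Type*} [Fintype S] (w : S → ℝ) : Prop where
  nonneg : ∀ s, 0 ≤ w s
  sum_eq_one : ∑ s, w s = 1

section ProductLaw

variable {ι : Type*} [Fintype ι] [DecidableEq ι] {S : ι → Type*} [∀ i, Fintype (S i)]

/-- The expectation of `f` when the coordinates are independent and the `i`-th one has law `w i`. -/
noncomputable def prodExp (w : ∀ i, S i → ℝ) (f : (∀ i, S i) → ℝ) : ℝ :=
  ∑ ω, (∏ i, w i (ω i)) * f ω

theorem prodExp_mono {w : ∀ i, S i → ℝ} (hw : ∀ i, IsLaw (w i)) {f g : (∀ i, S i) → ℝ}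
    (h : ∀ ω, (∀ i, w i (ω i) ≠ 0) → f ω ≤ g ω) : prodExp w f ≤ prodExp w g := by
  refine Finset.sum_le_sum fun ω _ => ?_
  by_cases h0 : ∀ i, w i (ω i) ≠ 0
  · exact mul_le_mul_of_nonneg_left (h ω h0) (Finset.prod_nonneg fun i _ => (hw i).nonneg _)
  · push Not at h0
    obtain ⟨i, hi⟩ := h0
    rw [Finset.prod_eq_zero (Finset.mem_univ i) hi, zero_mul, zero_mul]

theorem prodExp_add (w : ∀ i, S i → ℝ) (f g : (∀ i, S i) → ℝ) :
    prodExp w (fun ω => f ω + g ω) = prodExp w f + prodExp w g := by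
  simp only [prodExp, mul_add, Finset.sum_add_distrib]

theorem prodExp_sub (w : ∀ i, S i → ℝ) (f g : (∀ i, S i) → ℝ) :
    prodExp w (fun ω => f ω - g ω) = prodExp w f - prodExp w g := by
  simp only [prodExp, mul_sub, Finset.sum_sub_distrib]

theorem prodExp_const_mul (w : ∀ i, S i → ℝ) (c : ℝ) (f : (∀ i, S i) → ℝ) :
    prodExp w (fun ω => c * f ω) = c * prodExp w f := by
  simp only [prodExp, Finset.mul_sum]
  exact Finset.sum_congr rfl fun ω _ => by ring

theorem prodExp_sum {κ : Type*} (s : Finset κ) (w : ∀ i, S i → ℝ) (f : κ → (∀ i, S i) → ℝ) :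
    prodExp w (fun ω => ∑ k ∈ s, f k ω) = ∑ k ∈ s, prodExp w (f k) := by
  simp only [prodExp, Finset.mul_sum]
  exact Finset.sum_comm

theorem sum_prod_eq_one {w : ∀ i, S i → ℝ} (hw : ∀ i, IsLaw (w i)) :
    ∑ ω : ∀ i, S i, ∏ i, w i (ω i) = 1 := by
  have := Finset.prod_univ_sum (fun i => (Finset.univ : Finset (S i))) (fun i s => w i s)
  rw [Fintype.piFinset_univ] at this
  rw [← this]
  exact Finset.prod_eq_one fun i _ => (hw i).sum_eq_one

theorem prodExp_const {w : ∀ i, S i → ℝ} (hw : ∀ i, IsLaw (w i)) (c : ℝ) :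
    prodExp w (fun _ => c) = c := by
  rw [prodExp, ← Finset.sum_mul, sum_prod_eq_one hw, one_mul]

/-- Exchanging the `i`-th coordinate of a point with a separate copy of it permutes the pairs. -/
theorem sum_update_swap {M : Type*} [AddCommMonoid M] (i : ι) (F : (∀ i, S i) → S i → M) :
    ∑ ω, ∑ s, F (Function.update ω i s) (ω i) = ∑ ω, ∑ s, F ω s := by
  rw [← Fintype.sum_prod_type', ← Fintype.sum_prod_type']
  refine Fintype.sum_equiv
    { toFun := fun q => (Function.update q.1 i q.2, q.1 i)
      invFun := fun q => (Function.update q.1 i q.2, q.1 i)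
      left_inv := fun q => by simp
      right_inv := fun q => by simp } _ _ fun q => rfl

/-- Moving the `i`-th coordinate by the kernel `k` amounts to moving its law. -/
theorem prodExp_kernel (w : ∀ i, S i → ℝ) (i : ι) (k : S i → S i → ℝ) (f : (∀ i, S i) → ℝ) :
    prodExp w (fun ω => ∑ s, k (ω i) s * f (Function.update ω i s))
      = prodExp (Function.update w i fun s => ∑ r, w i r * k r s) f := by
  have hsplit : ∀ (v : ∀ i, S i → ℝ) (ω : ∀ i, S i),
      ∏ j, v j (ω j) = v i (ω i) * ∏ j ∈ Finset.univ.erase i, v j (ω j) := fun v ω =>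
    (Finset.mul_prod_erase _ _ (Finset.mem_univ i)).symm
  have := sum_update_swap i fun (ω : ∀ i, S i) (r : S i) =>
    w i r * (∏ j ∈ Finset.univ.erase i, w j (ω j)) * (k r (ω i) * f ω)
  calc prodExp w (fun ω => ∑ s, k (ω i) s * f (Function.update ω i s))
      = ∑ ω, ∑ s, w i (ω i) * (∏ j ∈ Finset.univ.erase i, w j (Function.update ω i s j)) *
          (k (ω i) (Function.update ω i s i) * f (Function.update ω i s)) := by
        refine Finset.sum_congr rfl fun ω _ => ?_
        rw [Finset.mul_sum, hsplit]
        refine Finset.sum_congr rfl fun s _ => ?_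
        rw [Function.update_self]
        congr 2
        exact Finset.prod_congr rfl fun j hj => by
          rw [Function.update_of_ne (Finset.ne_of_mem_erase hj)]
    _ = ∑ ω, ∑ r, w i r * (∏ j ∈ Finset.univ.erase i, w j (ω j)) * (k r (ω i) * f ω) := this
    _ = _ := by
        refine Finset.sum_congr rfl fun ω _ => ?_
        rw [hsplit, Function.update_self, Finset.sum_mul, Finset.sum_mul]
        refine Finset.sum_congr rfl fun r _ => ?_
        have : ∏ j ∈ Finset.univ.erase i,
            Function.update w i (fun s => ∑ r, w i r * k r s) j (ω j)
            = ∏ j ∈ Finset.univ.erase i, w j (ω j) :=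
          Finset.prod_congr rfl fun j hj => by
            rw [Function.update_of_ne (Finset.ne_of_mem_erase hj)]
        rw [this]
        ring

/-- The coordinates outside `A` may be drawn afresh. -/
theorem prodExp_piecewise {w : ∀ i, S i → ℝ} (hw : ∀ i, IsLaw (w i)) (A : Finset ι)
    (f : (∀ i, S i) → ℝ) :
    prodExp w (fun ω => prodExp w fun ω' => f (A.piecewise ω ω')) = prodExp w f := by
  have h1 : prodExp w (fun ω => prodExp w fun ω' => f (A.piecewise ω ω'))
      = ∑ q : (∀ i, S i) × (∀ i, S i),
        (∏ i, w i (q.1 i)) * (∏ i, w i (q.2 i)) * f (A.piecewise q.1 q.2) := by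
    rw [Fintype.sum_prod_type]
    refine Finset.sum_congr rfl fun ω _ => ?_
    simp only [prodExp, Finset.mul_sum]
    exact Finset.sum_congr rfl fun ω' _ => by ring
  have h2 : prodExp w f = ∑ q : (∀ i, S i) × (∀ i, S i),
      (∏ i, w i (q.1 i)) * (∏ i, w i (q.2 i)) * f q.1 := by
    rw [Fintype.sum_prod_type]
    refine Finset.sum_congr rfl fun ω _ => ?_
    simp only
    rw [← Finset.sum_mul, ← Finset.mul_sum, sum_prod_eq_one hw, mul_one]
  have hinv : ∀ q : (∀ i, S i) × (∀ i, S i),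
      (A.piecewise (A.piecewise q.1 q.2) (A.piecewise q.2 q.1),
        A.piecewise (A.piecewise q.2 q.1) (A.piecewise q.1 q.2)) = q := fun q => by
    refine Prod.ext (funext fun i => ?_) (funext fun i => ?_) <;> by_cases hi : i ∈ A <;> simp [hi]
  rw [h1, h2]
  have hperm : Function.Involutive fun q : (∀ i, S i) × (∀ i, S i) =>
      (A.piecewise q.1 q.2, A.piecewise q.2 q.1) := hinv
  refine Fintype.sum_equiv hperm.toPerm _ _ fun q => ?_
  simp only [Function.Involutive.coe_toPerm, ← Finset.prod_mul_distrib]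
  congr 1
  refine Finset.prod_congr rfl fun i _ => ?_
  by_cases hi : i ∈ A
  · simp [hi]
  · simp [hi, mul_comm]

theorem prodExp_coord {w : ∀ i, S i → ℝ} (hw : ∀ i, IsLaw (w i)) (i : ι) (g : S i → ℝ) :
    prodExp w (fun ω => g (ω i)) = ∑ s, w i s * g s := by
  have h := prodExp_kernel w i (fun _ s => w i s) fun ω => g (ω i)
  have hlaw : (fun s => ∑ r, w i r * w i s) = w i := by
    ext s
    rw [← Finset.sum_mul, (hw i).sum_eq_one, one_mul]
  rw [hlaw, Function.update_eq_self] at h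
  rw [← h]
  simp only [Function.update_self]
  exact prodExp_const hw _

theorem prodExp_mul {w : ∀ i, S i → ℝ} (hw : ∀ i, IsLaw (w i)) (i : ι) (f : S i → ℝ)
    (g : (∀ i, S i) → ℝ) (hg : ∀ ω s, g (Function.update ω i s) = g ω) :
    prodExp w (fun ω => f (ω i) * g ω) = (∑ s, w i s * f s) * prodExp w g := by
  rw [← prodExp_piecewise hw {i}]
  simp only [Finset.piecewise_singleton, Function.update_self, hg, prodExp_const_mul]
  have : ∀ ω : ∀ i, S i, f (ω i) * prodExp w g = prodExp w g * f (ω i) := fun ω => mul_comm _ _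
  simp only [this, prodExp_const_mul, prodExp_coord hw]
  ring

/-- Numbers that are at most `1/3`, of total at most `2/3`, can be put into three bins of capacity
`1/3`: fill the first bin as far as possible, and put one more number into the second bin. -/
theorem exists_three_bins {e : ι → ℝ} (h1 : ∀ i, e i ≤ 1 / 3)
    (h : ∑ i, e i ≤ 2 / 3) :
    ∃ A B : Finset ι, Disjoint A B ∧ ∑ i ∈ A, e i ≤ 1 / 3 ∧ ∑ i ∈ B, e i ≤ 1 / 3 ∧
      ∑ i ∈ (A ∪ B)ᶜ, e i ≤ 1 / 3 := by
  obtain ⟨A, hA, hmax⟩ := Finset.exists_max_image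
    ((Finset.univ : Finset (Finset ι)).filter fun A => ∑ i ∈ A, e i ≤ 1 / 3) Finset.card
    ⟨∅, by simp⟩
  have hA' : ∑ i ∈ A, e i ≤ 1 / 3 := by simpa using hA
  by_cases hu : A = Finset.univ
  · exact ⟨A, ∅, by simp, hA', by simp, by simp [hu]⟩
  obtain ⟨m, hm⟩ : ∃ m, m ∉ A := by
    by_contra hc
    push Not at hc
    exact hu (Finset.eq_univ_iff_forall.2 hc)
  refine ⟨A, {m}, by simpa using hm, hA', by simpa using h1 m, ?_⟩
  have hins : 1 / 3 < ∑ i ∈ insert m A, e i := by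
    by_contra hc
    have := hmax (insert m A) (by simpa using hc)
    rw [Finset.card_insert_of_notMem hm] at this
    omega
  have heq : insert m A = A ∪ {m} := by rw [Finset.insert_eq, Finset.union_comm]
  have := Finset.sum_add_sum_compl (A ∪ {m}) e
  rw [heq] at hins
  linarith

/-- The sum of independent nonnegative variables whose means are at most `1/3`, with total at most
`2/3`, reaches `1` with probability at most `5/9`. -/
theorem prodExp_overload_le {w : ∀ i, S i → ℝ} (hw : ∀ i, IsLaw (w i)) {y : ∀ i, S i → ℝ}
    (hy : ∀ i s, 0 ≤ y i s) (h1 : ∀ i, ∑ s, w i s * y i s ≤ 1 / 3)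
    (h : ∑ i, ∑ s, w i s * y i s ≤ 2 / 3) :
    prodExp w (fun ω => overload (∑ i, y i (ω i))) ≤ 5 / 9 := by
  obtain ⟨A, B, hAB, hA, hB, hC⟩ := exists_three_bins h1 h
  set C := (A ∪ B)ᶜ with hCdef
  -- the three bins are independent: draw the coordinates outside `A`, and then outside `B`, afresh
  have hsum : ∀ ω : ∀ i, S i, ∑ i, y i (ω i)
      = ∑ i ∈ A, y i (ω i) + ∑ i ∈ B, y i (ω i) + ∑ i ∈ C, y i (ω i) := fun ω => by
    rw [← Finset.sum_union hAB, Finset.sum_add_sum_compl]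
  have hin : ∀ (D : Finset ι) (ω ω' : ∀ i, S i),
      ∑ i ∈ D, y i (D.piecewise ω ω' i) = ∑ i ∈ D, y i (ω i) := fun D ω ω' =>
    Finset.sum_congr rfl fun i hi => by simp [hi]
  have hout : ∀ (D E : Finset ι), Disjoint D E → ∀ ω ω' : ∀ i, S i,
      ∑ i ∈ E, y i (D.piecewise ω ω' i) = ∑ i ∈ E, y i (ω' i) := fun D E hd ω ω' =>
    Finset.sum_congr rfl fun i hi => by simp [Finset.disjoint_right.1 hd hi]
  have hAC : Disjoint A C := by
    rw [hCdef]
    exact Finset.disjoint_left.2 fun i hi => by simp [hi]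
  have hBC : Disjoint B C := by
    rw [hCdef]
    exact Finset.disjoint_left.2 fun i hi => by simp [hi]
  have e1 : prodExp w (fun ω => overload (∑ i, y i (ω i)))
      = prodExp w fun ω₁ => prodExp w fun ω₂ => prodExp w fun ω₃ =>
        overload (∑ i ∈ A, y i (ω₁ i) + ∑ i ∈ B, y i (ω₂ i) + ∑ i ∈ C, y i (ω₃ i)) := by
    rw [← prodExp_piecewise hw A]
    congr 1
    ext ω₁
    rw [← prodExp_piecewise hw B]
    congr 1
    ext ω₂
    congr 1
    ext ω₃
    rw [hsum, hin A, hout A B hAB, hout A C hAC, hin B, hout B C hBC]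
  have hmean : ∀ D : Finset ι, ∑ ω : ∀ i, S i, (∏ i, w i (ω i)) * ∑ i ∈ D, y i (ω i)
      = ∑ i ∈ D, ∑ s, w i s * y i s := fun D => by
    have := prodExp_sum D w fun i ω => y i (ω i)
    rw [prodExp] at this
    rw [this]
    exact Finset.sum_congr rfl fun i _ => prodExp_coord hw i _
  rw [e1]
  have hW : ∀ ω : ∀ i, S i, 0 ≤ ∏ i, w i (ω i) := fun ω =>
    Finset.prod_nonneg fun i _ => (hw i).nonneg _
  refine three_indep_overload_le hW hW hW (sum_prod_eq_one hw) (sum_prod_eq_one hw)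
    (sum_prod_eq_one hw) (fun ω => Finset.sum_nonneg fun i _ => hy i _)
    (fun ω => Finset.sum_nonneg fun i _ => hy i _) (fun ω => Finset.sum_nonneg fun i _ => hy i _)
    (hmean A).le (hmean B).le (hmean C).le hA hB hC ?_
  rw [← Finset.sum_union hAB, Finset.sum_add_sum_compl]
  exact h

end ProductLaw

/-! ### A single arm -/

/-- A randomized policy for a single arm with node set `N`, without regard to the other arms: in
its time step `τ + 1`, on node `u`, it plays action `a` with probability `act τ u a`. -/
structure ArmPolicy (N A : Type*) [Fintype N] [Fintype A] where
  root : N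
  act : ℕ → N → A → ℝ
  move : N → A → N → ℝ
  act_nonneg : ∀ τ u a, 0 ≤ act τ u a
  act_sum_le : ∀ τ u, ∑ a, act τ u a ≤ 1
  move_nonneg : ∀ u a v, 0 ≤ move u a v
  move_sum : ∀ u a, ∑ v, move u a v = 1

/-- The state of an arm: the number of time steps of its policy that have been simulated (its
virtual time), the number of plays so far, and the node. -/
abbrev ArmState (B : ℕ) (N : Type*) : Type _ := Fin (B + 1) × Fin (B + 1) × N

/-- The successor, cut off at `B`. -/
def bump {B : ℕ} (k : Fin (B + 1)) : Fin (B + 1) := ⟨min (k + 1) B, by omega⟩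

theorem bump_val {B : ℕ} {k : Fin (B + 1)} (h : k.val < B) : (bump k).val = k + 1 := by
  simp only [bump]
  omega

theorem le_bump {B : ℕ} (k : Fin (B + 1)) : k.val ≤ (bump k).val := by
  simp only [bump]
  omega

theorem bump_le {B : ℕ} (k : Fin (B + 1)) : (bump k).val ≤ k + 1 := by
  simp only [bump]
  omega

/-- In round `t`, an arm is advanced while its virtual time is at most `t` or less than twice the
number of its plays. -/
def Enabled {B : ℕ} {N : Type*} (t : ℕ) (s : ArmState B N) : Prop :=
  s.1.val < B ∧ (s.1.val ≤ t ∨ s.1.val < 2 * s.2.1.val)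

instance {B : ℕ} {N : Type*} (t : ℕ) (s : ArmState B N) : Decidable (Enabled t s) :=
  inferInstanceAs (Decidable (_ ∧ _))

namespace ArmPolicy

variable {N A : Type*} [Fintype N] [DecidableEq N] [Fintype A] {B : ℕ} (M : ArmPolicy N A)

/-- The mean of `g` after the simulation of one time step from the state `s`. -/
noncomputable def stepMean (g : ArmState B N → ℝ) (s : ArmState B N) : ℝ :=
  ∑ a, M.act s.1 s.2.2 a * ∑ v, M.move s.2.2 a v * g (bump s.1, bump s.2.1, v)
    + (1 - ∑ a, M.act s.1 s.2.2 a) * g (bump s.1, s.2.1, s.2.2)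

omit [DecidableEq N] in
theorem stepMean_mono {g h : ArmState B N → ℝ} {s : ArmState B N}
    (h1 : ∀ v, g (bump s.1, bump s.2.1, v) ≤ h (bump s.1, bump s.2.1, v))
    (h2 : g (bump s.1, s.2.1, s.2.2) ≤ h (bump s.1, s.2.1, s.2.2)) :
    M.stepMean g s ≤ M.stepMean h s := by
  unfold stepMean
  have := M.act_sum_le s.1 s.2.2
  gcongr with a _ v _
  · exact M.act_nonneg _ _ _
  · exact M.move_nonneg _ _ _
  · exact h1 v

omit [DecidableEq N] in
theorem stepMean_const (c : ℝ) (s : ArmState B N) : M.stepMean (fun _ => c) s = c := by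
  simp only [stepMean, ← Finset.sum_mul, M.move_sum, one_mul]
  ring

/-- The transition probabilities of an arm in round `t`. -/
noncomputable def kernel (t : ℕ) (s r : ArmState B N) : ℝ :=
  if Enabled t s then M.stepMean (fun q => if r = q then 1 else 0) s else if r = s then 1 else 0

theorem sum_kernel_mul (t : ℕ) (s : ArmState B N) (g : ArmState B N → ℝ) :
    ∑ r, M.kernel t s r * g r = if Enabled t s then M.stepMean g s else g s := by
  unfold kernel
  split_ifs with h
  · simp only [stepMean, add_mul, Finset.sum_add_distrib, Finset.sum_mul, Finset.mul_sum]
    congr 1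
    · rw [Finset.sum_comm]
      refine Finset.sum_congr rfl fun a _ => ?_
      rw [Finset.sum_comm]
      refine Finset.sum_congr rfl fun v _ => ?_
      simp [mul_assoc]
    · simp
  · simp

theorem kernel_nonneg (t : ℕ) (s r : ArmState B N) : 0 ≤ M.kernel t s r := by
  unfold kernel
  split_ifs with h
  · exact (M.stepMean_const 0 s).symm.le.trans
      (M.stepMean_mono (fun v => by split_ifs <;> norm_num) (by split_ifs <;> norm_num))
  · norm_num
  · norm_num

/-- The law of the state of an arm after one more move in round `t`. -/
noncomputable def moveLaw (t : ℕ) (w : ArmState B N → ℝ) (r : ArmState B N) : ℝ :=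
  ∑ s, w s * M.kernel t s r

theorem sum_moveLaw_mul (t : ℕ) (w g : ArmState B N → ℝ) :
    ∑ r, M.moveLaw t w r * g r = ∑ s, w s * if Enabled t s then M.stepMean g s else g s := by
  simp only [moveLaw, Finset.sum_mul]
  rw [Finset.sum_comm]
  refine Finset.sum_congr rfl fun s _ => ?_
  rw [← sum_kernel_mul, Finset.mul_sum]
  exact Finset.sum_congr rfl fun r _ => by ring

theorem isLaw_moveLaw {t : ℕ} {w : ArmState B N → ℝ} (hw : IsLaw w) : IsLaw (M.moveLaw t w) where
  nonneg r := Finset.sum_nonneg fun s _ => mul_nonneg (hw.nonneg s) (M.kernel_nonneg t s r)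
  sum_eq_one := by
    have := M.sum_moveLaw_mul t w fun _ => 1
    simp only [mul_one, stepMean_const, ite_self] at this
    rw [this, hw.sum_eq_one]

theorem sum_moveLaw_mul_le {t : ℕ} {w g : ArmState B N → ℝ} (hw : IsLaw w)
    (h : ∀ s, Enabled t s → M.stepMean g s ≤ g s) :
    ∑ r, M.moveLaw t w r * g r ≤ ∑ s, w s * g s := by
  rw [sum_moveLaw_mul]
  refine Finset.sum_le_sum fun s _ => mul_le_mul_of_nonneg_left ?_ (hw.nonneg s)
  split_ifs with hs
  · exact h s hs
  · exact le_rfl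

theorem support_moveLaw {t : ℕ} {w : ArmState B N → ℝ} {P Q : ArmState B N → Prop}
    (hw : ∀ s, w s ≠ 0 → P s) (h0 : ∀ s, P s → ¬ Enabled t s → Q s)
    (h1 : ∀ s v, P s → Enabled t s → Q (bump s.1, bump s.2.1, v))
    (h2 : ∀ s, P s → Enabled t s → Q (bump s.1, s.2.1, s.2.2)) :
    ∀ s, M.moveLaw t w s ≠ 0 → Q s := by
  intro r hr
  obtain ⟨s, -, hs⟩ := Finset.exists_ne_zero_of_sum_ne_zero hr
  have hP := hw s (left_ne_zero_of_mul hs)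
  have hk := right_ne_zero_of_mul hs
  by_contra hQ
  apply hk
  unfold kernel
  split_ifs with he hrs
  · have e1 : ∀ v, r ≠ (bump s.1, bump s.2.1, v) := fun v hv => hQ (hv ▸ h1 s v hP he)
    have e2 : r ≠ (bump s.1, s.2.1, s.2.2) := fun hv => hQ (hv ▸ h2 s hP he)
    simp [stepMean, e1, e2]
  · exact absurd (hrs ▸ h0 s hP he) hQ
  · rfl

/-- With probability `1/3` an arm starts at virtual time `0`; otherwise its virtual time is set to
`B`, so that it is never advanced. -/
noncomputable def initLaw (B : ℕ) (s : ArmState B N) : ℝ :=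
  (if s = (0, 0, M.root) then 1 / 3 else 0) + if s = (Fin.last B, 0, M.root) then 2 / 3 else 0

/-- The law of the state of an arm after `t` rounds of `B` moves. -/
noncomputable def lawAt (B : ℕ) : ℕ → ArmState B N → ℝ
  | 0 => M.initLaw B
  | t + 1 => (M.moveLaw t)^[B] (lawAt B t)

theorem sum_initLaw_mul (g : ArmState B N → ℝ) :
    ∑ s, M.initLaw B s * g s = 1 / 3 * g (0, 0, M.root) + 2 / 3 * g (Fin.last B, 0, M.root) := by
  simp [initLaw, add_mul, Finset.sum_add_distrib]

theorem isLaw_initLaw : IsLaw (M.initLaw B) where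
  nonneg s := by unfold initLaw; split_ifs <;> norm_num
  sum_eq_one := by
    have := M.sum_initLaw_mul (B := B) fun _ => 1
    simp only [mul_one] at this
    rw [this]
    norm_num

theorem isLaw_iterate_moveLaw {t : ℕ} {w : ArmState B N → ℝ} (hw : IsLaw w) (k : ℕ) :
    IsLaw ((M.moveLaw t)^[k] w) := by
  induction k with
  | zero => exact hw
  | succ k ih =>
    rw [Function.iterate_succ_apply']
    exact M.isLaw_moveLaw ih

theorem isLaw_lawAt (t : ℕ) : IsLaw (M.lawAt B t) := by
  induction t with
  | zero => exact M.isLaw_initLaw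
  | succ t ih => exact M.isLaw_iterate_moveLaw ih B

theorem sum_lawAt_mul_le {t : ℕ} {g : ArmState B N → ℝ}
    (h : ∀ t' < t, ∀ s, Enabled t' s → M.stepMean g s ≤ g s) :
    ∑ s, M.lawAt B t s * g s ≤ ∑ s, M.initLaw B s * g s := by
  induction t with
  | zero => exact le_rfl
  | succ t ih =>
    refine le_trans ?_ (ih fun t' ht' => h t' (by omega))
    suffices ∀ k, ∑ s, (M.moveLaw t)^[k] (M.lawAt B t) s * g s ≤ ∑ s, M.lawAt B t s * g s from
      this B
    intro k
    induction k with
    | zero => exact le_rfl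
    | succ k ihk =>
      rw [Function.iterate_succ_apply']
      exact (M.sum_moveLaw_mul_le (M.isLaw_iterate_moveLaw (M.isLaw_lawAt t) k)
        (h t (by omega))).trans ihk

/-- In round `t`, an arm that is still to be advanced has been played at most
`τ - t / 2` times. -/
theorem iterate_moveLaw_support {t : ℕ} {w : ArmState B N → ℝ}
    (hw : ∀ s, w s ≠ 0 → Enabled t s → 2 * s.2.1.val + t ≤ 2 * s.1.val) (k : ℕ) :
    ∀ s, (M.moveLaw t)^[k] w s ≠ 0 →
      Enabled t s → 2 * s.2.1.val + t ≤ 2 * s.1.val ∧ k ≤ s.1.val := by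
  induction k with
  | zero => exact fun s hs he => ⟨hw s hs he, by omega⟩
  | succ k ih =>
    rw [Function.iterate_succ_apply']
    refine M.support_moveLaw ih (fun s _ hn he => absurd he hn) ?_ ?_
    · intro s v hP he _
      have := hP he
      have h1 := bump_val he.1
      have h2 := bump_le s.2.1
      constructor <;> dsimp only <;> omega
    · intro s hP he _
      have := hP he
      have h1 := bump_val he.1
      constructor <;> dsimp only <;> omega

theorem lawAt_support (t : ℕ) : ∀ s, M.lawAt B t s ≠ 0 →
    (t ≤ B → t ≤ s.1.val) ∧ (Enabled t s → 2 * s.2.1.val + t ≤ 2 * s.1.val) := by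
  induction t with
  | zero =>
    intro s hs
    refine ⟨fun _ => Nat.zero_le _, fun _ => ?_⟩
    have : s.2.1 = 0 := by
      by_contra hc
      apply hs
      have h1 : s ≠ (0, 0, M.root) := fun h => hc (by rw [h])
      have h2 : s ≠ (Fin.last B, 0, M.root) := fun h => hc (by rw [h])
      simp [lawAt, initLaw, h1, h2]
    rw [this]
    simp
  | succ t ih =>
    intro s hs
    have h := M.iterate_moveLaw_support (fun s hs => (ih s hs).2) B s hs
    have hn : ¬ Enabled t s := fun he => by
      have := h he
      have := he.1
      omega
    unfold Enabled at hn ⊢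
    omega

/-- The expected total of `ψ` over `m` time steps of the policy, from virtual time `τ` and node
`u` on. -/
noncomputable def futureAux (ψ : ℕ → N → ℝ) : ℕ → ℕ → N → ℝ
  | 0, _, _ => 0
  | m + 1, τ, u => ψ τ u + (∑ a, M.act τ u a * ∑ v, M.move u a v * futureAux ψ m (τ + 1) v
      + (1 - ∑ a, M.act τ u a) * futureAux ψ m (τ + 1) u)

/-- The expected total of `ψ` between the virtual times `τ` and `T`. -/
noncomputable def future (ψ : ℕ → N → ℝ) (T τ : ℕ) (u : N) : ℝ := M.futureAux ψ (T - τ) τ u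

omit [DecidableEq N] in
theorem future_nonneg {ψ : ℕ → N → ℝ} (hψ : ∀ τ u, 0 ≤ ψ τ u) (T τ : ℕ) (u : N) :
    0 ≤ M.future ψ T τ u := by
  unfold future
  generalize T - τ = m
  induction m generalizing τ u with
  | zero => exact le_rfl
  | succ m ih =>
    have h1 := M.act_sum_le τ u
    have h2 : 0 ≤ ∑ a, M.act τ u a * ∑ v, M.move u a v * M.futureAux ψ m (τ + 1) v :=
      Finset.sum_nonneg fun a _ => mul_nonneg (M.act_nonneg _ _ _)
        (Finset.sum_nonneg fun v _ => mul_nonneg (M.move_nonneg _ _ _) (ih _ _))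
    have h3 := mul_nonneg (sub_nonneg.2 h1) (ih (τ + 1) u)
    have h4 := hψ τ u
    rw [futureAux]
    linarith

omit [DecidableEq N] in
theorem stepMean_future (ψ : ℕ → N → ℝ) {T : ℕ} (hT : T ≤ B) {s : ArmState B N}
    (hs : s.1.val < T) :
    M.stepMean (fun r => M.future ψ T r.1 r.2.2) s = M.future ψ T s.1 s.2.2 - ψ s.1 s.2.2 := by
  have h1 : T - s.1.val = (T - (s.1.val + 1)) + 1 := by omega
  simp only [stepMean, future, bump_val (hs.trans_le hT)]
  rw [h1, futureAux]
  ring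

/-- The probability that the policy is on node `u` at virtual time `τ`. -/
noncomputable def occupancy : ℕ → N → ℝ
  | 0, u => if u = M.root then 1 else 0
  | τ + 1, u => occupancy τ u - ∑ a, occupancy τ u * M.act τ u a
      + ∑ v, ∑ a, occupancy τ v * M.act τ v a * M.move v a u

theorem sum_occupancy_mul_futureAux (ψ : ℕ → N → ℝ) (m τ : ℕ) :
    ∑ u, M.occupancy τ u * M.futureAux ψ m τ u
      = ∑ j ∈ Finset.range m, ∑ u, M.occupancy (τ + j) u * ψ (τ + j) u := by
  induction m generalizing τ with
  | zero => simp [futureAux]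
  | succ m ih =>
    rw [Finset.sum_range_succ', add_zero]
    have hih : ∑ j ∈ Finset.range m, ∑ u, M.occupancy (τ + (j + 1)) u * ψ (τ + (j + 1)) u
        = ∑ u, M.occupancy (τ + 1) u * M.futureAux ψ m (τ + 1) u := by
      rw [ih]
      exact Finset.sum_congr rfl fun j _ => by rw [show τ + (j + 1) = τ + 1 + j by omega]
    rw [hih]
    have key : ∑ u, (∑ v, ∑ a, M.occupancy τ v * M.act τ v a * M.move v a u)
          * M.futureAux ψ m (τ + 1) u
        = ∑ u, M.occupancy τ u * ∑ a, M.act τ u a * ∑ v, M.move u a v *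
          M.futureAux ψ m (τ + 1) v := by
      simp only [Finset.sum_mul, Finset.mul_sum]
      rw [Finset.sum_comm]
      refine Finset.sum_congr rfl fun v _ => ?_
      rw [Finset.sum_comm]
      exact Finset.sum_congr rfl fun a _ => Finset.sum_congr rfl fun u _ => by ring
    have hocc : ∀ u, M.occupancy (τ + 1) u * M.futureAux ψ m (τ + 1) u
        = (M.occupancy τ u * (1 - ∑ a, M.act τ u a)) * M.futureAux ψ m (τ + 1) u
        + (∑ v, ∑ a, M.occupancy τ v * M.act τ v a * M.move v a u)
          * M.futureAux ψ m (τ + 1) u := fun u => by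
      rw [occupancy, ← Finset.mul_sum]
      ring
    rw [Finset.sum_congr rfl fun u _ => hocc u, Finset.sum_add_distrib, key,
      ← Finset.sum_add_distrib, ← Finset.sum_add_distrib]
    refine Finset.sum_congr rfl fun u _ => ?_
    rw [futureAux]
    ring

theorem future_zero_root (ψ : ℕ → N → ℝ) (T : ℕ) :
    M.future ψ T 0 M.root = ∑ τ ∈ Finset.range T, ∑ u, M.occupancy τ u * ψ τ u := by
  have := M.sum_occupancy_mul_futureAux ψ T 0
  simp only [occupancy, zero_add, ite_mul, one_mul, zero_mul, Finset.sum_ite_eq',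
    Finset.mem_univ, if_true] at this
  exact this

/-- The expected number of plays up to virtual time `T`. -/
noncomputable def expectedPlays (T : ℕ) : ℝ := M.future (fun τ u => ∑ a, M.act τ u a) T 0 M.root

/-- After `t ≤ T` rounds, the mean of the number of plays of an arm, capped at `K`, is at most a third
of what the policy of the arm plays up to virtual time `T`.  In these rounds an arm gets beyond
virtual time `T` only after its `K`-th play, because `2 * K ≤ T + 2`; so the capped number of plays,
plus the expected number of plays of the policy that are still to come up to virtual time `T`, is a
supermartingale. -/
theorem sum_lawAt_mul_min_le {t T K : ℕ} (hT : T ≤ B) (ht : t ≤ T) (hK : 2 * K ≤ T + 2) :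
    ∑ s, M.lawAt B t s * min (s.2.1.val : ℝ) K ≤ 1 / 3 * M.expectedPlays T := by
  set ψ : ℕ → N → ℝ := fun τ u => ∑ a, M.act τ u a with hψ
  have hψ0 : ∀ τ u, 0 ≤ ψ τ u := fun τ u => Finset.sum_nonneg fun a _ => M.act_nonneg _ _ _
  set g : ArmState B N → ℝ := fun s => min (s.2.1.val : ℝ) K + M.future ψ T s.1 s.2.2 with hg
  have h1 : ∑ s, M.lawAt B t s * min (s.2.1.val : ℝ) K ≤ ∑ s, M.lawAt B t s * g s :=
    Finset.sum_le_sum fun s _ => mul_le_mul_of_nonneg_left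
      (le_add_of_nonneg_right (M.future_nonneg hψ0 _ _ _)) ((M.isLaw_lawAt t).nonneg s)
  refine h1.trans ((M.sum_lawAt_mul_le ?_).trans ?_)
  · intro t' ht' s hs
    by_cases hτ : s.1.val < T
    · have e := M.stepMean_future ψ hT hτ
      have hmin : min ((bump s.2.1).val : ℝ) K ≤ min (s.2.1.val : ℝ) K + 1 := by
        have : ((bump s.2.1).val : ℝ) ≤ s.2.1.val + 1 := by exact_mod_cast bump_le s.2.1
        rcases min_cases (s.2.1.val : ℝ) K with h | h
        · exact (min_le_left _ _).trans (by linarith)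
        · exact (min_le_right _ _).trans (by linarith)
      have hsplit : M.stepMean g s ≤ (min (s.2.1.val : ℝ) K + ψ s.1 s.2.2)
          + M.stepMean (fun r => M.future ψ T r.1 r.2.2) s := by
        have : (min (s.2.1.val : ℝ) K + ψ s.1 s.2.2)
            + M.stepMean (fun r => M.future ψ T r.1 r.2.2) s
            = ∑ a, M.act s.1 s.2.2 a * ∑ v, M.move s.2.2 a v *
                (min (s.2.1.val : ℝ) K + 1 + M.future ψ T (bump s.1) v)
              + (1 - ∑ a, M.act s.1 s.2.2 a) *
                (min (s.2.1.val : ℝ) K + M.future ψ T (bump s.1) s.2.2) := by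
          simp only [mul_add (M.move _ _ _), Finset.sum_add_distrib, ← Finset.sum_mul, M.move_sum,
            mul_add (M.act _ _ _), stepMean, hψ]
          ring
        rw [this]
        unfold stepMean
        have := M.act_sum_le s.1 s.2.2
        simp only [hg]
        gcongr with a _ v _
        · exact M.act_nonneg _ _ _
        · exact M.move_nonneg _ _ _
      rw [e] at hsplit
      simp only [hg] at hsplit ⊢
      linarith
    · -- the arm runs ahead of round `t'`, which it does only after its `K`-th play
      have h2 : K ≤ s.2.1.val := by
        have := hs.2
        omega
      have hge : ∀ s' : ArmState B N, K ≤ s'.2.1.val → T ≤ s'.1.val → g s' = K := by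
        intro s' hK' hT'
        have h3 : T - s'.1.val = 0 := by omega
        have h4 : (K : ℝ) ≤ s'.2.1.val := by exact_mod_cast hK'
        simp only [hg, future, h3, futureAux, add_zero]
        exact min_eq_right h4
      have h5 := le_bump s.1
      have h6 := le_bump s.2.1
      rw [hge s h2 (by omega), ← M.stepMean_const (K : ℝ) s]
      exact M.stepMean_mono
        (fun v => (hge _ (show K ≤ (bump s.2.1).val by omega)
          (show T ≤ (bump s.1).val by omega)).le)
        (hge (bump s.1, s.2.1, s.2.2) h2 (show T ≤ (bump s.1).val by omega)).le
  · have h7 : T - B = 0 := by omega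
    rw [sum_initLaw_mul]
    simp [hg, hψ, future, h7, futureAux, expectedPlays]

/-- The number of plays, capped at `K`, is also at most `K` times the probability of selection. -/
theorem sum_lawAt_mul_min_le_third (t K : ℕ) :
    ∑ s, M.lawAt B t s * min (s.2.1.val : ℝ) K ≤ 1 / 3 * K := by
  -- an arm that is not selected stays at virtual time `B` without plays
  set χ : ArmState B N → ℝ := fun s => if s.1.val = B ∧ s.2.1.val = 0 then 0 else K with hχ
  have h1 : ∑ s, M.lawAt B t s * min (s.2.1.val : ℝ) K ≤ ∑ s, M.lawAt B t s * χ s := by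
    refine Finset.sum_le_sum fun s _ => mul_le_mul_of_nonneg_left ?_ ((M.isLaw_lawAt t).nonneg s)
    simp only [hχ]
    split_ifs with h
    · rw [h.2]
      simp
    · exact min_le_right _ _
  refine h1.trans ((M.sum_lawAt_mul_le ?_).trans ?_)
  · intro t' _ s hs
    have : χ s = K := if_neg fun h => by
      have := hs.1
      omega
    rw [this, ← M.stepMean_const (K : ℝ) s]
    have hle : ∀ s' : ArmState B N, χ s' ≤ K := fun s' => by
      simp only [hχ]
      split_ifs
      · exact Nat.cast_nonneg K
      · exact le_rfl
    exact M.stepMean_mono (fun v => hle _) (hle _)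
  · rw [sum_initLaw_mul]
    have e1 : χ (Fin.last B, 0, M.root) = 0 := if_pos (by simp)
    have e2 : χ (0, 0, M.root) ≤ K := by
      simp only [hχ]
      split_ifs
      · exact Nat.cast_nonneg K
      · exact le_rfl
    rw [e1]
    linarith

end ArmPolicy

/-! ### All arms together -/

/-- `op 0 (op 1 (⋯ (op (k - 1) h)))`, the value before a loop of `k` rounds whose value after the
last round is `h`. -/
def loopOp {H : Type*} : ℕ → (ℕ → H → H) → H → H
  | 0, _, h => h
  | k + 1, op, h => loopOp k op (op k h)

section JointProcess

variable {n : ℕ} {N : Fin n → Type*} {A : Type*} [∀ i, Fintype (N i)] [∀ i, DecidableEq (N i)]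
  [Fintype A] {B : ℕ}

/-- The total number of plays of all arms. -/
def totalPlays (ω : ∀ i, ArmState B (N i)) : ℕ := ∑ i, (ω i).2.1.val

/-- The expected reward of the policy of an arm in a time step. -/
noncomputable def rewardRate {N A : Type*} [Fintype N] [Fintype A] (M : ArmPolicy N A)
    (r : N → A → ℝ) (τ : ℕ) (u : N) : ℝ := ∑ a, M.act τ u a * r u a

variable (M : ∀ i, ArmPolicy (N i) A) (r : ∀ i, N i → A → ℝ)

/-- The expected future reward before a move of arm `i` in round `t`, if it is `h` afterwards.
A reward counts only if the budget is not exhausted. -/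
noncomputable def jointStep (t : ℕ) (i : Fin n) (h : (∀ i, ArmState B (N i)) → ℝ)
    (ω : ∀ i, ArmState B (N i)) : ℝ :=
  if Enabled t (ω i) then
    (if totalPlays ω < B then rewardRate (M i) (r i) (ω i).1 (ω i).2.2 else 0)
      + (M i).stepMean (fun s => h (Function.update ω i s)) (ω i)
  else h ω

/-- The expected future reward before round `t`. -/
noncomputable def roundValue (t : ℕ) (h : (∀ i, ArmState B (N i)) → ℝ) :
    (∀ i, ArmState B (N i)) → ℝ :=
  loopOp n (fun i h => if hi : i < n then loopOp B (fun _ => jointStep M r t ⟨i, hi⟩) h else h) h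

/-- The expected future reward before the random selection of arm `i`. -/
noncomputable def selectStep (i : Fin n) (h : (∀ i, ArmState B (N i)) → ℝ)
    (ω : ∀ i, ArmState B (N i)) : ℝ :=
  1 / 3 * h ω + 2 / 3 * h (Function.update ω i (Fin.last B, (ω i).2))

/-- The expected future reward before the random selection of all arms. -/
noncomputable def selectValue (h : (∀ i, ArmState B (N i)) → ℝ) : (∀ i, ArmState B (N i)) → ℝ :=
  loopOp n (fun i h => if hi : i < n then selectStep ⟨i, hi⟩ h else h) h

/-- The expected reward that the policies of the arms still promise, summed over the arms. -/
noncomputable def promise (w : ∀ i, ArmState B (N i) → ℝ) : ℝ :=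
  ∑ i, ∑ s, w i s * (M i).future (rewardRate (M i) (r i)) B s.1 s.2.2

omit [∀ i, DecidableEq (N i)] in
theorem promise_update (w : ∀ i, ArmState B (N i) → ℝ) (i : Fin n) (v : ArmState B (N i) → ℝ) :
    promise M r (Function.update w i v) = promise M r w
      - ∑ s, w i s * (M i).future (rewardRate (M i) (r i)) B s.1 s.2.2
      + ∑ s, v s * (M i).future (rewardRate (M i) (r i)) B s.1 s.2.2 := by
  unfold promise
  rw [← Finset.add_sum_erase _ _ (Finset.mem_univ i), ← Finset.add_sum_erase _ _ (Finset.mem_univ i),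
    Function.update_self]
  have : ∑ j ∈ Finset.univ.erase i, ∑ s, Function.update w i v j s *
      (M j).future (rewardRate (M j) (r j)) B s.1 s.2.2
      = ∑ j ∈ Finset.univ.erase i, ∑ s, w j s *
      (M j).future (rewardRate (M j) (r j)) B s.1 s.2.2 :=
    Finset.sum_congr rfl fun j hj => by rw [Function.update_of_ne (Finset.ne_of_mem_erase hj)]
  rw [this]
  ring

omit [∀ i, DecidableEq (N i)] in
/-- While arm `i` is moved in round `t`, the other arms have made more than `t / 2` plays with
probability at most `5/9`. -/
theorem prodExp_others_overload_le {w : ∀ i, ArmState B (N i) → ℝ} (hw : ∀ i, IsLaw (w i))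
    {t K : ℕ} {i : Fin n} (hK : K = t / 2 + 1)
    (h1 : ∀ j ≠ i, ∑ s, w j s * min (s.2.1.val : ℝ) K ≤ 1 / 3 * (M j).expectedPlays (t + 1))
    (h2 : ∀ j ≠ i, ∑ s, w j s * min (s.2.1.val : ℝ) K ≤ 1 / 3 * K)
    (hplays : ∑ j, (M j).expectedPlays (t + 1) ≤ t + 1) :
    prodExp w (fun ω => overload
      (∑ j, if j = i then 0 else min ((ω j).2.1.val : ℝ) K / K)) ≤ 5 / 9 := by
  have hK0 : (0 : ℝ) < K := by exact_mod_cast (by omega : 0 < K)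
  have hpos : ∀ j, 0 ≤ (M j).expectedPlays (t + 1) := fun j =>
    (M j).future_nonneg (fun τ u => Finset.sum_nonneg fun a _ => (M j).act_nonneg _ _ _) _ _ _
  have mean : ∀ j, ∑ s, w j s * (if j = i then 0 else min (s.2.1.val : ℝ) K / K)
      = if j = i then 0 else (∑ s, w j s * min (s.2.1.val : ℝ) K) / K := fun j => by
    split_ifs
    · simp
    · rw [Finset.sum_div]
      exact Finset.sum_congr rfl fun s _ => by ring
  refine prodExp_overload_le (y := fun j s => if j = i then 0 else min (s.2.1.val : ℝ) K / K) hw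
    (fun j s => ?_) (fun j => ?_) ?_
  · split_ifs
    · exact le_rfl
    · positivity
  · rw [mean]
    split_ifs with hj
    · norm_num
    · rw [div_le_iff₀ hK0]
      exact h2 j hj
  · calc ∑ j, ∑ s, w j s * (if j = i then 0 else min (s.2.1.val : ℝ) K / K)
        ≤ ∑ j, 1 / 3 * (M j).expectedPlays (t + 1) / K := by
          refine Finset.sum_le_sum fun j _ => ?_
          rw [mean]
          split_ifs with hj
          · exact div_nonneg (mul_nonneg (by norm_num) (hpos j)) hK0.le
          · exact div_le_div_of_nonneg_right (h1 j hj) hK0.le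
      _ = 1 / 3 * (∑ j, (M j).expectedPlays (t + 1)) / K := by
          rw [Finset.mul_sum, Finset.sum_div]
      _ ≤ 2 / 3 := by
          rw [div_le_iff₀ hK0]
          have : ((t + 1 : ℕ) : ℝ) ≤ ((2 * K : ℕ) : ℝ) := by exact_mod_cast (by omega)
          push_cast at this
          linarith

/-- A move of arm `i` in round `t` earns at least `4/9` of what the policy of the arm earns. -/
theorem le_prodExp_jointStep (hr : ∀ i u a, 0 ≤ r i u a) {w : ∀ i, ArmState B (N i) → ℝ}
    (hw : ∀ i, IsLaw (w i)) {t : ℕ} {i : Fin n}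
    (h1 : ∀ j ≠ i, ∑ s, w j s * min (s.2.1.val : ℝ) ((t / 2 + 1 : ℕ) : ℝ)
      ≤ 1 / 3 * (M j).expectedPlays (t + 1))
    (h2 : ∀ j ≠ i, ∑ s, w j s * min (s.2.1.val : ℝ) ((t / 2 + 1 : ℕ) : ℝ)
      ≤ 1 / 3 * ((t / 2 + 1 : ℕ) : ℝ))
    (hplays : ∑ j, (M j).expectedPlays (t + 1) ≤ t + 1)
    (hi : ∀ s, w i s ≠ 0 → Enabled t s → 2 * s.2.1.val + t ≤ 2 * s.1.val)
    (h : (∀ i, ArmState B (N i)) → ℝ) :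
    4 / 9 * (promise M r w - promise M r (Function.update w i ((M i).moveLaw t (w i))))
      + prodExp (Function.update w i ((M i).moveLaw t (w i))) h ≤ prodExp w (jointStep M r t i h) := by
  obtain ⟨K, hK⟩ : ∃ K, K = t / 2 + 1 := ⟨_, rfl⟩
  rw [← hK] at h1 h2
  have hK0 : (0 : ℝ) < K := by exact_mod_cast (by omega : 0 < K)
  set ψ := rewardRate (M i) (r i) with hψ
  have hψ0 : ∀ τ u, 0 ≤ ψ τ u := fun τ u =>
    Finset.sum_nonneg fun a _ => mul_nonneg ((M i).act_nonneg _ _ _) (hr i u a)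
  set R : (∀ i, ArmState B (N i)) → ℝ := fun ω =>
    if Enabled t (ω i) then (if totalPlays ω < B then ψ (ω i).1 (ω i).2.2 else 0) else 0 with hR
  set f : ArmState B (N i) → ℝ := fun s => if Enabled t s then ψ s.1 s.2.2 else 0 with hf
  have hf0 : ∀ s, 0 ≤ f s := fun s => by
    simp only [hf]
    split_ifs
    · exact hψ0 _ _
    · exact le_rfl
  have e1 : jointStep M r t i h = fun ω => R ω
      + ∑ s, (M i).kernel t (ω i) s * h (Function.update ω i s) := by
    ext ω
    rw [(M i).sum_kernel_mul t (ω i) fun s => h (Function.update ω i s)]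
    simp only [jointStep, hR, hψ]
    split_ifs <;> simp
  have e2 : promise M r w - promise M r (Function.update w i ((M i).moveLaw t (w i)))
      = ∑ s, w i s * f s := by
    rw [promise_update,
      (M i).sum_moveLaw_mul t (w i) (fun s => (M i).future (rewardRate (M i) (r i)) B s.1 s.2.2)]
    have : ∀ x y z : ℝ, x - (x - y + z) = y - z := fun x y z => by ring
    rw [this, ← Finset.sum_sub_distrib]
    refine Finset.sum_congr rfl fun s _ => ?_
    simp only [hf]
    split_ifs with hs
    · rw [(M i).stepMean_future _ le_rfl hs.1]
      ring
    · ring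
  rw [e1, prodExp_add, prodExp_kernel w i ((M i).kernel t) h, e2]
  suffices hmain : 4 / 9 * ∑ s, w i s * f s ≤ prodExp w R by
    exact add_le_add hmain le_rfl
  set g : (∀ i, ArmState B (N i)) → ℝ := fun ω => 1 - overload
    (∑ j, if j = i then 0 else min ((ω j).2.1.val : ℝ) K / K) with hg
  have hgupd : ∀ ω s, g (Function.update ω i s) = g ω := fun ω s => by
    simp only [hg]
    congr 2
    refine Finset.sum_congr rfl fun j _ => ?_
    by_cases hj : j = i
    · simp [hj]
    · simp [hj]
  have hg49 : 4 / 9 ≤ prodExp w g := by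
    have := prodExp_others_overload_le M hw hK h1 h2 hplays
    rw [hg, prodExp_sub, prodExp_const hw]
    linarith
  have hsum0 : 0 ≤ ∑ s, w i s * f s :=
    Finset.sum_nonneg fun s _ => mul_nonneg ((hw i).nonneg s) (hf0 s)
  calc 4 / 9 * ∑ s, w i s * f s ≤ (∑ s, w i s * f s) * prodExp w g := by
        rw [mul_comm]
        exact mul_le_mul_of_nonneg_left hg49 hsum0
    _ = prodExp w fun ω => f (ω i) * g ω := (prodExp_mul hw i f g hgupd).symm
    _ ≤ prodExp w R := by
        refine prodExp_mono hw fun ω hω => ?_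
        simp only [hf, hR]
        by_cases hE : Enabled t (ω i)
        · rw [if_pos hE, if_pos hE]
          by_cases hL : 1 ≤ ∑ j, if j = i then 0 else min ((ω j).2.1.val : ℝ) K / K
          · have : g ω = 0 := by simp [hg, overload, hL]
            rw [this, mul_zero]
            split_ifs
            · exact hψ0 _ _
            · exact le_rfl
          · have hone : g ω = 1 := by simp [hg, overload, hL]
            -- without an overload the other arms have made at most `t / 2` plays
            have hlt : ∑ j ∈ Finset.univ.erase i, (ω j).2.1.val < K := by
              push Not at hL
              rw [← Finset.add_sum_erase _ _ (Finset.mem_univ i), if_pos rfl, zero_add,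
                Finset.sum_congr rfl fun j hj => if_neg (Finset.ne_of_mem_erase hj),
                ← Finset.sum_div, div_lt_one hK0] at hL
              have hmin : ∀ j ∈ Finset.univ.erase i, (ω j).2.1.val < K := fun j hj => by
                by_contra hc
                push Not at hc
                have hle := Finset.single_le_sum (f := fun j => min ((ω j).2.1.val : ℝ) K)
                  (fun j _ => by positivity) hj
                have : min ((ω j).2.1.val : ℝ) K = K := min_eq_right (by exact_mod_cast hc)
                simp only [this] at hle
                linarith
              rw [Finset.sum_congr rfl fun j hj => min_eq_left
                (by exact_mod_cast (hmin j hj).le)] at hL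
              exact_mod_cast hL
            have htot : totalPlays ω < B := by
              have h3 := hi (ω i) (hω i) hE
              have h4 := hE.1
              rw [totalPlays, ← Finset.add_sum_erase _ _ (Finset.mem_univ i)]
              omega
            rw [if_pos htot, hone, mul_one]
        · rw [if_neg hE, if_neg hE, zero_mul]

/-- The state laws of the arms within round `t`, when the arms before `m` have been advanced. -/
noncomputable def roundLaw (B t m : ℕ) (j : Fin n) : ArmState B (N j) → ℝ :=
  if j.val < m then (M j).lawAt B (t + 1) else (M j).lawAt B t

theorem roundLaw_succ (t : ℕ) {m : ℕ} (hm : m < n) :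
    roundLaw M B t (m + 1) = Function.update (roundLaw M B t m) ⟨m, hm⟩
      (((M ⟨m, hm⟩).moveLaw t)^[B] (roundLaw M B t m ⟨m, hm⟩)) := by
  funext j
  by_cases hj : j = ⟨m, hm⟩
  · subst hj
    rw [Function.update_self]
    simp [roundLaw, ArmPolicy.lawAt]
  · rw [Function.update_of_ne hj]
    have : j.val ≠ m := fun h => hj (Fin.ext h)
    simp only [roundLaw, show j.val < m + 1 ↔ j.val < m by omega]

theorem isLaw_roundLaw (t m : ℕ) (j : Fin n) : IsLaw (roundLaw M B t m j) := by
  unfold roundLaw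
  split_ifs
  · exact (M j).isLaw_lawAt _
  · exact (M j).isLaw_lawAt _

theorem le_prodExp_roundValue (hr : ∀ i u a, 0 ≤ r i u a) {t : ℕ} (ht : t < B)
    (hplays : ∑ j, (M j).expectedPlays (t + 1) ≤ t + 1) (h : (∀ i, ArmState B (N i)) → ℝ) :
    4 / 9 * (promise M r (fun j => (M j).lawAt B t) - promise M r (fun j => (M j).lawAt B (t + 1)))
      + prodExp (fun j => (M j).lawAt B (t + 1)) h
      ≤ prodExp (fun j => (M j).lawAt B t) (roundValue M r t h) := by
  -- the moves of a single arm
  have arm : ∀ (i : Fin n) (k : ℕ) (h : (∀ i, ArmState B (N i)) → ℝ),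
      4 / 9 * (promise M r (roundLaw M B t i) - promise M r (Function.update (roundLaw M B t i) i
          (((M i).moveLaw t)^[k] (roundLaw M B t i i))))
        + prodExp (Function.update (roundLaw M B t i) i
          (((M i).moveLaw t)^[k] (roundLaw M B t i i))) h
        ≤ prodExp (roundLaw M B t i) (loopOp k (fun _ => jointStep M r t i) h) := by
    intro i k
    induction k with
    | zero =>
      intro h
      simp [loopOp]
    | succ k ih =>
      intro h
      set w := Function.update (roundLaw M B t i) i
        (((M i).moveLaw t)^[k] (roundLaw M B t i i)) with hw
      have hi : roundLaw M B t i i = (M i).lawAt B t := by simp [roundLaw]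
      have hlaw : ∀ j, IsLaw (w j) := fun j => by
        by_cases hj : j = i
        · subst hj
          rw [hw, Function.update_self]
          exact (M j).isLaw_iterate_moveLaw (isLaw_roundLaw M t _ j) k
        · rw [hw, Function.update_of_ne hj]
          exact isLaw_roundLaw M t _ j
      have hother : ∀ j ≠ i, ∃ t', t' ≤ t + 1 ∧ w j = (M j).lawAt B t' := fun j hj => by
        rw [hw, Function.update_of_ne hj]
        unfold roundLaw
        split_ifs
        · exact ⟨t + 1, le_rfl, rfl⟩
        · exact ⟨t, by omega, rfl⟩
      have step := le_prodExp_jointStep M r hr hlaw (t := t) (i := i)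
        (fun j hj => by
          obtain ⟨t', ht', e⟩ := hother j hj
          rw [e]
          exact (M j).sum_lawAt_mul_min_le (by omega) ht' (by omega))
        (fun j hj => by
          obtain ⟨t', ht', e⟩ := hother j hj
          rw [e]
          exact (M j).sum_lawAt_mul_min_le_third _ _)
        hplays
        (fun s hs hE => by
          rw [hw, Function.update_self, hi] at hs
          exact ((M i).iterate_moveLaw_support
            (fun s hs => ((M i).lawAt_support t s hs).2) k s hs hE).1)
        h
      have hupd : Function.update w i ((M i).moveLaw t (w i))
          = Function.update (roundLaw M B t i) i
            (((M i).moveLaw t)^[k + 1] (roundLaw M B t i i)) := by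
        rw [hw, Function.update_self, Function.update_idem, Function.iterate_succ_apply']
      rw [hupd] at step
      have := ih (jointStep M r t i h)
      rw [loopOp]
      linarith
  have arms : ∀ (m : ℕ), m ≤ n → ∀ h : (∀ i, ArmState B (N i)) → ℝ,
      4 / 9 * (promise M r (roundLaw M B t 0) - promise M r (roundLaw M B t m))
        + prodExp (roundLaw M B t m) h
        ≤ prodExp (roundLaw M B t 0) (loopOp m (fun i h => if hi : i < n then
          loopOp B (fun _ => jointStep M r t ⟨i, hi⟩) h else h) h) := by
    intro m
    induction m with
    | zero =>
      intro _ h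
      simp [loopOp]
    | succ m ih =>
      intro hm h
      have h1 := arm ⟨m, hm⟩ B h
      have h2 := ih (by omega) (loopOp B (fun _ => jointStep M r t ⟨m, hm⟩) h)
      rw [roundLaw_succ M t hm, loopOp, dif_pos (show m < n by omega)]
      dsimp only at h1 h2 ⊢
      linarith
  have h0 : roundLaw M B t 0 = fun j => (M j).lawAt B t := by
    funext j
    simp [roundLaw]
  have hn : roundLaw M B t n = fun j => (M j).lawAt B (t + 1) := by
    funext j
    simp [roundLaw]
  have := arms n le_rfl h
  rw [h0, hn] at this
  exact this

theorem le_prodExp_loop_roundValue (hr : ∀ i u a, 0 ≤ r i u a)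
    (hplays : ∀ t ≤ B, ∑ j, (M j).expectedPlays t ≤ t) {t : ℕ} (ht : t ≤ B)
    (h : (∀ i, ArmState B (N i)) → ℝ) :
    4 / 9 * (promise M r (fun j => (M j).initLaw B) - promise M r (fun j => (M j).lawAt B t))
      + prodExp (fun j => (M j).lawAt B t) h
      ≤ prodExp (fun j => (M j).initLaw B) (loopOp t (roundValue M r) h) := by
  induction t generalizing h with
  | zero => simp [loopOp, ArmPolicy.lawAt]
  | succ t ih =>
    have h1 := le_prodExp_roundValue M r hr (t := t) (by omega)
      (by exact_mod_cast hplays (t + 1) ht) h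
    have h2 := ih (by omega) (roundValue M r t h)
    rw [loopOp]
    linarith

/-- The random selection of the arms turns the initial state into independent arms that are
distributed according to `initLaw`. -/
theorem selectValue_eq_prodExp (h : (∀ i, ArmState B (N i)) → ℝ) :
    selectValue h (fun i => (0, 0, (M i).root)) = prodExp (fun j => (M j).initLaw B) h := by
  set δ : ∀ j, ArmState B (N j) → ℝ := fun j s => if s = (0, 0, (M j).root) then 1 else 0 with hδ
  have hpoint : ∀ f : (∀ i, ArmState B (N i)) → ℝ,
      prodExp δ f = f fun i => (0, 0, (M i).root) := fun f => by
    unfold prodExp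
    rw [Finset.sum_eq_single fun i => (0, 0, (M i).root)]
    · simp [hδ]
    · intro ω _ hω
      obtain ⟨i, hi⟩ := Function.ne_iff.1 hω
      rw [Finset.prod_eq_zero (Finset.mem_univ i) (by simp [hδ, hi]), zero_mul]
    · simp
  have key : ∀ m, m ≤ n → ∀ h : (∀ i, ArmState B (N i)) → ℝ,
      prodExp δ (loopOp m (fun i h => if hi : i < n then selectStep ⟨i, hi⟩ h else h) h)
        = prodExp (fun j => if j.val < m then (M j).initLaw B else δ j) h := by
    intro m
    induction m with
    | zero =>
      intro _ h
      simp [loopOp]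
    | succ m ih =>
      intro hm h
      rw [loopOp, ih (by omega), dif_pos (show m < n by omega)]
      set w : ∀ j, ArmState B (N j) → ℝ := fun j => if j.val < m then (M j).initLaw B else δ j
        with hw
      have e1 : selectStep ⟨m, hm⟩ h = fun ω => ∑ s : ArmState B (N ⟨m, hm⟩),
          ((if s = ω ⟨m, hm⟩ then 1 / 3 else 0)
            + if s = (Fin.last B, (ω ⟨m, hm⟩).2) then 2 / 3 else 0) *
          h (Function.update ω ⟨m, hm⟩ s) := by
        ext ω
        simp [selectStep, add_mul, Finset.sum_add_distrib]
      rw [e1, prodExp_kernel w ⟨m, hm⟩ (fun q s => (if s = q then 1 / 3 else 0)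
            + if s = (Fin.last B, q.2) then 2 / 3 else 0)]
      congr 1
      funext j
      by_cases hj : j = ⟨m, hm⟩
      · subst hj
        rw [Function.update_self]
        ext s
        simp [hw, hδ, ArmPolicy.initLaw]
      · rw [Function.update_of_ne hj]
        have : j.val ≠ m := fun h => hj (Fin.ext h)
        simp only [hw, show j.val < m + 1 ↔ j.val < m by omega]
  have := key n le_rfl h
  rw [hpoint] at this
  simpa [selectValue] using this

/-- Selecting each arm with probability `1/3` and then advancing the selected arms in rounds earns
at least `4/27` of what the policies of the arms earn separately. -/
theorem le_selectValue (hr : ∀ i u a, 0 ≤ r i u a)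
    (hplays : ∀ t ≤ B, ∑ j, (M j).expectedPlays t ≤ t) :
    4 / 27 * ∑ j, (M j).future (rewardRate (M j) (r j)) B 0 (M j).root
      ≤ selectValue (B := B) (loopOp B (roundValue M r) fun _ => 0)
        fun i => (0, 0, (M i).root) := by
  have h1 := le_prodExp_loop_roundValue M r hr hplays le_rfl fun _ => 0
  rw [selectValue_eq_prodExp M]
  have h2 : promise M r (fun j => (M j).lawAt B B) = 0 := by
    refine Finset.sum_eq_zero fun j _ => Finset.sum_eq_zero fun s _ => ?_
    dsimp only
    by_cases hs : (M j).lawAt B B s = 0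
    · rw [hs, zero_mul]
    · have := ((M j).lawAt_support B s hs).1 le_rfl
      have : B - s.1.val = 0 := by omega
      simp [ArmPolicy.future, this, ArmPolicy.futureAux]
  have h3 : promise M r (fun j => (M j).initLaw B)
      = 1 / 3 * ∑ j, (M j).future (rewardRate (M j) (r j)) B 0 (M j).root := by
    rw [promise, Finset.mul_sum]
    refine Finset.sum_congr rfl fun j _ => ?_
    rw [(M j).sum_initLaw_mul (fun s => (M j).future (rewardRate (M j) (r j)) B s.1 s.2.2)]
    simp [ArmPolicy.future, ArmPolicy.futureAux]
  have h4 : prodExp (fun j => (M j).lawAt B B) (fun _ => (0 : ℝ)) = 0 := by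
    simp [prodExp]
  rw [h2, h3, h4] at h1
  linarith

end JointProcess

/-! ### The two linear programs -/

namespace MABInstance

variable (I : MABInstance)

/-- The values of the variables `s` of (PolyLP) that are forced by `x`; here time starts at `0`. -/
noncomputable def nodeProb (x : I.PlayVar) (i : Fin I.numArms) : ℕ → Fin (I.numNodes i) → ℝ
  | 0, u => if u = I.root i then 1 else 0
  | τ + 1, u => nodeProb x i τ u - ∑ a, x i u a (τ + 1)
      + ∑ v, ∑ a, x i v a (τ + 1) * I.trans i v a u

variable {I}

theorem PolyFeasible.node_eq {x : I.PlayVar} {s : I.NodeVar} (h : I.PolyFeasible x s)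
    {τ : ℕ} (hτ : τ < I.budget) (i : Fin I.numArms) (u : Fin (I.numNodes i)) :
    s i u (τ + 1) = I.nodeProb x i τ u := by
  induction τ generalizing u with
  | zero =>
    rw [nodeProb]
    split_ifs with hu
    · rw [hu]
      exact h.start_root i
    · exact h.start_other i u hu
  | succ τ ih =>
    rw [h.update (τ + 1 + 1) (Finset.mem_Icc.2 ⟨by omega, by omega⟩) i u, Nat.add_sub_cancel,
      ih (by omega), nodeProb]

theorem continuous_nodeProb (i : Fin I.numArms) (τ : ℕ) (u : Fin (I.numNodes i)) :
    Continuous fun x : I.PlayVar => I.nodeProb x i τ u := by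
  induction τ generalizing u with
  | zero => exact continuous_const
  | succ τ ih =>
    unfold nodeProb
    have := ih u
    fun_prop

variable (I)

/-- The solutions of (PolyLP), as far as they matter: they vanish outside of the time horizon. -/
def playSet : Set I.PlayVar :=
  {x | (∀ t ∈ Finset.Icc 1 I.budget, ∑ i, ∑ u, ∑ a, x i u a t ≤ 1) ∧
    (∀ t ∈ Finset.Icc 1 I.budget, ∀ i u, ∑ a, x i u a t ≤ I.nodeProb x i (t - 1) u) ∧
    (∀ t ∈ Finset.Icc 1 I.budget, ∀ i u a, 0 ≤ x i u a t) ∧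
    ∀ t, t ∉ Finset.Icc 1 I.budget → ∀ i u a, x i u a t = 0}

theorem isCompact_playSet : IsCompact I.playSet := by
  have hbox : IsCompact (Set.pi Set.univ fun _ : Fin I.numArms => Set.pi Set.univ fun _ =>
      Set.pi Set.univ fun _ => Set.pi Set.univ fun _ => Set.Icc 0 1 : Set I.PlayVar) :=
    isCompact_univ_pi fun _ => isCompact_univ_pi fun _ => isCompact_univ_pi fun _ =>
      isCompact_univ_pi fun _ => isCompact_Icc
  refine hbox.of_isClosed_subset ?_ ?_
  · have hc : ∀ (i : Fin I.numArms) (u : Fin (I.numNodes i)) (a : Fin I.numActions) (t : ℕ),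
        Continuous fun x : I.PlayVar => x i u a t := fun i u a t => by fun_prop
    unfold playSet
    simp only [Set.ofPred_and, Set.ofPred_forall]
    refine IsClosed.inter ?_ (IsClosed.inter ?_ (IsClosed.inter ?_ ?_))
    · refine isClosed_iInter fun t => isClosed_iInter fun _ => isClosed_le ?_ continuous_const
      fun_prop
    · refine isClosed_iInter fun t => isClosed_iInter fun _ => isClosed_iInter fun i =>
        isClosed_iInter fun u => isClosed_le ?_ (continuous_nodeProb i _ u)
      fun_prop
    · exact isClosed_iInter fun t => isClosed_iInter fun _ => isClosed_iInter fun i =>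
        isClosed_iInter fun u => isClosed_iInter fun a => isClosed_le continuous_const (hc i u a t)
    · exact isClosed_iInter fun t => isClosed_iInter fun _ => isClosed_iInter fun i =>
        isClosed_iInter fun u => isClosed_iInter fun a => isClosed_eq (hc i u a t) continuous_const
  · rintro x ⟨h1, -, h3, h4⟩ i - u - a - t -
    by_cases ht : t ∈ Finset.Icc 1 I.budget
    · refine ⟨h3 t ht i u a, le_trans ?_ (h1 t ht)⟩
      calc x i u a t ≤ ∑ a, x i u a t :=
            Finset.single_le_sum (f := fun a => x i u a t) (fun a _ => h3 t ht i u a)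
              (Finset.mem_univ a)
        _ ≤ ∑ u, ∑ a, x i u a t :=
            Finset.single_le_sum (f := fun u => ∑ a, x i u a t)
              (fun u _ => Finset.sum_nonneg fun a _ => h3 t ht i u a) (Finset.mem_univ u)
        _ ≤ ∑ i, ∑ u, ∑ a, x i u a t :=
            Finset.single_le_sum (f := fun i => ∑ u, ∑ a, x i u a t)
              (fun i _ => Finset.sum_nonneg fun u _ => Finset.sum_nonneg fun a _ => h3 t ht i u a)
              (Finset.mem_univ i)
    · rw [h4 t ht]
      exact ⟨le_rfl, zero_le_one⟩

variable {I}

theorem polyFeasible_of_mem_playSet {x : I.PlayVar} (hx : x ∈ I.playSet) :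
    I.PolyFeasible x fun i u t => I.nodeProb x i (t - 1) u where
  one_play := hx.1
  play_le := hx.2.1
  nonneg := hx.2.2.1
  start_root i := by simp [nodeProb]
  start_other i u hu := by simp [nodeProb, hu]
  update t ht i u := by
    obtain ⟨k, rfl⟩ : ∃ k, t = k + 2 := ⟨t - 2, by have := Finset.mem_Icc.1 ht; omega⟩
    rfl

theorem polyValue_congr {x x' : I.PlayVar}
    (h : ∀ t ∈ Finset.Icc 1 I.budget, ∀ i u a, x i u a t = x' i u a t) :
    I.polyValue x = I.polyValue x' := by
  unfold polyValue
  refine Finset.sum_congr rfl fun i _ => Finset.sum_congr rfl fun u _ =>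
    Finset.sum_congr rfl fun a _ => ?_
  rw [Finset.sum_congr rfl fun t ht => h t ht i u a]

theorem PolyFeasible.exists_mem_playSet {x : I.PlayVar} {s : I.NodeVar} (h : I.PolyFeasible x s) :
    ∃ x' ∈ I.playSet, I.polyValue x' = I.polyValue x := by
  set x' : I.PlayVar := fun i u a t => if t ∈ Finset.Icc 1 I.budget then x i u a t else 0 with hx'
  have heq : ∀ t ∈ Finset.Icc 1 I.budget, ∀ i u a, x' i u a t = x i u a t := fun t ht i u a =>
    if_pos ht
  have hnode : ∀ τ, τ < I.budget → ∀ i u, I.nodeProb x' i τ u = I.nodeProb x i τ u := by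
    intro τ hτ i
    induction τ with
    | zero => intro u; rfl
    | succ τ ih =>
      intro u
      have ht : τ + 1 ∈ Finset.Icc 1 I.budget := Finset.mem_Icc.2 ⟨by omega, by omega⟩
      simp only [nodeProb, ih (by omega), heq _ ht]
  refine ⟨x', ⟨fun t ht => ?_, fun t ht i u => ?_, fun t ht i u a => ?_, fun t ht i u a => ?_⟩,
    polyValue_congr heq⟩
  · simp only [heq t ht]
    exact h.one_play t ht
  · have ht' := Finset.mem_Icc.1 ht
    simp only [heq t ht]
    rw [hnode _ (by omega), ← h.node_eq (by omega), Nat.sub_add_cancel ht'.1]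
    exact h.play_le t ht i u
  · rw [heq t ht]
    exact h.nonneg t ht i u a
  · exact if_neg ht

theorem nodeProb_zero_nonneg (i : Fin I.numArms) (τ : ℕ) (u : Fin (I.numNodes i)) :
    0 ≤ I.nodeProb (fun _ _ _ _ => 0) i τ u := by
  induction τ with
  | zero => rw [nodeProb]; split_ifs <;> norm_num
  | succ τ ih => simpa [nodeProb] using ih

variable (I)

theorem exists_polyOptimal : ∃ (x : I.PlayVar) (s : I.NodeVar), I.PolyOptimal x s := by
  have hne : I.playSet.Nonempty :=
    ⟨fun _ _ _ _ => 0, fun t _ => by simp, fun t _ i u => by simpa using nodeProb_zero_nonneg i _ u,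
      fun t _ i u a => le_rfl, fun t _ i u a => rfl⟩
  have hcont : Continuous fun x : I.PlayVar => I.polyValue x := by
    unfold polyValue
    fun_prop
  obtain ⟨x, hx, hmax⟩ := I.isCompact_playSet.exists_isMaxOn hne hcont.continuousOn
  refine ⟨x, _, polyFeasible_of_mem_playSet hx, fun x' s' h' => ?_⟩
  obtain ⟨x'', hx'', e⟩ := h'.exists_mem_playSet
  rw [← e]
  exact hmax hx''

variable {I}

theorem PolyOptimal.optPoly_eq {x : I.PlayVar} {s : I.NodeVar} (h : I.PolyOptimal x s) :
    I.optPoly = I.polyValue x := by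
  refine IsGreatest.csSup_eq ⟨⟨x, s, h.1, rfl⟩, ?_⟩
  rintro w ⟨x', s', h', rfl⟩
  exact h.2 x' s' h'

/-- The change of the mean of a function `W` of the joint node in one time step of (ExpLP). -/
theorem sum_joint_update {y y' : I.Joint → ℝ} {z : I.Joint → Fin I.numArms → Fin I.numActions → ℝ}
    (h : ∀ π, y' π = y π - ∑ i, ∑ a, z π i a
      + ∑ i, ∑ u, ∑ a, z (Function.update π i u) i a * I.trans i u a (π i)) (W : I.Joint → ℝ) :
    ∑ π, y' π * W π = ∑ π, y π * W π + ∑ π, ∑ i, ∑ a, z π i a *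
      (∑ v, I.trans i (π i) a v * W (Function.update π i v) - W π) := by
  have key : ∀ i, ∑ π, (∑ u, ∑ a, z (Function.update π i u) i a * I.trans i u a (π i)) * W π
      = ∑ π, ∑ a, z π i a * ∑ v, I.trans i (π i) a v * W (Function.update π i v) := fun i => by
    have := sum_update_swap i fun (π : I.Joint) (v : Fin (I.numNodes i)) =>
      ∑ a, z π i a * (I.trans i (π i) a v * W (Function.update π i v))
    simp only [Function.update_self, Function.update_idem, Function.update_eq_self] at this
    rw [Finset.sum_congr rfl fun π _ => Finset.sum_mul _ _ _]
    simp only [Finset.sum_mul, mul_assoc]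
    rw [this]
    refine Finset.sum_congr rfl fun π _ => ?_
    rw [Finset.sum_comm]
    exact Finset.sum_congr rfl fun a _ => (Finset.mul_sum _ _ _).symm
  have e1 : ∀ π, y' π * W π = y π * W π - ∑ i, ∑ a, z π i a * W π
      + ∑ i, (∑ u, ∑ a, z (Function.update π i u) i a * I.trans i u a (π i)) * W π := fun π => by
    rw [h, ← Finset.sum_mul]
    simp only [← Finset.sum_mul]
    ring
  have e2 : ∑ π, ∑ i, (∑ u, ∑ a, z (Function.update π i u) i a * I.trans i u a (π i)) * W π
      = ∑ π, ∑ i, ∑ a, z π i a * ∑ v, I.trans i (π i) a v * W (Function.update π i v) := by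
    rw [Finset.sum_comm, Finset.sum_congr rfl fun i _ => key i, Finset.sum_comm]
  rw [Finset.sum_congr rfl fun π _ => e1 π, Finset.sum_add_distrib, Finset.sum_sub_distrib, e2]
  simp only [mul_sub, Finset.sum_sub_distrib]
  ring

/-- The marginals of a solution of (ExpLP) are a solution of (PolyLP) of the same value. -/
theorem ExpFeasible.exists_polyFeasible
    {z : I.Joint → Fin I.numArms → Fin I.numActions → ℕ → ℝ} {y : I.Joint → ℕ → ℝ}
    (h : I.ExpFeasible z y) :
    ∃ x s, I.PolyFeasible x s ∧ I.polyValue x = I.expValue z := by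
  have coll : ∀ (i : Fin I.numArms) (f : I.Joint → Fin (I.numNodes i) → ℝ),
      ∑ u, ∑ π : I.Joint, f π u * (if π i = u then 1 else 0) = ∑ π : I.Joint, f π (π i) :=
    fun i f => by
      rw [Finset.sum_comm]
      exact Finset.sum_congr rfl fun π _ => by simp
  refine ⟨fun i u a t => ∑ π : I.Joint, z π i a t * if π i = u then 1 else 0,
    fun i u t => ∑ π : I.Joint, y π t * if π i = u then 1 else 0, ?_, ?_⟩
  · refine ⟨fun t ht => ?_, fun t ht i u => ?_, fun t ht i u a => ?_, fun i => ?_, fun i u hu => ?_,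
      fun t ht i u => ?_⟩
    · refine le_trans (le_of_eq ?_) (h.one_play t ht)
      rw [Finset.sum_comm (s := Finset.univ (α := I.Joint))]
      refine Finset.sum_congr rfl fun i _ => ?_
      rw [← coll i fun π _ => ∑ a, z π i a t]
      refine Finset.sum_congr rfl fun u _ => ?_
      rw [Finset.sum_comm]
      exact Finset.sum_congr rfl fun π _ => (Finset.sum_mul _ _ _).symm
    · rw [Finset.sum_comm]
      refine Finset.sum_le_sum fun π _ => ?_
      rw [← Finset.sum_mul]
      refine mul_le_mul_of_nonneg_right (le_trans ?_ (h.play_le t ht π)) (by split_ifs <;> norm_num)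
      exact Finset.single_le_sum (f := fun i => ∑ a, z π i a t)
        (fun i _ => Finset.sum_nonneg fun a _ => h.nonneg t ht π i a) (Finset.mem_univ i)
    · exact Finset.sum_nonneg fun π _ =>
        mul_nonneg (h.nonneg t ht π i a) (by split_ifs <;> norm_num)
    · rw [Finset.sum_eq_single I.root (fun π _ hπ => by rw [h.start_other π hπ, zero_mul])
        (fun hn => absurd (Finset.mem_univ _) hn), h.start_root]
      simp
    · refine Finset.sum_eq_zero fun π _ => ?_
      by_cases hπ : π = I.root
      · rw [hπ, if_neg (Ne.symm hu), mul_zero]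
      · rw [h.start_other π hπ, zero_mul]
    · rw [sum_joint_update (h.update t ht) fun π => if π i = u then 1 else 0]
      -- a play on another arm does not move arm `i`
      have inner : ∀ π : I.Joint, ∑ j, ∑ a, z π j a (t - 1) *
          (∑ v, I.trans j (π j) a v * (if Function.update π j v i = u then 1 else 0)
            - if π i = u then 1 else 0)
          = ∑ a, z π i a (t - 1) * (I.trans i (π i) a u - if π i = u then 1 else 0) := fun π => by
        rw [Finset.sum_eq_single i]
        · simp
        · intro j _ hj
          refine Finset.sum_eq_zero fun a _ => ?_
          simp only [Function.update_of_ne (Ne.symm hj), ← Finset.sum_mul, I.trans_sum]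
          ring
        · intro hn
          exact absurd (Finset.mem_univ _) hn
      rw [Finset.sum_congr rfl fun π _ => inner π]
      simp only [mul_sub, Finset.sum_sub_distrib]
      have e1 : ∑ v, ∑ a, (∑ π : I.Joint, z π i a (t - 1) * if π i = v then 1 else 0)
            * I.trans i v a u
          = ∑ π : I.Joint, ∑ a, z π i a (t - 1) * I.trans i (π i) a u := by
        rw [← coll i fun π v => ∑ a, z π i a (t - 1) * I.trans i v a u]
        refine Finset.sum_congr rfl fun v _ => ?_
        simp only [Finset.sum_mul]
        rw [Finset.sum_comm]
        exact Finset.sum_congr rfl fun π _ => Finset.sum_congr rfl fun a _ => by ring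
      rw [e1, Finset.sum_comm (s := Finset.univ (α := Fin I.numActions))]
      ring
  · unfold polyValue expValue
    rw [Finset.sum_comm (s := Finset.univ (α := I.Joint))]
    refine Finset.sum_congr rfl fun i _ => ?_
    rw [← coll i fun π u => ∑ a, I.reward i u a * ∑ t ∈ Finset.Icc 1 I.budget, z π i a t]
    refine Finset.sum_congr rfl fun u _ => ?_
    simp only [Finset.sum_mul]
    rw [Finset.sum_comm (s := Finset.univ (α := I.Joint))]
    refine Finset.sum_congr rfl fun a _ => ?_
    rw [Finset.sum_comm, Finset.mul_sum]
    refine Finset.sum_congr rfl fun π _ => ?_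
    rw [← Finset.sum_mul]
    ring

variable (I)

theorem expFeasible_zero : I.ExpFeasible (fun _ _ _ _ => 0) fun π _ => if π = I.root then 1 else 0 where
  one_play t _ := by simp
  play_le t _ π := by
    simp only [Finset.sum_const_zero]
    split_ifs <;> norm_num
  nonneg t _ π i a := le_rfl
  start_root := if_pos rfl
  start_other π hπ := if_neg hπ
  update t _ π := by simp

theorem optExp_le_optPoly : I.optExp ≤ I.optPoly := by
  obtain ⟨x, s, hopt⟩ := I.exists_polyOptimal
  rw [hopt.optPoly_eq]
  refine csSup_le ⟨_, _, _, I.expFeasible_zero, rfl⟩ ?_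
  rintro w ⟨z, y, h, rfl⟩
  obtain ⟨x', s', h', e⟩ := h.exists_polyFeasible
  rw [← e]
  exact hopt.2 x' s' h'

theorem ExpFeasible.expValue_le_optExp
    {z : I.Joint → Fin I.numArms → Fin I.numActions → ℕ → ℝ} {y : I.Joint → ℕ → ℝ}
    (h : I.ExpFeasible z y) : I.expValue z ≤ I.optExp := by
  obtain ⟨x, s, hopt⟩ := I.exists_polyOptimal
  refine le_csSup ⟨I.polyValue x, ?_⟩ ⟨z, y, h, rfl⟩
  rintro w ⟨z, y, h, rfl⟩
  obtain ⟨x', s', h', e⟩ := h.exists_polyFeasible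
  rw [← e]
  exact hopt.2 x' s' h'

/-- The mean of a future reward `W` after the play `o`, together with the reward of the play. -/
noncomputable def playMean (W : I.Joint → ℝ) (π : I.Joint) :
    Option (Fin I.numArms × Fin I.numActions) → ℝ
  | none => W π
  | some (i, a) => I.reward i (π i) a + ∑ v, I.trans i (π i) a v * W (Function.update π i v)

/-- The greatest expected reward of an adaptive policy in `k` time steps, from the joint node `π`
on. -/
noncomputable def bestReward : ℕ → I.Joint → ℝ
  | 0, _ => 0
  | k + 1, π => Finset.univ.sup' ⟨none, Finset.mem_univ _⟩ (I.playMean (bestReward k) π)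

theorem playMean_le_bestReward (k : ℕ) (π : I.Joint) (o) :
    I.playMean (I.bestReward k) π o ≤ I.bestReward (k + 1) π :=
  Finset.le_sup' (I.playMean (I.bestReward k) π) (Finset.mem_univ o)

theorem bestReward_mono {k l : ℕ} (h : k ≤ l) (π : I.Joint) : I.bestReward k π ≤ I.bestReward l π := by
  induction l, h using Nat.le_induction with
  | base => exact le_rfl
  | succ l _ ih => exact ih.trans (I.playMean_le_bestReward l π none)

theorem exists_best_play (k : ℕ) (π : I.Joint) :
    ∃ o, I.bestReward (k + 1) π = I.playMean (I.bestReward k) π o := by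
  obtain ⟨o, -, ho⟩ := Finset.exists_mem_eq_sup' ⟨none, Finset.mem_univ _⟩
    (I.playMean (I.bestReward k) π)
  exact ⟨o, ho⟩

/-- The law of the joint node at time `τ` (counted from `0`), if the play in each time step is
chosen by `f`. -/
noncomputable def greedyLaw (f : ℕ → I.Joint → Option (Fin I.numArms × Fin I.numActions)) :
    ℕ → I.Joint → ℝ
  | 0, π => if π = I.root then 1 else 0
  | τ + 1, π => greedyLaw f τ π
      - ∑ i, ∑ a, greedyLaw f τ π * (if f τ π = some (i, a) then 1 else 0)
      + ∑ i, ∑ u, ∑ a, greedyLaw f τ (Function.update π i u)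
          * (if f τ (Function.update π i u) = some (i, a) then 1 else 0) * I.trans i u a (π i)

theorem bestReward_le_optExp : I.bestReward I.budget I.root ≤ I.optExp := by
  choose g hg using fun k π => I.exists_best_play k π
  -- with `τ` time steps elapsed, play what is best for the remaining `budget - τ` ones
  set f : ℕ → I.Joint → Option (Fin I.numArms × Fin I.numActions) :=
    fun τ => g (I.budget - 1 - τ) with hf
  set y := I.greedyLaw f with hy
  set z : ℕ → I.Joint → Fin I.numArms → Fin I.numActions → ℝ :=
    fun τ π i a => y τ π * (if f τ π = some (i, a) then 1 else 0) with hz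
  have upd : ∀ τ π, y (τ + 1) π = y τ π - ∑ i, ∑ a, z τ π i a
      + ∑ i, ∑ u, ∑ a, z τ (Function.update π i u) i a * I.trans i u a (π i) := fun τ π => rfl
  have hsumz : ∀ (τ : ℕ) (π : I.Joint) (F : Fin I.numArms → Fin I.numActions → ℝ),
      ∑ i, ∑ a, z τ π i a * F i a
        = y τ π * (match f τ π with | none => 0 | some (i, a) => F i a) := by
    intro τ π F
    cases hfo : f τ π with
    | none => simp [hz, hfo]
    | some o =>
      obtain ⟨j, b⟩ := o
      rw [Finset.sum_eq_single j, Finset.sum_eq_single b]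
      · simp [hz, hfo]
      · intro a _ ha
        simp [hz, hfo, Ne.symm ha]
      · intro hn
        exact absurd (Finset.mem_univ _) hn
      · intro i _ hi
        exact Finset.sum_eq_zero fun a _ => by simp [hz, hfo, Ne.symm hi]
      · intro hn
        exact absurd (Finset.mem_univ _) hn
  have hsumz1 : ∀ τ π, ∑ i, ∑ a, z τ π i a
      = y τ π * (match f τ π with | none => 0 | some _ => 1) := fun τ π => by
    have := hsumz τ π fun _ _ => 1
    simp only [mul_one] at this
    rw [this]
    cases f τ π <;> rfl
  have y_nonneg : ∀ τ π, 0 ≤ y τ π := by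
    intro τ
    induction τ with
    | zero =>
      intro π
      simp only [hy, greedyLaw]
      split_ifs <;> norm_num
    | succ τ ih =>
      intro π
      rw [upd, hsumz1]
      have h1 : 0 ≤ ∑ i, ∑ u, ∑ a, z τ (Function.update π i u) i a * I.trans i u a (π i) :=
        Finset.sum_nonneg fun i _ => Finset.sum_nonneg fun u _ => Finset.sum_nonneg fun a _ =>
          mul_nonneg (mul_nonneg (ih _) (by split_ifs <;> norm_num)) (I.trans_nonneg _ _ _ _)
      have h2 := ih π
      cases f τ π <;> simp only [mul_zero, mul_one] <;> linarith
  have z_nonneg : ∀ τ π i a, 0 ≤ z τ π i a := fun τ π i a =>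
    mul_nonneg (y_nonneg τ π) (by split_ifs <;> norm_num)
  have z_le : ∀ τ π, ∑ i, ∑ a, z τ π i a ≤ y τ π := fun τ π => by
    have h2 := y_nonneg τ π
    rw [hsumz1]
    cases f τ π <;> simp only [mul_zero, mul_one] <;> linarith
  have mass : ∀ τ, ∑ π, y τ π = 1 := by
    intro τ
    induction τ with
    | zero => simp [hy, greedyLaw]
    | succ τ ih =>
      have := sum_joint_update (upd τ) fun _ => 1
      simpa [I.trans_sum, ih] using this
  have feas : I.ExpFeasible (fun π i a t => z (t - 1) π i a) fun π t => y (t - 1) π := by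
    refine ⟨fun t _ => ?_, fun t _ π => z_le _ π, fun t _ π i a => z_nonneg _ π i a, ?_, ?_, ?_⟩
    · rw [← mass (t - 1)]
      exact Finset.sum_le_sum fun π _ => z_le _ π
    · simp [hy, greedyLaw]
    · intro π hπ
      simp [hy, greedyLaw, hπ]
    · intro t ht π
      obtain ⟨k, rfl⟩ : ∃ k, t = k + 2 := ⟨t - 2, by have := Finset.mem_Icc.1 ht; omega⟩
      exact upd k π
  -- the mean of the best future reward drops by the reward that is collected
  have step : ∀ τ, τ < I.budget → ∑ π, y τ π * I.bestReward (I.budget - τ) π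
      = ∑ π, ∑ i, ∑ a, z τ π i a * I.reward i (π i) a
        + ∑ π, y (τ + 1) π * I.bestReward (I.budget - (τ + 1)) π := by
    intro τ hτ
    rw [sum_joint_update (upd τ), ← add_assoc, add_right_comm, ← Finset.sum_add_distrib,
      ← Finset.sum_add_distrib]
    refine Finset.sum_congr rfl fun π _ => ?_
    have e : I.budget - τ = I.budget - 1 - τ + 1 := by omega
    rw [hsumz τ π fun i a => I.reward i (π i) a, hsumz τ π fun i a =>
        ∑ v, I.trans i (π i) a v * I.bestReward (I.budget - (τ + 1)) (Function.update π i v)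
          - I.bestReward (I.budget - (τ + 1)) π,
      e, hg, show I.budget - (τ + 1) = I.budget - 1 - τ by omega]
    have hfg : f τ π = g (I.budget - 1 - τ) π := rfl
    rw [← hfg]
    cases f τ π with
    | none => simp [playMean]
    | some o =>
      simp only [playMean]
      ring
  have tele : ∀ τ, τ ≤ I.budget → I.bestReward I.budget I.root
      = ∑ k ∈ Finset.range τ, (∑ π, ∑ i, ∑ a, z k π i a * I.reward i (π i) a)
        + ∑ π, y τ π * I.bestReward (I.budget - τ) π := by
    intro τ
    induction τ with
    | zero => simp [hy, greedyLaw]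
    | succ τ ih =>
      intro hτ
      rw [ih (by omega), step τ (by omega), Finset.sum_range_succ]
      ring
  refine le_trans (le_of_eq ?_) feas.expValue_le_optExp
  rw [tele I.budget le_rfl, Nat.sub_self]
  simp only [bestReward, mul_zero, Finset.sum_const_zero, add_zero]
  unfold expValue
  rw [Finset.sum_comm]
  refine Finset.sum_congr rfl fun π _ => ?_
  rw [Finset.sum_comm]
  refine Finset.sum_congr rfl fun i _ => ?_
  rw [Finset.sum_comm]
  refine Finset.sum_congr rfl fun a _ => ?_
  rw [Finset.mul_sum, Finset.range_eq_Ico]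
  have := Finset.sum_Ico_add' (fun t => I.reward i (π i) a * z (t - 1) π i a) 0 I.budget 1
  simp only [Nat.add_sub_cancel, zero_add] at this
  rw [show Finset.Icc 1 I.budget = Finset.Ico 1 (I.budget + 1) from rfl, ← this]
  exact Finset.sum_congr rfl fun t _ => mul_comm _ _

end MABInstance

/-! ### Means under laws of finite support -/

/-- The mean of `f` under the law `p`. -/
noncomputable def pmfMean {α : Type*} (p : PMF α) (f : α → ℝ) : ℝ := ∑' a, (p a).toReal * f a

section Mean

variable {α β : Type*}

theorem pmfMean_eq_sum (p : PMF α) (f : α → ℝ) (s : Finset α) (h : ∀ a ∈ p.support, a ∈ s) :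
    pmfMean p f = ∑ a ∈ s, (p a).toReal * f a := by
  refine tsum_eq_sum fun a ha => ?_
  have : p a = 0 := by
    by_contra hc
    exact ha (h a ((p.mem_support_iff a).2 hc))
  simp [this]

theorem pmfMean_fintype [Fintype α] (p : PMF α) (f : α → ℝ) :
    pmfMean p f = ∑ a, (p a).toReal * f a := pmfMean_eq_sum p f _ fun _ _ => Finset.mem_univ _

theorem sum_toReal_eq_one (p : PMF α) (s : Finset α) (h : ∀ a ∈ p.support, a ∈ s) :
    ∑ a ∈ s, (p a).toReal = 1 := by
  have h1 : ∑ a ∈ s, p a = 1 := by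
    rw [← p.tsum_coe]
    refine (tsum_eq_sum fun a ha => ?_).symm
    by_contra hc
    exact ha (h a ((p.mem_support_iff a).2 hc))
  rw [← ENNReal.toReal_sum fun a _ => p.apply_ne_top a, h1, ENNReal.toReal_one]

theorem pmfMean_mono {p : PMF α} (hp : p.support.Finite) {f g : α → ℝ}
    (h : ∀ a ∈ p.support, f a ≤ g a) : pmfMean p f ≤ pmfMean p g := by
  rw [pmfMean_eq_sum p f hp.toFinset (by simp), pmfMean_eq_sum p g hp.toFinset (by simp)]
  exact Finset.sum_le_sum fun a ha =>
    mul_le_mul_of_nonneg_left (h a (by simpa using ha)) ENNReal.toReal_nonneg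

theorem pmfMean_congr {p : PMF α} {f g : α → ℝ} (h : ∀ a ∈ p.support, f a = g a) :
    pmfMean p f = pmfMean p g := by
  refine tsum_congr fun a => ?_
  by_cases ha : a ∈ p.support
  · rw [h a ha]
  · have : p a = 0 := by
      by_contra hc
      exact ha ((p.mem_support_iff a).2 hc)
    simp [this]

theorem pmfMean_eq_const {p : PMF α} (hp : p.support.Finite) {f : α → ℝ} {c : ℝ}
    (h : ∀ a ∈ p.support, f a = c) : pmfMean p f = c := by
  rw [pmfMean_congr h, pmfMean_eq_sum p _ hp.toFinset (by simp), ← Finset.sum_mul,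
    sum_toReal_eq_one p hp.toFinset (by simp), one_mul]

@[simp]
theorem pmfMean_pure (a : α) (f : α → ℝ) : pmfMean (PMF.pure a) f = f a :=
  pmfMean_eq_const (by simp) (by simp)

theorem pmfMean_bind {p : PMF α} {k : α → PMF β} (hp : p.support.Finite)
    (hk : ∀ a, (k a).support.Finite) (f : β → ℝ) :
    pmfMean (p.bind k) f = pmfMean p fun a => pmfMean (k a) f := by
  classical
  set s := hp.toFinset with hs
  set t := s.biUnion fun a => (hk a).toFinset with ht
  have hmem : ∀ a ∈ s, ∀ b ∈ (k a).support, b ∈ t := fun a ha b hb =>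
    Finset.mem_biUnion.2 ⟨a, ha, by simpa using hb⟩
  have h1 : ∀ b, (p.bind k b).toReal = ∑ a ∈ s, (p a).toReal * (k a b).toReal := fun b => by
    rw [PMF.bind_apply, tsum_eq_sum (s := s), ENNReal.toReal_sum]
    · simp only [ENNReal.toReal_mul]
    · exact fun a _ => ENNReal.mul_ne_top (p.apply_ne_top a) ((k a).apply_ne_top b)
    · intro a ha
      have : p a = 0 := by
        by_contra hc
        exact ha (by simpa [hs] using hc)
      rw [this, zero_mul]
  rw [pmfMean_eq_sum _ f t, pmfMean_eq_sum p _ s (by simp [hs])]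
  · rw [Finset.sum_congr rfl fun b _ => by rw [h1 b, Finset.sum_mul], Finset.sum_comm]
    refine Finset.sum_congr rfl fun a ha => ?_
    rw [pmfMean_eq_sum (k a) f t (hmem a ha), Finset.mul_sum]
    exact Finset.sum_congr rfl fun b _ => by ring
  · intro b hb
    obtain ⟨a, ha, hb⟩ := (PMF.mem_support_bind_iff _ _ _).1 hb
    exact hmem a (by simpa [hs] using ha) b hb

theorem pmfMean_map {p : PMF α} (hp : p.support.Finite) (g : α → β) (f : β → ℝ) :
    pmfMean (p.map g) f = pmfMean p fun a => f (g a) := by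
  rw [← PMF.bind_pure_comp, pmfMean_bind hp fun a => by simp]
  simp

end Mean

theorem pmfMean_coin {q : ℝ} (h0 : 0 ≤ q) (h1 : q ≤ 1) (f : Bool → ℝ) :
    pmfMean (coin q) f = q * f true + (1 - q) * f false := by
  rw [pmfMean_fintype, Fintype.sum_bool]
  simp only [coin, PMF.ofFintype_apply, if_true, min_eq_right h1, max_eq_right h0]
  rw [ENNReal.toReal_ofReal h0]
  simp [ENNReal.toReal_ofReal (sub_nonneg.2 h1)]

/-! ### Execution of programs -/

namespace Cmd

variable {I : MABInstance}

/-- The law of the configuration after the first rounds of a loop. -/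
noncomputable def rounds (A : ℕ) (c : Cmd) (σ : Config I) : ℕ → PMF (Config I)
  | 0 => PMF.pure σ.tick
  | k + 1 => (rounds A c σ k).bind fun τ => c.exec (τ.tick.setNat A [] k)

theorem exec_loop (A : ℕ) (e : NatExpr) (c : Cmd) (σ : Config I) :
    (loop A e c).exec σ = c.rounds A σ (e.eval σ.mem) := by
  rw [exec]
  induction e.eval σ.mem with
  | zero => rfl
  | succ k ih => simp only [rounds, ← ih]

theorem _root_.Config.finite_support_play (σ : Config I) (j k A : ℕ) :
    (σ.play j k A).support.Finite := by
  unfold Config.play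
  split_ifs
  · rw [PMF.support_map]
    exact (Set.toFinite _).image _
  · simp

theorem finite_support_rounds {A : ℕ} {c : Cmd} (hc : ∀ σ : Config I, (c.exec σ).support.Finite)
    (σ : Config I) (k : ℕ) : (c.rounds A σ k).support.Finite := by
  induction k with
  | zero => simp [rounds]
  | succ k ih =>
    rw [rounds, PMF.support_bind]
    exact ih.biUnion fun τ _ => hc _

theorem finite_support_exec (c : Cmd) (σ : Config I) : (c.exec σ).support.Finite := by
  induction c generalizing σ with
  | skip => simp [exec]
  | setNat A idx e => simp [exec]
  | setReal A idx e => simp [exec]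
  | seq c d hc hd =>
    rw [exec, PMF.support_bind]
    exact (hc σ).biUnion fun τ _ => hd τ
  | ite b c d hc hd =>
    rw [exec]
    split_ifs
    · exact hc _
    · exact hd _
  | loop A e c hc =>
    rw [exec_loop]
    exact finite_support_rounds hc σ _
  | toss A e =>
    rw [exec, PMF.support_map]
    exact (Set.toFinite _).image _
  | play arm act A =>
    rw [exec]
    exact σ.tick.finite_support_play _ _ _

/-- Every elementary command preserves `R`, and so does every command. -/
theorem exec_induction (R : Config I → Config I → Prop)
    (htrans : ∀ σ τ υ, R σ τ → R τ υ → R σ υ) (htick : ∀ σ, R σ σ.tick)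
    (hnat : ∀ σ A idx k, R σ (σ.setNat A idx k)) (hreal : ∀ σ A idx w, R σ (σ.setReal A idx w))
    (hplay : ∀ σ j k A, ∀ τ ∈ (σ.play j k A).support, R σ τ) (c : Cmd) (σ : Config I) :
    ∀ τ ∈ (c.exec σ).support, R σ τ := by
  induction c generalizing σ with
  | skip =>
    intro τ hτ
    rw [exec, PMF.mem_support_pure_iff] at hτ
    exact hτ ▸ htick σ
  | setNat A idx e =>
    intro τ hτ
    rw [exec, PMF.mem_support_pure_iff] at hτ
    exact hτ ▸ htrans _ _ _ (htick σ) (hnat _ _ _ _)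
  | setReal A idx e =>
    intro τ hτ
    rw [exec, PMF.mem_support_pure_iff] at hτ
    exact hτ ▸ htrans _ _ _ (htick σ) (hreal _ _ _ _)
  | seq c d hc hd =>
    intro υ hυ
    rw [exec] at hυ
    obtain ⟨τ, hτ, hυ⟩ := (PMF.mem_support_bind_iff _ _ _).1 hυ
    exact htrans _ _ _ (hc σ τ hτ) (hd τ υ hυ)
  | ite b c d hc hd =>
    intro τ hτ
    rw [exec] at hτ
    split_ifs at hτ
    · exact htrans _ _ _ (htick σ) (hc _ τ hτ)
    · exact htrans _ _ _ (htick σ) (hd _ τ hτ)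
  | loop A e c hc =>
    rw [exec_loop]
    induction e.eval σ.mem with
    | zero =>
      intro τ hτ
      rw [rounds, PMF.mem_support_pure_iff] at hτ
      exact hτ ▸ htick σ
    | succ k ih =>
      intro υ hυ
      rw [rounds] at hυ
      obtain ⟨τ, hτ, hυ⟩ := (PMF.mem_support_bind_iff _ _ _).1 hυ
      exact htrans _ _ _ (ih τ hτ) (htrans _ _ _ (htrans _ _ _ (htick τ) (hnat _ _ _ _)) (hc _ υ hυ))
  | toss A e =>
    intro τ hτ
    rw [exec] at hτ
    obtain ⟨b, -, rfl⟩ := (PMF.mem_support_map_iff _ _ _).1 hτ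
    exact htrans _ _ _ (htick σ) (hnat _ _ _ _)
  | play arm act A =>
    intro τ hτ
    rw [exec] at hτ
    exact htrans _ _ _ (htick σ) (hplay _ _ _ _ τ hτ)

/-- Once the budget is exhausted, nothing is gained any more. -/
theorem exec_of_budget_le (c : Cmd) {σ : Config I} (hσ : I.budget ≤ σ.clock) :
    ∀ τ ∈ (c.exec σ).support, I.budget ≤ τ.clock ∧ τ.gain = σ.gain := by
  intro τ hτ
  refine exec_induction (fun σ τ => I.budget ≤ σ.clock → I.budget ≤ τ.clock ∧ τ.gain = σ.gain)
    (fun σ τ υ h1 h2 h => ?_) (fun σ h => ⟨h, rfl⟩)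
    (fun σ _ _ _ h => ⟨h, rfl⟩) (fun σ _ _ _ h => ⟨h, rfl⟩) (fun σ j k A τ hτ h => ?_) c σ τ hτ hσ
  · obtain ⟨h3, h4⟩ := h1 h
    obtain ⟨h5, h6⟩ := h2 h3
    exact ⟨h5, h6.trans h4⟩
  · rw [Config.play, dif_neg (by omega), PMF.mem_support_pure_iff] at hτ
    subst hτ
    exact ⟨by dsimp only; omega, rfl⟩

/-! ### Running time -/

/-- The natural-number arrays that hold the bounds of the loops are the input arrays `0`, …, `3`;
the command never writes to them. -/
def Tame : Cmd → Prop
  | skip => True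
  | setNat A _ _ => 4 ≤ A
  | setReal _ _ _ => True
  | seq c d => c.Tame ∧ d.Tame
  | ite _ c d => c.Tame ∧ d.Tame
  | loop A e c => 4 ≤ A ∧ (∃ C ≤ 3, ∃ (d : ℕ) (idx : Fin d → NatExpr), e = NatExpr.read C idx) ∧
      c.Tame
  | toss A _ => 4 ≤ A
  | play _ _ A => 4 ≤ A

/-- A bound on the number of steps of a tame command when every loop has at most `X` rounds. -/
noncomputable def cost : Cmd → Polynomial ℕ
  | skip => 1
  | setNat _ _ _ => 1
  | setReal _ _ _ => 1
  | seq c d => c.cost + d.cost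
  | ite _ c d => 1 + c.cost + d.cost
  | loop _ _ c => 1 + Polynomial.X * (1 + c.cost)
  | toss _ _ => 1
  | play _ _ _ => 1

theorem steps_le (S : ℕ) (c : Cmd) (hc : c.Tame) (σ : Config I)
    (hσ : ∀ A ≤ 3, ∀ idx, σ.mem.nat A idx ≤ S) :
    ∀ τ ∈ (c.exec σ).support, (∀ A ≤ 3, ∀ idx, τ.mem.nat A idx ≤ S) ∧
      τ.steps ≤ σ.steps + c.cost.eval S := by
  have hset : ∀ (τ : Config I), (∀ A ≤ 3, ∀ idx, τ.mem.nat A idx ≤ S) → ∀ A, 4 ≤ A → ∀ idx k,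
      ∀ C ≤ 3, ∀ idx', (τ.setNat A idx k).mem.nat C idx' ≤ S := by
    intro τ hτ A hA idx k C hC idx'
    have : C ≠ A := by omega
    simp only [Config.setNat, Function.update_of_ne this]
    exact hτ C hC idx'
  induction c generalizing σ with
  | skip =>
    intro τ hτ
    rw [exec, PMF.mem_support_pure_iff] at hτ
    subst hτ
    exact ⟨hσ, by simp [Config.tick, cost]⟩
  | setNat A idx e =>
    intro τ hτ
    rw [exec, PMF.mem_support_pure_iff] at hτ
    subst hτ
    exact ⟨hset _ hσ A hc _ _, by simp [Config.tick, Config.setNat, cost]⟩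
  | setReal A idx e =>
    intro τ hτ
    rw [exec, PMF.mem_support_pure_iff] at hτ
    subst hτ
    exact ⟨hσ, by simp [Config.tick, Config.setReal, cost]⟩
  | seq c d ihc ihd =>
    intro υ hυ
    rw [exec] at hυ
    obtain ⟨τ, hτ, hυ⟩ := (PMF.mem_support_bind_iff _ _ _).1 hυ
    have h1 := ihc hc.1 σ hσ τ hτ
    have h2 := ihd hc.2 τ h1.1 υ hυ
    refine ⟨h2.1, ?_⟩
    simp only [cost, Polynomial.eval_add]
    omega
  | ite b c d ihc ihd =>
    intro τ hτ
    rw [exec] at hτ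
    simp only [cost, Polynomial.eval_add, Polynomial.eval_one]
    split_ifs at hτ
    · have h := ihc hc.1 σ.tick hσ τ hτ
      refine ⟨h.1, h.2.trans ?_⟩
      simp only [Config.tick]
      omega
    · have h := ihd hc.2 σ.tick hσ τ hτ
      refine ⟨h.1, h.2.trans ?_⟩
      simp only [Config.tick]
      omega
  | loop A e c ihc =>
    obtain ⟨hA, ⟨C, hC, d, idx, rfl⟩, hc⟩ := hc
    have hN : (NatExpr.read C idx).eval σ.mem ≤ S := hσ C hC _
    have key : ∀ k, ∀ τ ∈ (c.rounds A σ k).support, (∀ A ≤ 3, ∀ idx, τ.mem.nat A idx ≤ S) ∧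
        τ.steps ≤ σ.steps + 1 + k * (1 + c.cost.eval S) := by
      intro k
      induction k with
      | zero =>
        intro τ hτ
        rw [rounds, PMF.mem_support_pure_iff] at hτ
        subst hτ
        exact ⟨hσ, by simp [Config.tick]⟩
      | succ k ihk =>
        intro υ hυ
        rw [rounds] at hυ
        obtain ⟨τ, hτ, hυ⟩ := (PMF.mem_support_bind_iff _ _ _).1 hυ
        have h1 := ihk τ hτ
        have h2 := ihc hc (τ.tick.setNat A [] k) (hset _ h1.1 A hA _ _) υ hυ
        refine ⟨h2.1, h2.2.trans ?_⟩
        have : (τ.tick.setNat A [] k).steps = τ.steps + 1 := rfl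
        rw [this, Nat.succ_mul]
        omega
    intro τ hτ
    rw [exec_loop] at hτ
    have h := key _ τ hτ
    refine ⟨h.1, h.2.trans ?_⟩
    simp only [cost, Polynomial.eval_add, Polynomial.eval_one, Polynomial.eval_mul,
      Polynomial.eval_X]
    have := Nat.mul_le_mul_right (1 + c.cost.eval S) hN
    omega
  | toss A e =>
    intro τ hτ
    rw [exec] at hτ
    obtain ⟨b, -, rfl⟩ := (PMF.mem_support_map_iff _ _ _).1 hτ
    exact ⟨hset _ hσ A hc _ _, by simp [Config.tick, Config.setNat, cost]⟩
  | play arm act A =>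
    intro τ hτ
    rw [exec, Config.play] at hτ
    split_ifs at hτ with h
    · obtain ⟨v, -, rfl⟩ := (PMF.mem_support_map_iff _ _ _).1 hτ
      exact ⟨hset _ hσ A hc _ _, by simp [Config.tick, Config.setNat, cost]⟩
    · rw [PMF.mem_support_pure_iff] at hτ
      subst hτ
      exact ⟨hσ, by simp [Config.tick, cost]⟩

/-! ### No program beats the best adaptive policy -/

theorem pmfMean_transPMF (i : Fin I.numArms) (u : Fin (I.numNodes i)) (a : Fin I.numActions)
    (f : Fin (I.numNodes i) → ℝ) :
    pmfMean (I.transPMF i u a) f = ∑ v, I.trans i u a v * f v := by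
  rw [pmfMean_fintype]
  refine Finset.sum_congr rfl fun v _ => ?_
  simp [MABInstance.transPMF, ENNReal.toReal_ofReal (I.trans_nonneg i u a v)]

/-- The reward so far together with the best expected future reward is a supermartingale. -/
theorem pmfMean_exec_le (c : Cmd) (σ : Config I) :
    pmfMean (c.exec σ) (fun τ => τ.gain + I.bestReward (I.budget - τ.clock) τ.node)
      ≤ σ.gain + I.bestReward (I.budget - σ.clock) σ.node := by
  induction c generalizing σ with
  | skip => simp [exec, Config.tick]
  | setNat A idx e => simp [exec, Config.tick, Config.setNat]
  | setReal A idx e => simp [exec, Config.tick, Config.setReal]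
  | seq c d hc hd =>
    rw [exec, pmfMean_bind (c.finite_support_exec σ) d.finite_support_exec]
    exact (pmfMean_mono (c.finite_support_exec σ) fun τ _ => hd τ).trans (hc σ)
  | ite b c d hc hd =>
    rw [exec]
    split_ifs
    · exact hc σ.tick
    · exact hd σ.tick
  | loop A e c hc =>
    rw [exec_loop]
    induction e.eval σ.mem with
    | zero => simp [rounds, Config.tick]
    | succ k ih =>
      have hfin := finite_support_rounds (A := A) c.finite_support_exec σ k
      rw [rounds, pmfMean_bind hfin fun τ => c.finite_support_exec _]
      exact (pmfMean_mono hfin fun τ _ => hc _).trans ih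
  | toss A e =>
    have hfin : (coin (e.eval σ.mem)).support.Finite := Set.toFinite _
    rw [exec, pmfMean_map hfin]
    refine (pmfMean_eq_const hfin (c := σ.gain + I.bestReward (I.budget - σ.clock) σ.node)
      fun b _ => rfl).le
  | play arm act A =>
    rw [exec, Config.play]
    split_ifs with h
    · rw [pmfMean_map (Set.toFinite _), pmfMean_transPMF]
      have hclock : σ.clock < I.budget := h.2.2
      have e : I.budget - σ.clock = I.budget - (σ.clock + 1) + 1 := by omega
      have := I.playMean_le_bestReward (I.budget - (σ.clock + 1)) σ.node
        (some (⟨_, h.1⟩, ⟨_, h.2.1⟩))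
      rw [← e] at this
      refine le_trans (le_of_eq ?_) (add_le_add (le_refl σ.gain) this)
      simp only [MABInstance.playMean, Config.tick, mul_add, Finset.sum_add_distrib,
        ← Finset.sum_mul, I.trans_sum]
      ring
    · rw [pmfMean_pure]
      exact add_le_add le_rfl (I.bestReward_mono (by simp only [Config.tick]; omega) _)

end Cmd

theorem MABInstance.bestReward_nonneg (I : MABInstance) (k : ℕ) (π : I.Joint) :
    0 ≤ I.bestReward k π := I.bestReward_mono (Nat.zero_le k) π

theorem MABInstance.expectedReward_le_optExp (I : MABInstance) (P : Cmd) (x : I.PlayVar) :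
    I.expectedReward P x ≤ I.optExp := by
  refine le_trans ?_ I.bestReward_le_optExp
  have h := P.pmfMean_exec_le (I.start x)
  have h0 : (I.start x).gain + I.bestReward (I.budget - (I.start x).clock) (I.start x).node
      = I.bestReward I.budget I.root := by simp [MABInstance.start]
  rw [h0] at h
  exact (pmfMean_mono (P.finite_support_exec _) fun τ _ =>
    le_add_of_nonneg_right (I.bestReward_nonneg _ _)).trans h

/-! ### Reasoning about programs -/

namespace Cmd

variable {I : MABInstance}

/-- The reward so far, plus the prospect `f`, which is void when the budget is exhausted. -/
noncomputable def total (f : Config I → ℝ) (σ : Config I) : ℝ :=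
  σ.gain + if σ.clock < I.budget then f σ else 0

/-- From `σ`, the command leads to configurations that satisfy `Q` unless the budget is exhausted,
and the mean of the reward plus the prospect `f` is then `v`. -/
def Achieves (c : Cmd) (σ : Config I) (Q : Config I → Prop) (f : Config I → ℝ) (v : ℝ) : Prop :=
  (∀ τ ∈ (c.exec σ).support, τ.clock < I.budget → Q τ) ∧ pmfMean (c.exec σ) (total f) = v

theorem achieves_of_pure {c : Cmd} {σ τ : Config I} (h : c.exec σ = PMF.pure τ)
    {Q : Config I → Prop} {f : Config I → ℝ} {v : ℝ} (hQ : τ.clock < I.budget → Q τ)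
    (hv : total f τ = v) : c.Achieves σ Q f v := by
  rw [Achieves, h]
  refine ⟨fun υ hυ => ?_, by rw [pmfMean_pure, hv]⟩
  rw [PMF.mem_support_pure_iff] at hυ
  exact hυ ▸ hQ

theorem pmfMean_total_of_budget_le (c : Cmd) {σ : Config I} (hσ : ¬ σ.clock < I.budget)
    (f : Config I → ℝ) : pmfMean (c.exec σ) (total f) = σ.gain := by
  refine pmfMean_eq_const (c.finite_support_exec σ) fun τ hτ => ?_
  obtain ⟨h1, h2⟩ := c.exec_of_budget_le (not_lt.1 hσ) τ hτ
  rw [total, if_neg (by omega), h2, add_zero]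

theorem Achieves.mono {c : Cmd} {σ : Config I} {Q Q' : Config I → Prop} {f f' : Config I → ℝ}
    {v : ℝ} (h : c.Achieves σ Q f v) (hQ : ∀ τ, τ.clock < I.budget → Q τ → Q' τ ∧ f' τ = f τ) :
    c.Achieves σ Q' f' v := by
  refine ⟨fun τ hτ hb => (hQ τ hb (h.1 τ hτ hb)).1, ?_⟩
  rw [← h.2]
  refine pmfMean_congr fun τ hτ => ?_
  unfold total
  split_ifs with hb
  · rw [(hQ τ hb (h.1 τ hτ hb)).2]
  · rfl

theorem Achieves.seq {c d : Cmd} {σ : Config I} {R Q : Config I → Prop} {k f : Config I → ℝ}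
    {v : ℝ} (h : c.Achieves σ R k v)
    (hd : ∀ τ, τ.clock < I.budget → R τ → d.Achieves τ Q f (τ.gain + k τ)) :
    (c.seq d).Achieves σ Q f v := by
  constructor
  · intro υ hυ hb
    rw [exec] at hυ
    obtain ⟨τ, hτ, hυ⟩ := (PMF.mem_support_bind_iff _ _ _).1 hυ
    by_cases hτb : τ.clock < I.budget
    · exact (hd τ hτb (h.1 τ hτ hτb)).1 υ hυ hb
    · have := (d.exec_of_budget_le (not_lt.1 hτb) υ hυ).1
      omega
  · rw [exec, pmfMean_bind (c.finite_support_exec σ) d.finite_support_exec, ← h.2]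
    refine pmfMean_congr fun τ hτ => ?_
    by_cases hτb : τ.clock < I.budget
    · rw [(hd τ hτb (h.1 τ hτ hτb)).2, total, if_pos hτb]
    · rw [d.pmfMean_total_of_budget_le hτb, total, if_neg hτb, add_zero]

theorem Achieves.ite {b : Test} {c d : Cmd} {σ : Config I} {Q : Config I → Prop}
    {f : Config I → ℝ} {v : ℝ} (hc : b.holds σ.mem → c.Achieves σ.tick Q f v)
    (hd : ¬ b.holds σ.mem → d.Achieves σ.tick Q f v) : (Cmd.ite b c d).Achieves σ Q f v := by
  unfold Achieves
  rw [exec]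
  split_ifs with h
  · exact hc h
  · exact hd h

theorem achieves_skip {σ : Config I} {Q : Config I → Prop} {f : Config I → ℝ}
    (hσ : σ.clock < I.budget) (hQ : Q σ.tick) : skip.Achieves σ Q f (σ.gain + f σ.tick) :=
  achieves_of_pure rfl (fun _ => hQ) (by rw [total, if_pos (show σ.tick.clock < I.budget from hσ)]; rfl)

/-- The prospect `V k` and the invariant `Inv k` belong to the moment before round `k`. -/
theorem achieves_loop {A N : ℕ} {e : NatExpr} {c : Cmd} {σ : Config I}
    (Inv : ℕ → Config I → Prop) (V : ℕ → Config I → ℝ) (hN : e.eval σ.mem = N)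
    (hσ : σ.clock < I.budget) (h0 : Inv 0 σ.tick)
    (hstep : ∀ k < N, ∀ τ : Config I, τ.clock < I.budget → Inv k τ →
      c.Achieves (τ.tick.setNat A [] k) (Inv (k + 1)) (V (k + 1)) (τ.gain + V k τ)) :
    (Cmd.loop A e c).Achieves σ (Inv N) (V N) (σ.gain + V 0 σ.tick) := by
  unfold Achieves
  rw [exec_loop, hN]
  suffices ∀ m ≤ N, (∀ τ ∈ (c.rounds A σ m).support, τ.clock < I.budget → Inv m τ) ∧
      pmfMean (c.rounds A σ m) (total (V m)) = σ.gain + V 0 σ.tick from this N le_rfl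
  intro m
  induction m with
  | zero =>
    intro _
    constructor
    · intro τ hτ _
      rw [rounds, PMF.mem_support_pure_iff] at hτ
      exact hτ ▸ h0
    · rw [rounds, pmfMean_pure, total, if_pos (show σ.tick.clock < I.budget from hσ)]
      rfl
  | succ m ih =>
    intro hm
    obtain ⟨ih1, ih2⟩ := ih (by omega)
    constructor
    · intro υ hυ hb
      rw [rounds] at hυ
      obtain ⟨τ, hτ, hυ⟩ := (PMF.mem_support_bind_iff _ _ _).1 hυ
      by_cases hτb : τ.clock < I.budget
      · exact (hstep m (by omega) τ hτb (ih1 τ hτ hτb)).1 υ hυ hb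
      · have := (c.exec_of_budget_le (σ := τ.tick.setNat A [] m) (not_lt.1 hτb) υ hυ).1
        omega
    · rw [rounds, pmfMean_bind (finite_support_rounds c.finite_support_exec σ m)
        fun τ => c.finite_support_exec _, ← ih2]
      refine pmfMean_congr fun τ hτ => ?_
      by_cases hτb : τ.clock < I.budget
      · rw [(hstep m (by omega) τ hτb (ih1 τ hτ hτb)).2, total, if_pos hτb]
      · rw [c.pmfMean_total_of_budget_le (σ := τ.tick.setNat A [] m) hτb, total, if_neg hτb,
          add_zero]
        rfl

theorem achieves_toss_seq {A : ℕ} {e : RealExpr} {c : Cmd} {σ : Config I} {Q : Config I → Prop}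
    {f : Config I → ℝ} {q v w : ℝ} (hq : e.eval σ.mem = q) (h0 : 0 ≤ q) (h1 : q ≤ 1)
    (hv : c.Achieves (σ.tick.setNat A [] 1) Q f v)
    (hw : c.Achieves (σ.tick.setNat A [] 0) Q f w) :
    ((toss A e).seq c).Achieves σ Q f (q * v + (1 - q) * w) := by
  have hfin : (coin q).support.Finite := Set.toFinite _
  have hmap : ((coin q).map fun b => σ.tick.setNat A [] (if b then 1 else 0)).support.Finite := by
    rw [PMF.support_map]
    exact hfin.image _
  unfold Achieves
  rw [exec, exec, hq]
  constructor
  · intro υ hυ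
    obtain ⟨τ, hτ, hυ⟩ := (PMF.mem_support_bind_iff _ _ _).1 hυ
    obtain ⟨b, -, rfl⟩ := (PMF.mem_support_map_iff _ _ _).1 hτ
    cases b
    · exact hw.1 υ hυ
    · exact hv.1 υ hυ
  · rw [pmfMean_bind hmap c.finite_support_exec, pmfMean_map hfin, pmfMean_coin h0 h1, ← hv.2,
      ← hw.2]
    simp

theorem achieves_play_seq {arm act : NatExpr} {A : ℕ} {c : Cmd} {σ : Config I}
    {Q : Config I → Prop} {f : Config I → ℝ} (i : Fin I.numArms) (a : Fin I.numActions)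
    (hi : arm.eval σ.mem = i) (ha : act.eval σ.mem = a) (hσ : σ.clock < I.budget)
    {w : Fin (I.numNodes i) → ℝ}
    (hw : ∀ v, c.Achieves { σ.tick.setNat A [] v.val with
        node := Function.update σ.node i v
        clock := σ.clock + 1
        gain := σ.gain + I.reward i (σ.node i) a } Q f (w v)) :
    ((play arm act A).seq c).Achieves σ Q f (∑ v, I.trans i (σ.node i) a v * w v) := by
  have h : (i : ℕ) < I.numArms ∧ (a : ℕ) < I.numActions ∧ σ.tick.clock < I.budget :=
    ⟨i.2, a.2, hσ⟩
  have hplay : (play arm act A).exec σ = (I.transPMF i (σ.node i) a).map fun v =>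
      { σ.tick.setNat A [] v.val with
        node := Function.update σ.node i v
        clock := σ.clock + 1
        gain := σ.gain + I.reward i (σ.node i) a } := by
    rw [exec, hi, ha, Config.play, dif_pos h]
    rfl
  have hfin : (I.transPMF i (σ.node i) a).support.Finite := Set.toFinite _
  unfold Achieves
  rw [exec]
  constructor
  · intro υ hυ
    obtain ⟨τ, hτ, hυ⟩ := (PMF.mem_support_bind_iff _ _ _).1 hυ
    rw [hplay] at hτ
    obtain ⟨v, -, rfl⟩ := (PMF.mem_support_map_iff _ _ _).1 hτ
    exact (hw v).1 υ hυ
  · rw [pmfMean_bind (finite_support_exec _ _) c.finite_support_exec, hplay, pmfMean_map hfin,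
      pmfMean_transPMF]
    exact Finset.sum_congr rfl fun v _ => by rw [(hw v).2]

end Cmd

/-- The prospects between the rounds of a loop. -/
theorem exists_loopOp {H : Type*} (op : ℕ → H → H) (p : H → Prop) (hp : ∀ k h, p h → p (op k h))
    (N : ℕ) {h : H} (hh : p h) : ∃ F : ℕ → H, F 0 = loopOp N op h ∧ F N = h ∧
      (∀ k < N, F k = op k (F (k + 1))) ∧ ∀ k, p (F k) := by
  induction N generalizing h with
  | zero => exact ⟨fun _ => h, rfl, rfl, fun k hk => absurd hk (Nat.not_lt_zero k), fun _ => hh⟩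
  | succ N ih =>
    obtain ⟨F, h0, hN, hF, hpF⟩ := ih (hp N h hh)
    refine ⟨fun k => if k ≤ N then F k else h, ?_, ?_, fun k hk => ?_, fun k => ?_⟩
    · simpa [loopOp] using h0
    · simp
    · rcases Nat.lt_succ_iff_lt_or_eq.1 hk with hk | rfl
      · simp only [hk.le, Nat.succ_le_of_lt hk, if_true]
        exact hF k hk
      · simp [hN]
    · dsimp only
      split_ifs
      · exact hpF k
      · exact hh

theorem loopOp_induction {H : Type*} {op : ℕ → H → H} {p : H → Prop}
    (hp : ∀ k h, p h → p (op k h)) (N : ℕ) {h : H} (hh : p h) : p (loopOp N op h) := by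
  obtain ⟨F, h0, -, -, hF⟩ := exists_loopOp op p hp N hh
  exact h0 ▸ hF 0

/-! ### Memory cells -/

/-- The scalar `A`. -/
abbrev NatExpr.var (A : ℕ) : NatExpr := .read A ![]

/-- The cell `A[e]`. -/
abbrev NatExpr.cell (A : ℕ) (e : NatExpr) : NatExpr := .read A ![e]

section Cells

variable (m : Memory)

@[simp]
theorem ofFn_eval_zero (idx : Fin 0 → NatExpr) : (List.ofFn fun j => (idx j).eval m) = [] := by
  simp

@[simp]
theorem ofFn_eval_one (e : NatExpr) :
    (List.ofFn fun j => ((![e] : Fin 1 → NatExpr) j).eval m) = [e.eval m] := by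
  simp

@[simp]
theorem ofFn_eval_three (e f g : NatExpr) :
    (List.ofFn fun j => ((![e, f, g] : Fin 3 → NatExpr) j).eval m)
      = [e.eval m, f.eval m, g.eval m] := by
  simp [List.ofFn_succ]

@[simp]
theorem ofFn_eval_four (e f g h : NatExpr) :
    (List.ofFn fun j => ((![e, f, g, h] : Fin 4 → NatExpr) j).eval m)
      = [e.eval m, f.eval m, g.eval m, h.eval m] := by
  simp [List.ofFn_succ]

@[simp]
theorem NatExpr.eval_var (A : ℕ) : (NatExpr.var A).eval m = m.nat A [] := by
  simp [NatExpr.eval]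

@[simp]
theorem NatExpr.eval_cell (A : ℕ) (e : NatExpr) : (NatExpr.cell A e).eval m = m.nat A [e.eval m] := by
  simp [NatExpr.eval]

theorem NatExpr.eval_const (c : ℕ) : (NatExpr.const c).eval m = c := rfl

theorem NatExpr.eval_add (e f : NatExpr) : (e.add f).eval m = e.eval m + f.eval m := rfl

theorem NatExpr.eval_sub (e f : NatExpr) : (e.sub f).eval m = e.eval m - f.eval m := rfl

end Cells

namespace Config

variable {I : MABInstance} (σ : Config I)

@[simp] theorem tick_mem : σ.tick.mem = σ.mem := rfl
@[simp] theorem tick_clock : σ.tick.clock = σ.clock := rfl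
@[simp] theorem tick_gain : σ.tick.gain = σ.gain := rfl

variable (A : ℕ) (idx : List ℕ)

@[simp] theorem setNat_node (k : ℕ) : (σ.setNat A idx k).node = σ.node := rfl
@[simp] theorem setNat_clock (k : ℕ) : (σ.setNat A idx k).clock = σ.clock := rfl
@[simp] theorem setNat_gain (k : ℕ) : (σ.setNat A idx k).gain = σ.gain := rfl
@[simp] theorem setNat_mem_real (k : ℕ) : (σ.setNat A idx k).mem.real = σ.mem.real := rfl

@[simp]
theorem setNat_mem_nat (k C : ℕ) (idx' : List ℕ) :
    (σ.setNat A idx k).mem.nat C idx' = if C = A ∧ idx' = idx then k else σ.mem.nat C idx' := by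
  simp only [setNat, Function.update_apply]
  by_cases h : C = A
  · subst h
    simp [Function.update_apply]
  · simp [h]

@[simp] theorem setReal_gain (w : ℝ) : (σ.setReal A idx w).gain = σ.gain := rfl
@[simp] theorem setReal_mem_nat (w : ℝ) : (σ.setReal A idx w).mem.nat = σ.mem.nat := rfl

@[simp]
theorem setReal_mem_real (w : ℝ) (C : ℕ) (idx' : List ℕ) :
    (σ.setReal A idx w).mem.real C idx'
      = if C = A ∧ idx' = idx then w else σ.mem.real C idx' := by
  simp only [setReal, Function.update_apply]
  by_cases h : C = A
  · subst h
    simp [Function.update_apply]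
  · simp [h]

end Config

namespace Cmd

variable {I : MABInstance} {σ : Config I} {Q : Config I → Prop} {f : Config I → ℝ}

theorem achieves_setNat {A d : ℕ} {idx : Fin d → NatExpr} {e : NatExpr}
    (hσ : σ.clock < I.budget)
    (hQ : Q (σ.tick.setNat A (List.ofFn fun j => (idx j).eval σ.mem) (e.eval σ.mem))) :
    (setNat A idx e).Achieves σ Q f
      (σ.gain + f (σ.tick.setNat A (List.ofFn fun j => (idx j).eval σ.mem) (e.eval σ.mem))) := by
  refine achieves_of_pure rfl (fun _ => hQ) ?_
  rw [total, if_pos]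
  · rfl
  · exact hσ

theorem achieves_setReal {A d : ℕ} {idx : Fin d → NatExpr} {e : RealExpr}
    (hσ : σ.clock < I.budget)
    (hQ : Q (σ.tick.setReal A (List.ofFn fun j => (idx j).eval σ.mem) (e.eval σ.mem))) :
    (setReal A idx e).Achieves σ Q f
      (σ.gain + f (σ.tick.setReal A (List.ofFn fun j => (idx j).eval σ.mem) (e.eval σ.mem))) := by
  refine achieves_of_pure rfl (fun _ => hQ) ?_
  rw [total, if_pos]
  · rfl
  · exact hσ

theorem achieves_setNat_seq {A d : ℕ} {idx : Fin d → NatExpr} {e : NatExpr} {c : Cmd} {v : ℝ}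
    (h : c.Achieves (σ.tick.setNat A (List.ofFn fun j => (idx j).eval σ.mem) (e.eval σ.mem)) Q f v) :
    ((setNat A idx e).seq c).Achieves σ Q f v := by
  unfold Achieves
  rw [exec, exec, PMF.pure_bind]
  exact h

theorem achieves_setReal_seq {A d : ℕ} {idx : Fin d → NatExpr} {e : RealExpr} {c : Cmd} {v : ℝ}
    (h : c.Achieves (σ.tick.setReal A (List.ofFn fun j => (idx j).eval σ.mem) (e.eval σ.mem)) Q f
      v) : ((setReal A idx e).seq c).Achieves σ Q f v := by
  unfold Achieves
  rw [exec, exec, PMF.pure_bind]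
  exact h

end Cmd

/-! ### The program -/

namespace MABProgram

open Cmd NatExpr

/-- The probability `s_{u,t}` that arm `9[]` is on the node `12[]` at the beginning of time
`t = 8[] + 2`, from those for time `8[] + 1`. -/
def nodeCell : Cmd :=
  (setReal 3 ![var 9, var 12, (var 8).add (const 2)]
    (.read 3 ![var 9, var 12, (var 8).add (const 1)])).seq
  ((loop 11 (var 1) (setReal 3 ![var 9, var 12, (var 8).add (const 2)]
    (.sub (.read 3 ![var 9, var 12, (var 8).add (const 2)])
      (.read 2 ![var 9, var 12, var 11, (var 8).add (const 1)])))).seq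
  (loop 13 (cell 3 (var 9)) (loop 11 (var 1)
    (setReal 3 ![var 9, var 12, (var 8).add (const 2)]
      (.add (.read 3 ![var 9, var 12, (var 8).add (const 2)])
        (.mul (.read 2 ![var 9, var 13, var 11, (var 8).add (const 1)])
          (.read 1 ![var 9, var 13, var 11, var 12])))))))

/-- The probabilities `s_{u,t}` for the nodes `u` of arm `9[]`; the array `4` holds the roots. -/
def armCells : Cmd :=
  (setReal 3 ![var 9, cell 4 (var 9), const 1] (.const 1)).seq
    (loop 8 (var 2) (loop 12 (cell 3 (var 9)) nodeCell))

/-- The values of the variables `s_{u,t}`, which are determined by `x`, are written to the array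
`3[i,u,t]`. -/
def tabulate : Cmd := loop 9 (var 0) armCells

/-- Each arm is selected with probability `1/3`.  The virtual time `6[i]` of the other arms is set
to the budget, so that they are never played. -/
def select : Cmd :=
  loop 9 (var 0) ((toss 14 (.const (1 / 3))).seq
    (ite (.natLe (var 14) (const 0)) (setNat 6 ![var 9] (var 2)) skip))

/-- If no action has been chosen yet (`14[] = 0`), action `11[]` is chosen for arm `9[]` with the
conditional probability that is proportional to `x`, where `4[]` is the mass of the actions that are
still possible, and it is played. -/
def tryAction : Cmd :=
  ite (.natLe (var 14) (const 0))
    ((toss 14 (.div (.read 2 ![var 9, cell 4 (var 9), var 11, cell 6 (var 9)])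
      (.read 4 ![]))).seq
    (ite (.natLe (const 1) (var 14))
      ((play (var 9) (var 11) 15).seq
        ((setNat 4 ![var 9] (var 15)).seq
          (setNat 7 ![var 9] ((cell 7 (var 9)).add (const 1)))))
      (setReal 4 ![] (.sub (.read 4 ![])
        (.read 2 ![var 9, cell 4 (var 9), var 11, cell 6 (var 9)])))))
    skip

/-- One time step of the policy of arm `9[]` is simulated: with probability `x^a_{u,t} / s_{u,t}`
action `a` is played, where `u` is the current node of the arm and `t` its new virtual time. -/
def simulateStep : Cmd :=
  (setNat 6 ![var 9] ((cell 6 (var 9)).add (const 1))).seq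
  ((setNat 14 ![] (const 0)).seq
  ((setReal 4 ![] (.read 3 ![var 9, cell 4 (var 9), cell 6 (var 9)])).seq
  (loop 11 (var 1) tryAction)))

/-- In round `8[]`, arm `9[]` is advanced if its virtual time `6[i]` is less than the budget, and at
most `8[]` or less than twice the number `7[i]` of its plays.  The sum in the test is the maximum of
`8[] + 1` and `2 * 7[i]`. -/
def advance : Cmd :=
  ite (.and (.natLe ((cell 6 (var 9)).add (const 1)) (var 2))
      (.natLe ((cell 6 (var 9)).add (const 1))
        (((var 8).add (const 1)).add
          (((cell 7 (var 9)).add (cell 7 (var 9))).sub ((var 8).add (const 1))))))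
    simulateStep skip

/-- The rounds. -/
def rounds : Cmd := loop 8 (var 2) (loop 9 (var 0) (loop 10 (var 2) advance))

/-- The algorithm. -/
def program : Cmd := tabulate.seq (select.seq rounds)

theorem tame_program : program.Tame := by
  simp only [program, tabulate, armCells, nodeCell, select, rounds, advance, simulateStep,
    tryAction, Cmd.Tame]
  refine ⟨⟨by norm_num, ⟨0, by norm_num, _, _, rfl⟩, trivial, by norm_num,
    ⟨2, by norm_num, _, _, rfl⟩, by norm_num, ⟨3, by norm_num, _, _, rfl⟩, trivial,
    ⟨by norm_num, ⟨1, by norm_num, _, _, rfl⟩, trivial⟩, by norm_num,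
    ⟨3, by norm_num, _, _, rfl⟩, by norm_num, ⟨1, by norm_num, _, _, rfl⟩, trivial⟩,
    ⟨by norm_num, ⟨0, by norm_num, _, _, rfl⟩, by norm_num, by norm_num, trivial⟩,
    by norm_num, ⟨2, by norm_num, _, _, rfl⟩, by norm_num, ⟨0, by norm_num, _, _, rfl⟩,
    by norm_num, ⟨2, by norm_num, _, _, rfl⟩, ⟨by norm_num, by norm_num, trivial, by norm_num,
    ⟨1, by norm_num, _, _, rfl⟩, ?_⟩, trivial⟩
  norm_num

end MABProgram

/-! ### Tabulation of the node probabilities -/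

namespace MABProgram

open Cmd NatExpr

variable {I : MABInstance} {x : I.PlayVar}

theorem input_play (i : Fin I.numArms) (u : Fin (I.numNodes i)) (a : Fin I.numActions) {t : ℕ}
    (ht : t < I.budget) : (I.input x).real 2 [i, u, a, t + 1] = x i u a (t + 1) := by
  simp [MABInstance.input, show t + 1 ≤ I.budget from ht]

theorem input_trans (i : Fin I.numArms) (u : Fin (I.numNodes i)) (a : Fin I.numActions)
    (v : Fin (I.numNodes i)) : (I.input x).real 1 [i, u, a, v] = I.trans i u a v := by
  simp [MABInstance.input]

theorem input_numNodes (i : Fin I.numArms) : (I.input x).nat 3 [i] = I.numNodes i := by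
  simp [MABInstance.input]

theorem input_root (i : Fin I.numArms) : (I.input x).nat 4 [i] = I.root i := by
  simp [MABInstance.input]

/-- The memory has been altered only in natural-number arrays `A ≥ 8` and in real arrays
`A ≥ 3`, and no arm has been played. -/
structure Fresh (x : I.PlayVar) (σ : Config I) : Prop where
  nat : ∀ A < 8, ∀ idx, σ.mem.nat A idx = (I.input x).nat A idx
  real : ∀ A < 3, ∀ idx, σ.mem.real A idx = (I.input x).real A idx
  node : σ.node = I.root
  clock : σ.clock = 0

theorem Fresh.tick {σ : Config I} (h : Fresh x σ) : Fresh x σ.tick := ⟨h.1, h.2, h.3, h.4⟩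

theorem Fresh.setNat {σ : Config I} (h : Fresh x σ) {A : ℕ} (hA : 8 ≤ A) (idx : List ℕ) (k : ℕ) :
    Fresh x (σ.setNat A idx k) where
  nat C hC idx' := by
    rw [Config.setNat_mem_nat, if_neg (by omega)]
    exact h.nat C hC idx'
  real := h.real
  node := h.node
  clock := h.clock

theorem Fresh.setReal {σ : Config I} (h : Fresh x σ) {A : ℕ} (hA : 3 ≤ A) (idx : List ℕ) (w : ℝ) :
    Fresh x (σ.setReal A idx w) where
  nat := h.nat
  real C hC idx' := by
    rw [Config.setReal_mem_real, if_neg (by omega)]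
    exact h.real C hC idx'
  node := h.node
  clock := h.clock

/-- The situation while the cell `3[i,u,t+2]` is computed: it holds `w`, and all other cells of
the array `3` are as in `base`. -/
structure CellState (x : I.PlayVar) (base : List ℕ → ℝ) (t i u : ℕ) (w : ℝ) (σ : Config I) :
    Prop where
  fresh : Fresh x σ
  time : σ.mem.nat 8 [] = t
  arm : σ.mem.nat 9 [] = i
  node : σ.mem.nat 12 [] = u
  value : ∀ idx, σ.mem.real 3 idx = if idx = [i, u, t + 2] then w else base idx

theorem CellState.tick_setNat {base : List ℕ → ℝ} {t i u : ℕ} {w : ℝ} {σ : Config I}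
    (h : CellState x base t i u w σ) {A : ℕ} (h8 : 8 ≤ A) (hA : A ≠ 8 ∧ A ≠ 9 ∧ A ≠ 12)
    (idx : List ℕ) (k : ℕ) : CellState x base t i u w (σ.tick.setNat A idx k) where
  fresh := h.fresh.tick.setNat h8 _ _
  time := by simp [hA.1.symm, h.time]
  arm := by simp [hA.2.1.symm, h.arm]
  node := by simp [hA.2.2.symm, h.node]
  value := h.value

theorem CellState.tick {base : List ℕ → ℝ} {t i u : ℕ} {w : ℝ} {σ : Config I}
    (h : CellState x base t i u w σ) : CellState x base t i u w σ.tick :=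
  ⟨h.fresh.tick, h.time, h.arm, h.node, h.value⟩

theorem CellState.setReal {base : List ℕ → ℝ} {t i u : ℕ} {w : ℝ} {σ : Config I}
    (h : CellState x base t i u w σ) (w' : ℝ) :
    CellState x base t i u w' (σ.tick.setReal 3 [i, u, t + 2] w') where
  fresh := h.fresh.tick.setReal (by norm_num) _ _
  time := h.time
  arm := h.arm
  node := h.node
  value idx := by
    simp only [Config.setReal_mem_real, Config.tick_mem, true_and]
    split_ifs with hi
    · rfl
    · rw [h.value, if_neg hi]

theorem Fresh.clock_lt {σ : Config I} (h : Fresh x σ) (hB : 0 < I.budget) :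
    σ.clock < I.budget := h.clock ▸ hB

theorem achieves_nodeCell (C : ℝ) {t : ℕ} (ht : t < I.budget) (i : Fin I.numArms)
    (u : Fin (I.numNodes i)) {σ : Config I} (h : Fresh x σ) (h8 : σ.mem.nat 8 [] = t)
    (h9 : σ.mem.nat 9 [] = i) (h12 : σ.mem.nat 12 [] = u)
    (hs : σ.mem.real 3 [i, u, t + 1] = I.nodeProb x i t u) :
    nodeCell.Achieves σ
      (CellState x (σ.mem.real 3) t i u (I.nodeProb x i (t + 1) u)) (fun _ => C) (σ.gain + C) := by
  have hB : 0 < I.budget := by omega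
  set base := σ.mem.real 3 with hbase
  refine achieves_setReal_seq ?_
  have hcell : CellState x base t i u (I.nodeProb x i t u)
      (σ.tick.setReal 3 [i, u, t + 2] (I.nodeProb x i t u)) :=
    ⟨h.tick.setReal (by norm_num) _ _, h8, h9, h12, fun idx => by simp [hbase]⟩
  have e : σ.tick.setReal 3 (List.ofFn fun j => ((![var 9, var 12, (var 8).add (const 2)] :
      Fin 3 → NatExpr) j).eval σ.mem)
      ((RealExpr.read 3 ![var 9, var 12, (var 8).add (const 1)]).eval σ.mem)
      = σ.tick.setReal 3 [i, u, t + 2] (I.nodeProb x i t u) := by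
    simp only [ofFn_eval_three, eval_var, eval_const, eval_add, RealExpr.eval, h8, h9, h12, hs, ← hbase]
  rw [e]
  -- the value of the cell after `k` rounds of the first inner loop
  set w1 : ℕ → ℝ := fun k => I.nodeProb x i t u
    - ∑ a ∈ Finset.range k, (I.input x).real 2 [i, u, a, t + 1] with hw1
  set w2 : ℕ → ℕ → ℝ := fun n k => w1 I.numActions
    + ∑ v ∈ Finset.range n, ∑ a ∈ Finset.range I.numActions,
      (I.input x).real 2 [i, v, a, t + 1] * (I.input x).real 1 [i, v, a, u]
    + ∑ a ∈ Finset.range k,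
      (I.input x).real 2 [i, n, a, t + 1] * (I.input x).real 1 [i, n, a, u] with hw2
  have hlast : w2 (I.numNodes i) 0 = I.nodeProb x i (t + 1) u := by
    simp only [hw2, hw1, Finset.range_zero, Finset.sum_empty, add_zero]
    simp only [Finset.sum_range, input_trans, input_play _ _ _ ht, MABInstance.nodeProb]
  have acts : ∀ τ : Config I, Fresh x τ → (var 1).eval τ.mem = I.numActions := fun τ hτ => by
    rw [eval_var, hτ.nat 1 (by norm_num)]
    rfl
  refine Achieves.seq (R := CellState x base t i u (w1 I.numActions)) (k := fun _ => C) ?_ ?_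
  · refine achieves_loop (fun k => CellState x base t i u (w1 k)) (fun _ _ => C)
      (acts _ hcell.fresh) (hcell.fresh.clock_lt hB) (by simpa [hw1] using hcell.tick) ?_
    intro k hk τ _ hτ
    have h' := hτ.tick_setNat (A := 11) (by norm_num) (by norm_num) [] k
    refine achieves_setReal (h'.fresh.clock_lt hB) ?_
    have hx := h'.fresh.real 2 (by norm_num) [i, u, k, t + 1]
    have hv := h'.value [i, u, t + 2]
    rw [if_pos rfl] at hv
    have hk11 : (τ.tick.setNat 11 [] k).mem.nat 11 [] = k := by simp
    simp only [ofFn_eval_three, ofFn_eval_four, eval_var, eval_const, eval_add, RealExpr.eval, h'.time,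
      h'.arm, h'.node, hx, hv, hk11]
    have : w1 k - (I.input x).real 2 [i, u, k, t + 1] = w1 (k + 1) := by
      simp only [hw1, Finset.sum_range_succ]
      ring
    rw [this]
    exact h'.setReal _
  · intro τ _ hτ
    rw [← hlast]
    refine achieves_loop (fun n => CellState x base t i u (w2 n 0)) (fun _ _ => C)
      (by rw [eval_cell, eval_var, hτ.arm, hτ.fresh.nat 3 (by norm_num), input_numNodes])
      (hτ.fresh.clock_lt hB) (by simpa [hw2] using hτ.tick) ?_
    intro n hn τ _ hτ
    have h' := hτ.tick_setNat (A := 13) (by norm_num) (by norm_num) [] n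
    have hn' : w2 (n + 1) 0 = w2 n I.numActions := by
      simp [hw2, Finset.sum_range_succ, add_assoc]
    rw [hn']
    refine (achieves_loop (fun k τ => CellState x base t i u (w2 n k) τ ∧ τ.mem.nat 13 [] = n)
      (fun _ _ => C) (acts _ h'.fresh) (h'.fresh.clock_lt hB) ⟨h'.tick, by simp⟩ ?_).mono
      fun τ _ hτ => ⟨hτ.1, rfl⟩
    intro k hk τ _ hτ
    have h' := hτ.1.tick_setNat (A := 11) (by norm_num) (by norm_num) [] k
    refine achieves_setReal (h'.fresh.clock_lt hB) ?_
    have hx := h'.fresh.real 2 (by norm_num) [i, n, k, t + 1]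
    have hp := h'.fresh.real 1 (by norm_num) [i, n, k, u]
    have hv := h'.value [i, u, t + 2]
    rw [if_pos rfl] at hv
    have hk11 : (τ.tick.setNat 11 [] k).mem.nat 11 [] = k := by simp
    have hk13 : (τ.tick.setNat 11 [] k).mem.nat 13 [] = n := by simp [hτ.2]
    simp only [ofFn_eval_three, ofFn_eval_four, eval_var, eval_const, eval_add, RealExpr.eval, h'.time,
      h'.arm, h'.node, hx, hv, hp, hk11, hk13]
    have : w2 n k + (I.input x).real 2 [i, n, k, t + 1] * (I.input x).real 1 [i, n, k, u]
        = w2 n (k + 1) := by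
      simp only [hw2, Finset.sum_range_succ _ k]
      ring
    rw [this]
    exact ⟨h'.setReal _, hk13⟩

/-- The cells of arm `i` hold the probabilities up to time `t`, and the cells of the other arms are
as in `base`. -/
structure ArmTable (x : I.PlayVar) (base : List ℕ → ℝ) (i : Fin I.numArms) (t : ℕ) (σ : Config I) :
    Prop where
  fresh : Fresh x σ
  arm : σ.mem.nat 9 [] = i
  value : ∀ t' ≤ t, ∀ u : Fin (I.numNodes i), σ.mem.real 3 [i, u, t' + 1] = I.nodeProb x i t' u
  other : ∀ (j : ℕ) (idx : List ℕ), j ≠ i → σ.mem.real 3 (j :: idx) = base (j :: idx)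

theorem achieves_armCells (C : ℝ) (hB : 0 < I.budget) (i : Fin I.numArms) {σ : Config I}
    (h : Fresh x σ) (h9 : σ.mem.nat 9 [] = i)
    (h0 : ∀ u : Fin (I.numNodes i), σ.mem.real 3 [i, u, 1] = 0) :
    armCells.Achieves σ (ArmTable x (σ.mem.real 3) i I.budget) (fun _ => C) (σ.gain + C) := by
  set base := σ.mem.real 3 with hbase
  refine achieves_setReal_seq ?_
  simp only [ofFn_eval_three, eval_var, eval_cell, eval_const, RealExpr.eval, h9,
    h.nat 4 (by norm_num), input_root]
  have h1 : ArmTable x base i 0 (σ.tick.setReal 3 [i, I.root i, 1] ((1 : ℚ) : ℝ)) := by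
    refine ⟨h.tick.setReal (by norm_num) _ _, h9, fun t' ht' u => ?_, fun j idx hj => ?_⟩
    · obtain rfl : t' = 0 := by omega
      rw [Config.setReal_mem_real, MABInstance.nodeProb]
      by_cases hu : u = I.root i
      · simp [hu]
      · have : (u : ℕ) ≠ I.root i := fun h => hu (Fin.ext h)
        simp [hu, this, ← hbase, h0]
    · simp [hj, hbase]
  have hg : (σ.tick.setReal 3 [(i : ℕ), I.root i, 1] ((1 : ℚ) : ℝ)).gain = σ.gain := rfl
  rw [← hg]
  generalize σ.tick.setReal 3 [(i : ℕ), I.root i, 1] ((1 : ℚ) : ℝ) = σ₁ at h1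
  refine achieves_loop (fun t => ArmTable x base i t) (fun _ _ => C)
    (by rw [eval_var, h1.fresh.nat 2 (by norm_num)]; rfl) (h1.fresh.clock_lt hB)
    ⟨h1.fresh.tick, h1.arm, h1.value, h1.other⟩ ?_
  intro t ht τ _ hτ
  have harm : (τ.tick.setNat 8 [] t).mem.nat 9 [] = i := by simp [hτ.arm]
  have hfresh : Fresh x (τ.tick.setNat 8 [] t) := hτ.fresh.tick.setNat le_rfl _ _
  -- the cells for time `t + 2` of the nodes before node `k` have been computed
  refine (achieves_loop (fun k υ => Fresh x υ ∧ υ.mem.nat 8 [] = t ∧ υ.mem.nat 9 [] = i ∧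
      (∀ u : Fin (I.numNodes i), u.val < k → υ.mem.real 3 [i, u, t + 2] = I.nodeProb x i (t + 1) u)
      ∧ ∀ idx, (∀ u, idx ≠ [↑i, u, t + 2]) → υ.mem.real 3 idx = τ.mem.real 3 idx) (fun _ _ => C)
    (by rw [eval_cell, eval_var, harm, hfresh.nat 3 (by norm_num), input_numNodes])
    (hfresh.clock_lt hB)
    ⟨hfresh.tick, by simp, by simp [hτ.arm], fun u hu => absurd hu (Nat.not_lt_zero _),
      fun idx _ => rfl⟩ ?_).mono ?_
  · rintro k hk υ _ ⟨h1, h2, h3, h4, h5⟩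
    have key := achieves_nodeCell C ht i ⟨k, hk⟩ (h1.tick.setNat (A := 12) (by norm_num) [] k)
      (by simp [h2]) (by simp [h3]) (by simp) (by
        have h6 := h5 [i, k, t + 1] (by simp)
        have h7 := hτ.value t le_rfl ⟨k, hk⟩
        exact h6.trans h7)
    refine key.mono ?_
    rintro ρ - ⟨g1, g2, g3, -, g4⟩
    simp only [Config.setNat_mem_real, Config.tick_mem] at g4
    refine ⟨⟨g1, g2, g3, fun u hu => ?_, fun idx hidx => ?_⟩, rfl⟩
    · rw [g4]
      split_ifs with hu'
      · have : u = ⟨k, hk⟩ := Fin.ext (by simpa using hu')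
        rw [this]
      · refine h4 u (lt_of_le_of_ne (Nat.lt_succ_iff.1 hu) fun hu => hu' ?_)
        simp [hu]
    · rw [g4, if_neg (hidx k), h5 idx hidx]
  · rintro υ - ⟨h1, -, h3, h4, h5⟩
    refine ⟨⟨h1, h3, fun t' ht' u => ?_, fun j idx hj => ?_⟩, rfl⟩
    · rcases Nat.le_succ_iff.1 ht' with ht' | rfl
      · rw [h5 _ (by simp; omega), hτ.value t' ht' u]
      · exact h4 u u.2
    · rw [h5 _ (by simp [hj]), hτ.other j idx hj]

/-- All probabilities have been tabulated. -/
structure Tabulated (x : I.PlayVar) (σ : Config I) : Prop where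
  fresh : Fresh x σ
  value : ∀ i, ∀ t ≤ I.budget, ∀ u : Fin (I.numNodes i),
    σ.mem.real 3 [i, u, t + 1] = I.nodeProb x i t u

theorem achieves_tabulate (C : ℝ) (hB : 0 < I.budget) :
    tabulate.Achieves (I.start x) (Tabulated x) (fun _ => C) ((I.start x).gain + C) := by
  have hstart : Fresh x (I.start x) := ⟨fun _ _ _ => rfl, fun _ _ _ => rfl, rfl, rfl⟩
  refine (achieves_loop (e := var 0) (fun k σ => Fresh x σ ∧
    (∀ i : Fin I.numArms, i.val < k → ∀ t ≤ I.budget, ∀ u : Fin (I.numNodes i),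
      σ.mem.real 3 [i, u, t + 1] = I.nodeProb x i t u) ∧
    ∀ i : Fin I.numArms, k ≤ i.val → ∀ u : Fin (I.numNodes i), σ.mem.real 3 [i, u, 1] = 0)
    (fun _ _ => C) (N := I.numArms) (by rw [eval_var]; rfl)
    (hstart.clock_lt hB) ⟨hstart.tick, fun i hi => absurd hi (Nat.not_lt_zero _),
      fun i _ u => rfl⟩ ?_).mono ?_
  · rintro k hk σ _ ⟨h1, h2, h3⟩
    have key := achieves_armCells C hB ⟨k, hk⟩
      (h1.tick.setNat (A := 9) (by norm_num) [] k)
      (by simp) (fun u => h3 ⟨k, hk⟩ le_rfl u)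
    refine key.mono ?_
    rintro τ - ⟨g1, -, g3, g4⟩
    refine ⟨⟨g1, fun i hi t ht u => ?_, fun i hi u => ?_⟩, rfl⟩
    · rcases Nat.lt_succ_iff_lt_or_eq.1 hi with hi | rfl
      · rw [g4 i _ hi.ne]
        exact h2 i hi t ht u
      · exact g3 t ht u
    · rw [g4 i _ (by simp; omega)]
      exact h3 i (by omega) u
  · rintro σ - ⟨h1, h2, -⟩
    exact ⟨⟨h1, fun i => h2 i i.2⟩, rfl⟩

end MABProgram

/-! ### The policies of the arms that a solution of the relaxation describes -/

namespace MABInstance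

variable {I : MABInstance} {x : I.PlayVar} {s : I.NodeVar}

theorem PolyFeasible.play_nonneg (h : I.PolyFeasible x s) {τ : ℕ} (hτ : τ < I.budget)
    (i : Fin I.numArms) (u : Fin (I.numNodes i)) (a : Fin I.numActions) : 0 ≤ x i u a (τ + 1) :=
  h.nonneg (τ + 1) (Finset.mem_Icc.2 ⟨by omega, hτ⟩) i u a

theorem PolyFeasible.sum_play_le (h : I.PolyFeasible x s) {τ : ℕ} (hτ : τ < I.budget)
    (i : Fin I.numArms) (u : Fin (I.numNodes i)) :
    ∑ a, x i u a (τ + 1) ≤ I.nodeProb x i τ u := by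
  rw [← h.node_eq hτ]
  exact h.play_le (τ + 1) (Finset.mem_Icc.2 ⟨by omega, hτ⟩) i u

theorem PolyFeasible.nodeProb_nonneg (h : I.PolyFeasible x s) {τ : ℕ} (hτ : τ < I.budget)
    (i : Fin I.numArms) (u : Fin (I.numNodes i)) : 0 ≤ I.nodeProb x i τ u :=
  (Finset.sum_nonneg fun a _ => h.play_nonneg hτ i u a).trans (h.sum_play_le hτ i u)

theorem PolyFeasible.nodeProb_mul_div (h : I.PolyFeasible x s) {τ : ℕ} (hτ : τ < I.budget)
    (i : Fin I.numArms) (u : Fin (I.numNodes i)) (a : Fin I.numActions) :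
    I.nodeProb x i τ u * (x i u a (τ + 1) / I.nodeProb x i τ u) = x i u a (τ + 1) := by
  by_cases h0 : I.nodeProb x i τ u = 0
  · have h1 := (Finset.single_le_sum (f := fun a => x i u a (τ + 1))
      (fun a _ => h.play_nonneg hτ i u a) (Finset.mem_univ a)).trans (h.sum_play_le hτ i u)
    have h2 := h.play_nonneg hτ i u a
    rw [h0, zero_mul]
    linarith
  · field_simp

/-- On node `u` at virtual time `τ`, action `a` is played with the conditional probability
`x^a_{u,τ+1} / s_{u,τ+1}`. -/
noncomputable def PolyFeasible.policy (h : I.PolyFeasible x s) (i : Fin I.numArms) :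
    ArmPolicy (Fin (I.numNodes i)) (Fin I.numActions) where
  root := I.root i
  act τ u a := if τ < I.budget then x i u a (τ + 1) / I.nodeProb x i τ u else 0
  move := I.trans i
  act_nonneg τ u a := by
    split_ifs with hτ
    · exact div_nonneg (h.play_nonneg hτ i u a) (h.nodeProb_nonneg hτ i u)
    · exact le_rfl
  act_sum_le τ u := by
    split_ifs with hτ
    · rw [← Finset.sum_div]
      exact div_le_one_of_le₀ (h.sum_play_le hτ i u) (h.nodeProb_nonneg hτ i u)
    · simp
  move_nonneg := I.trans_nonneg i
  move_sum := I.trans_sum i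

theorem PolyFeasible.occupancy_policy (h : I.PolyFeasible x s) (i : Fin I.numArms) {τ : ℕ}
    (hτ : τ ≤ I.budget) (u : Fin (I.numNodes i)) :
    (h.policy i).occupancy τ u = I.nodeProb x i τ u := by
  induction τ generalizing u with
  | zero => rfl
  | succ τ ih =>
    have key : ∀ v a, (h.policy i).occupancy τ v * (h.policy i).act τ v a = x i v a (τ + 1) :=
      fun v a => by
        rw [ih (by omega), policy]
        dsimp only
        rw [if_pos (by omega), h.nodeProb_mul_div (by omega)]
    simp only [ArmPolicy.occupancy, key, nodeProb]
    rw [ih (by omega)]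
    rfl

theorem PolyFeasible.occupancy_mul_act (h : I.PolyFeasible x s) (i : Fin I.numArms) {τ : ℕ}
    (hτ : τ < I.budget) (u : Fin (I.numNodes i)) (a : Fin I.numActions) :
    (h.policy i).occupancy τ u * (h.policy i).act τ u a = x i u a (τ + 1) := by
  rw [h.occupancy_policy i hτ.le, policy]
  dsimp only
  rw [if_pos hτ, h.nodeProb_mul_div hτ]

theorem PolyFeasible.sum_expectedPlays_le (h : I.PolyFeasible x s) {t : ℕ} (ht : t ≤ I.budget) :
    ∑ i, (h.policy i).expectedPlays t ≤ t := by
  have e : ∀ i, (h.policy i).expectedPlays t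
      = ∑ τ ∈ Finset.range t, ∑ u, ∑ a, x i u a (τ + 1) := fun i => by
    rw [ArmPolicy.expectedPlays, ArmPolicy.future_zero_root]
    refine Finset.sum_congr rfl fun τ hτ => Finset.sum_congr rfl fun u _ => ?_
    rw [Finset.mul_sum]
    have := Finset.mem_range.1 hτ
    exact Finset.sum_congr rfl fun a _ => h.occupancy_mul_act i (by omega) u a
  rw [Finset.sum_congr rfl fun i _ => e i, Finset.sum_comm]
  calc ∑ τ ∈ Finset.range t, ∑ i, ∑ u, ∑ a, x i u a (τ + 1)
      ≤ ∑ τ ∈ Finset.range t, (1 : ℝ) := Finset.sum_le_sum fun τ hτ => by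
        have := Finset.mem_range.1 hτ
        exact h.one_play (τ + 1) (Finset.mem_Icc.2 ⟨by omega, by omega⟩)
    _ = t := by simp

theorem PolyFeasible.sum_future_policy (h : I.PolyFeasible x s) :
    ∑ i, (h.policy i).future (rewardRate (h.policy i) (I.reward i)) I.budget 0 (h.policy i).root
      = I.polyValue x := by
  refine Finset.sum_congr rfl fun i _ => ?_
  rw [ArmPolicy.future_zero_root, Finset.sum_comm]
  refine Finset.sum_congr rfl fun u _ => ?_
  simp only [rewardRate, Finset.mul_sum]
  rw [Finset.sum_comm]
  refine Finset.sum_congr rfl fun a _ => ?_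
  have hs := Finset.sum_Ico_eq_sum_range (fun t => I.reward i u a * x i u a t) 1 (I.budget + 1)
  rw [show Finset.Icc 1 I.budget = Finset.Ico 1 (I.budget + 1) from rfl, hs, Nat.add_sub_cancel]
  refine Finset.sum_congr rfl fun τ hτ => ?_
  rw [add_comm 1 τ, ← h.occupancy_mul_act i (Finset.mem_range.1 hτ)]
  ring

end MABInstance

/-- Actions are tried in turn: action `b` is chosen with the conditional probability
`X b / (m - ∑ c < b, X c)`, and then it is worth `y b`; no action is worth `w`.  The values
`U b` before action `b` is tried are such that `U 0` is the mean worth when action `b` is chosen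
with probability `X b / m`. -/
theorem exists_sequential_choice {n : ℕ} {X : ℕ → ℝ} {m : ℝ} (hX : ∀ b < n, 0 ≤ X b)
    (hm : ∑ b ∈ Finset.range n, X b ≤ m) (y : ℕ → ℝ) (w : ℝ) :
    ∃ U : ℕ → ℝ, U n = w ∧
      (∀ b < n, U b = X b / (m - ∑ c ∈ Finset.range b, X c) * y b
        + (1 - X b / (m - ∑ c ∈ Finset.range b, X c)) * U (b + 1)) ∧
      U 0 = ∑ b ∈ Finset.range n, X b / m * y b + (1 - ∑ b ∈ Finset.range n, X b / m) * w := by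
  refine ⟨fun b => w + (∑ c ∈ Finset.Ico b n, X c * (y c - w)) / (m - ∑ c ∈ Finset.range b, X c),
    by simp, fun b hb => ?_, ?_⟩
  · dsimp only
    rw [Finset.sum_eq_sum_Ico_succ_bot hb, Finset.sum_range_succ]
    set R := m - ∑ c ∈ Finset.range b, X c with hR
    set S := ∑ c ∈ Finset.Ico (b + 1) n, X c * (y c - w) with hS
    have e : m - (∑ c ∈ Finset.range b, X c + X b) = R - X b := by rw [hR]; ring
    rw [e]
    have hle : X b + ∑ c ∈ Finset.Ico (b + 1) n, X c ≤ R := by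
      rw [← Finset.sum_eq_sum_Ico_succ_bot hb, hR]
      have := Finset.sum_range_add_sum_Ico X hb.le
      linarith
    have hpos : ∀ c ∈ Finset.Ico (b + 1) n, 0 ≤ X c := fun c hc => hX c (Finset.mem_Ico.1 hc).2
    have h0 := hX b hb
    have hT := Finset.sum_nonneg hpos
    by_cases hRX : R - X b = 0
    · -- the remaining mass is exhausted, so the later actions have mass `0`
      have hzero : S = 0 := by
        refine Finset.sum_eq_zero fun c hc => ?_
        rw [(Finset.sum_eq_zero_iff_of_nonneg hpos).1 (by linarith) c hc, zero_mul]
      rw [hRX, hzero]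
      by_cases hR0 : R = 0
      · rw [hR0]
        simp
      · field_simp
        ring
    · have hR0 : R ≠ 0 := fun h => hRX (by linarith)
      field_simp
      ring
  · simp only [Finset.range_zero, Finset.sum_empty, sub_zero, ← Finset.range_eq_Ico, mul_sub,
      Finset.sum_sub_distrib, ← Finset.sum_mul, ← Finset.sum_div, sub_div, div_mul_eq_mul_div]
    ring

/-! ### The states of the arms in the memory -/

namespace MABProgram

open Cmd NatExpr

variable {I : MABInstance} {x : I.PlayVar} {s : I.NodeVar}

/-- The states of the arms: the virtual times are in the array `6` and the numbers of plays in the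
array `7`. -/
def armStates (σ : Config I) : ∀ i, ArmState I.budget (Fin (I.numNodes i)) := fun i =>
  (⟨min (σ.mem.nat 6 [i]) I.budget, by omega⟩, ⟨min (σ.mem.nat 7 [i]) I.budget, by omega⟩, σ.node i)

theorem armStates_congr {σ τ : Config I} (h6 : ∀ i : Fin I.numArms, σ.mem.nat 6 [i] = τ.mem.nat 6 [i])
    (h7 : ∀ i : Fin I.numArms, σ.mem.nat 7 [i] = τ.mem.nat 7 [i]) (hn : σ.node = τ.node) :
    armStates σ = armStates τ := by
  funext i
  simp only [armStates, h6, h7, hn]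

/-- The instance, the solution `x` of the relaxation and the table of the node probabilities are
intact, the array `4` holds the nodes of the arms, and the array `7` counts the plays. -/
structure Intact (x : I.PlayVar) (σ : Config I) : Prop where
  nat : ∀ A < 4, ∀ idx, σ.mem.nat A idx = (I.input x).nat A idx
  real : ∀ A < 3, ∀ idx, σ.mem.real A idx = (I.input x).real A idx
  table : ∀ i, ∀ t ≤ I.budget, ∀ u : Fin (I.numNodes i),
    σ.mem.real 3 [i, u, t + 1] = I.nodeProb x i t u
  node : ∀ i : Fin I.numArms, σ.mem.nat 4 [i] = σ.node i
  time : ∀ i : Fin I.numArms, σ.mem.nat 6 [i] ≤ I.budget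
  clock : σ.clock = ∑ i : Fin I.numArms, σ.mem.nat 7 [i]

namespace Intact

variable {σ : Config I}

theorem tick (h : Intact x σ) : Intact x σ.tick := ⟨h.1, h.2, h.3, h.4, h.5, h.6⟩

theorem setNat (h : Intact x σ) {A : ℕ} (hA : 8 ≤ A) (idx : List ℕ) (k : ℕ) :
    Intact x (σ.setNat A idx k) where
  nat C hC idx' := by
    rw [Config.setNat_mem_nat, if_neg (by omega)]
    exact h.nat C hC idx'
  real := h.real
  table := h.table
  node i := by
    rw [Config.setNat_mem_nat, if_neg (by omega)]
    exact h.node i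
  time i := by
    rw [Config.setNat_mem_nat, if_neg (by omega)]
    exact h.time i
  clock := by
    simp only [Config.setNat_mem_nat, show ¬ 7 = A by omega, false_and, if_false]
    exact h.clock

theorem setReal (h : Intact x σ) {A : ℕ} (hA : 4 ≤ A) (idx : List ℕ) (w : ℝ) :
    Intact x (σ.setReal A idx w) where
  nat := h.nat
  real C hC idx' := by
    rw [Config.setReal_mem_real, if_neg (by omega)]
    exact h.real C hC idx'
  table i t ht u := by
    rw [Config.setReal_mem_real, if_neg (by omega)]
    exact h.table i t ht u
  node := h.node
  time := h.time
  clock := h.clock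

/-- The virtual time of arm `i` is changed. -/
theorem setTime (h : Intact x σ) (i : Fin I.numArms) {k : ℕ} (hk : k ≤ I.budget) :
    Intact x (σ.setNat 6 [i] k) where
  nat C hC idx' := by
    rw [Config.setNat_mem_nat, if_neg (by omega)]
    exact h.nat C hC idx'
  real := h.real
  table := h.table
  node j := by simpa using h.node j
  time j := by
    rw [Config.setNat_mem_nat]
    split_ifs
    · exact hk
    · exact h.time j
  clock := by simpa using h.clock

theorem plays_le (h : Intact x σ) (hσ : σ.clock ≤ I.budget) (i : Fin I.numArms) :
    σ.mem.nat 7 [i] ≤ I.budget :=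
  (Finset.single_le_sum (f := fun i : Fin I.numArms => σ.mem.nat 7 [i]) (fun _ _ => Nat.zero_le _)
    (Finset.mem_univ i)).trans (h.clock ▸ hσ)

theorem armStates_time (h : Intact x σ) (i : Fin I.numArms) :
    (armStates σ i).1.val = σ.mem.nat 6 [i] := min_eq_left (h.time i)

theorem armStates_plays (h : Intact x σ) (hσ : σ.clock ≤ I.budget) (i : Fin I.numArms) :
    (armStates σ i).2.1.val = σ.mem.nat 7 [i] := min_eq_left (h.plays_le hσ i)

theorem totalPlays_armStates (h : Intact x σ) (hσ : σ.clock ≤ I.budget) :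
    totalPlays (armStates σ) = σ.clock := by
  rw [h.clock]
  exact Finset.sum_congr rfl fun i _ => h.armStates_plays hσ i

/-- Nothing is to be expected any more when the budget is exhausted. -/
theorem total_eq (h : Intact x σ) (hσ : σ.clock ≤ I.budget)
    {g : (∀ i, ArmState I.budget (Fin (I.numNodes i))) → ℝ}
    (hg : ∀ ω, I.budget ≤ totalPlays ω → g ω = 0) :
    total (fun τ => g (armStates τ)) σ = σ.gain + g (armStates σ) := by
  unfold total
  split_ifs with hb
  · rfl
  · rw [hg _ (by rw [h.totalPlays_armStates hσ]; omega)]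

end Intact

theorem armStates_setNat {A : ℕ} (hA : 8 ≤ A) (σ : Config I) (idx : List ℕ) (k : ℕ) :
    armStates (σ.setNat A idx k) = armStates σ :=
  armStates_congr (fun i => by rw [Config.setNat_mem_nat, if_neg (by omega)])
    (fun i => by rw [Config.setNat_mem_nat, if_neg (by omega)]) rfl

theorem armStates_setReal (σ : Config I) (A : ℕ) (idx : List ℕ) (w : ℝ) :
    armStates (σ.setReal A idx w) = armStates σ := rfl

theorem armStates_tick (σ : Config I) : armStates σ.tick = armStates σ := rfl

theorem armStates_setTime (σ : Config I) (i : Fin I.numArms) {k : ℕ} (hk : k ≤ I.budget) :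
    armStates (σ.setNat 6 [i] k)
      = Function.update (armStates σ) i (⟨k, by omega⟩, (armStates σ i).2) := by
  funext j
  by_cases hj : j = i
  · subst hj
    simp [armStates, hk]
  · have : (j : ℕ) ≠ i := fun h => hj (Fin.ext h)
    simp [armStates, hj, this]

theorem Tabulated.intact {σ : Config I} (h : Tabulated x σ) : Intact x σ where
  nat A hA := h.fresh.nat A (by omega)
  real := h.fresh.real
  table := h.value
  node i := by rw [h.fresh.nat 4 (by norm_num), input_root, h.fresh.node]
  time i := by
    rw [h.fresh.nat 6 (by norm_num)]
    simp [MABInstance.input]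
  clock := by
    rw [h.fresh.clock]
    refine (Finset.sum_eq_zero fun i _ => ?_).symm
    rw [h.fresh.nat 7 (by norm_num)]
    simp [MABInstance.input]

theorem Tabulated.armStates_eq {σ : Config I} (h : Tabulated x σ) :
    armStates σ = fun i => (0, 0, I.root i) := by
  funext i
  simp only [armStates, h.fresh.nat 6 (by norm_num), h.fresh.nat 7 (by norm_num), h.fresh.node]
  simp [MABInstance.input]

/-! ### Selection of the arms -/

theorem achieves_select (g : (∀ i, ArmState I.budget (Fin (I.numNodes i))) → ℝ) {σ : Config I}
    (hσ : σ.clock < I.budget) (h : Intact x σ) :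
    select.Achieves σ (Intact x) (fun τ => g (armStates τ))
      (σ.gain + selectValue g (armStates σ)) := by
  obtain ⟨F, hF0, hFN, hF, -⟩ := exists_loopOp (fun i h => if hi : i < I.numArms then
    selectStep (B := I.budget) (N := fun i => Fin (I.numNodes i)) ⟨i, hi⟩ h else h)
    (fun _ => True) (fun _ _ _ => trivial) I.numArms (h := g) trivial
  rw [selectValue, ← hF0, ← hFN]
  refine achieves_loop (fun _ => Intact x) (fun k τ => F k (armStates τ))
    (by rw [eval_var, h.nat 0 (by norm_num)]; rfl) hσ h.tick ?_
  intro k hk τ hτ hI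
  have h1 : Intact x (τ.tick.setNat 9 [] k) := hI.tick.setNat (by norm_num) _ _
  have ea : ∀ b, armStates ((τ.tick.setNat 9 [] k).tick.setNat 14 [] b) = armStates τ := fun b => by
    rw [armStates_setNat (by norm_num), armStates_tick, armStates_setNat (by norm_num),
      armStates_tick]
  have hv : τ.gain + F k (armStates τ) = 1 / 3 * (τ.gain + F (k + 1) (armStates τ))
      + (1 - 1 / 3) * (τ.gain + F (k + 1) (Function.update (armStates τ) ⟨k, hk⟩
        (Fin.last I.budget, (armStates τ ⟨k, hk⟩).2))) := by
    rw [hF k hk, dif_pos hk, selectStep]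
    ring
  rw [hv]
  refine achieves_toss_seq (by simp [RealExpr.eval]) (by norm_num) (by norm_num) ?_ ?_
  · refine Achieves.ite (fun hc => absurd hc (by simp [Test.holds, eval_const])) fun _ => ?_
    have := achieves_skip (Q := Intact x) (f := fun τ => F (k + 1) (armStates τ))
      (σ := ((τ.tick.setNat 9 [] k).tick.setNat 14 [] 1).tick) hτ
      ((h1.tick.setNat (by norm_num) _ _).tick.tick)
    rwa [armStates_tick, armStates_tick, ea] at this
  · refine Achieves.ite (fun _ => ?_) fun hc => absurd (by simp [Test.holds, eval_const]) hc
    have h2 := ((h1.tick.setNat (A := 14) (by norm_num) [] 0).tick.tick).setTime ⟨k, hk⟩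
      (le_refl I.budget)
    have e9 : ((τ.tick.setNat 9 [] k).tick.setNat 14 [] 0).tick.mem.nat 9 [] = k := by simp
    have e2 : ((τ.tick.setNat 9 [] k).tick.setNat 14 [] 0).tick.mem.nat 2 [] = I.budget := by
      simp [hI.nat 2 (by norm_num), MABInstance.input]
    have := achieves_setNat (Q := Intact x) (f := fun τ => F (k + 1) (armStates τ))
      (σ := ((τ.tick.setNat 9 [] k).tick.setNat 14 [] 0).tick) (A := 6) (idx := ![var 9])
      (e := var 2) hτ (by
        simp only [ofFn_eval_one, eval_var, e9, e2]
        exact h2)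
    simp only [ofFn_eval_one, eval_var, e9, e2] at this
    rw [armStates_setTime _ ⟨k, hk⟩ le_rfl, armStates_tick, armStates_tick, ea] at this
    exact this

end MABProgram

/-! ### Advancing an arm -/

namespace MABProgram

open Cmd NatExpr

variable {I : MABInstance} {x : I.PlayVar} {s : I.NodeVar}

/-- The successor of `ω` when arm `i` is played and moves to `v`. -/
def afterPlay (i : Fin I.numArms) (ω : ∀ i, ArmState I.budget (Fin (I.numNodes i)))
    (v : Fin (I.numNodes i)) : ∀ i, ArmState I.budget (Fin (I.numNodes i)) :=
  Function.update ω i (bump (ω i).1, bump (ω i).2.1, v)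

/-- The successor of `ω` when a time step of the policy of arm `i` passes without a play. -/
def afterIdle (i : Fin I.numArms) (ω : ∀ i, ArmState I.budget (Fin (I.numNodes i))) :
    ∀ i, ArmState I.budget (Fin (I.numNodes i)) :=
  Function.update ω i (bump (ω i).1, (ω i).2.1, (ω i).2.2)

theorem afterPlay_eq (i : Fin I.numArms) (ω : ∀ i, ArmState I.budget (Fin (I.numNodes i)))
    (v : Fin (I.numNodes i)) : afterPlay i ω v
      = Function.update (afterIdle i ω) i
        ((afterIdle i ω i).1, bump (afterIdle i ω i).2.1, v) := by
  simp [afterPlay, afterIdle]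

/-- The reward of action `b` and the prospect after it has been played. -/
noncomputable def actionWorth (g : (∀ i, ArmState I.budget (Fin (I.numNodes i))) → ℝ)
    (i : Fin I.numArms) (ω : ∀ i, ArmState I.budget (Fin (I.numNodes i))) (b : ℕ) : ℝ :=
  if hb : b < I.numActions then I.reward i (ω i).2.2 ⟨b, hb⟩
    + ∑ v, I.trans i (ω i).2.2 ⟨b, hb⟩ v * g (afterPlay i ω v) else 0

/-- In round `t`, before action `b` of arm `i` is tried: if no action has been chosen, then the
states of the arms are those that follow `ω` when no play is made, and the remaining mass is
known. -/
structure Trying (x : I.PlayVar) (t : ℕ) (i : Fin I.numArms)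
    (ω : ∀ i, ArmState I.budget (Fin (I.numNodes i))) (m : ℝ) (X : ℕ → ℝ) (b : ℕ) (σ : Config I) :
    Prop where
  intact : Intact x σ
  round : σ.mem.nat 8 [] = t
  arm : σ.mem.nat 9 [] = i
  idle : σ.mem.nat 14 [] = 0 → armStates σ = afterIdle i ω ∧
    σ.mem.real 4 [] = m - ∑ c ∈ Finset.range b, X c

theorem achieves_play_record {g : (∀ i, ArmState I.budget (Fin (I.numNodes i))) → ℝ}
    (hg : ∀ ω, I.budget ≤ totalPlays ω → g ω = 0) {i : Fin I.numArms} {a : Fin I.numActions}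
    {σ : Config I} (hσ : σ.clock < I.budget) (h : Intact x σ) (h9 : σ.mem.nat 9 [] = i)
    (h11 : σ.mem.nat 11 [] = a) :
    ((play (var 9) (var 11) 15).seq ((setNat 4 ![var 9] (var 15)).seq
      (setNat 7 ![var 9] ((cell 7 (var 9)).add (const 1))))).Achieves σ
      (fun τ => Intact x τ ∧ ∀ A, 8 ≤ A → A ≠ 15 → ∀ idx, τ.mem.nat A idx = σ.mem.nat A idx)
      (fun τ => g (armStates τ))
      (∑ v, I.trans i (σ.node i) a v * (σ.gain + I.reward i (σ.node i) a
        + g (Function.update (armStates σ) i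
          ((armStates σ i).1, bump (armStates σ i).2.1, v)))) := by
  refine achieves_play_seq (arm := var 9) (act := var 11) i a (by rw [eval_var, h9])
    (by rw [eval_var, h11]) hσ fun v => ?_
  set ρ : Config I := { σ.tick.setNat 15 [] v.val with
      node := Function.update σ.node i v
      clock := σ.clock + 1
      gain := σ.gain + I.reward i (σ.node i) a } with hρ
  have hmem : ∀ A, A ≠ 15 → ∀ idx, ρ.mem.nat A idx = σ.mem.nat A idx := fun A hA idx =>
    (Config.setNat_mem_nat σ.tick 15 [] v.val A idx).trans (if_neg fun hc => hA hc.1)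
  have hreal : ρ.mem.real = σ.mem.real := rfl
  have h15 : ρ.mem.nat 15 [] = v := (Config.setNat_mem_nat σ.tick 15 [] v.val 15 []).trans
    (if_pos ⟨rfl, rfl⟩)
  have hnode : ρ.node = Function.update σ.node i v := rfl
  have hclock : ρ.clock = σ.clock + 1 := rfl
  have hgain : ρ.gain = σ.gain + I.reward i (σ.node i) a := rfl
  clear_value ρ
  refine achieves_setNat_seq ?_
  rw [ofFn_eval_one, eval_var, eval_var, hmem 9 (by norm_num), h9, h15]
  set ρ' := ρ.tick.setNat 4 [i] v with hρ'
  have e7 : ((cell 7 (var 9)).add (const 1)).eval ρ'.mem = σ.mem.nat 7 [i] + 1 := by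
    simp [eval_add, eval_const, hρ', hmem, h9]
  have e9 : (var 9).eval ρ'.mem = i := by simp [hρ', hmem, h9]
  set υ := ρ'.tick.setNat 7 [i] (σ.mem.nat 7 [i] + 1) with hυ
  have hυmem : ∀ A idx, υ.mem.nat A idx = if A = 7 ∧ idx = [↑i] then σ.mem.nat 7 [i] + 1
      else if A = 4 ∧ idx = [↑i] then v.val else ρ.mem.nat A idx := fun A idx => by
    rw [hυ, Config.setNat_mem_nat, Config.tick_mem, hρ', Config.setNat_mem_nat, Config.tick_mem]
  have hυreal : υ.mem.real = σ.mem.real := hreal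
  have hυnode : υ.node = Function.update σ.node i v := hnode
  have hυclock : υ.clock = σ.clock + 1 := hclock
  have hυgain : υ.gain = σ.gain + I.reward i (σ.node i) a := hgain
  have hv : ∀ j : Fin I.numArms, (j : ℕ) = i ↔ j = i := fun j => Fin.ext_iff.symm
  have h7 : ∀ j : Fin I.numArms, υ.mem.nat 7 [j]
      = if j = i then σ.mem.nat 7 [i] + 1 else σ.mem.nat 7 [j] := fun j => by
    rw [hυmem, hmem _ (by norm_num)]
    simp [hv]
  have h6 : ∀ j : Fin I.numArms, υ.mem.nat 6 [j] = σ.mem.nat 6 [j] := fun j => by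
    rw [hυmem, hmem _ (by norm_num)]
    simp
  have hint : Intact x υ := by
    refine ⟨fun A hA idx => ?_, fun A hA idx => ?_, fun j t ht u => ?_, fun j => ?_, fun j => ?_, ?_⟩
    · rw [hυmem, if_neg (by omega), if_neg (by omega), hmem A (by omega), h.nat A hA]
    · rw [hυreal, h.real A hA]
    · rw [hυreal, h.table j t ht u]
    · rw [hυmem, hυnode, hmem _ (by norm_num)]
      by_cases hj : j = i
      · subst hj
        simp
      · simp [hv, hj, h.node j]
    · rw [h6]
      exact h.time j
    · rw [hυclock, h.clock, Finset.sum_congr rfl fun j _ => h7 j,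
        ← Finset.add_sum_erase _ _ (Finset.mem_univ i),
        ← Finset.add_sum_erase Finset.univ (fun j : Fin I.numArms => if j = i then
          σ.mem.nat 7 [i] + 1 else σ.mem.nat 7 [j]) (Finset.mem_univ i), if_pos rfl,
        Finset.sum_congr rfl fun j hj => if_neg (Finset.ne_of_mem_erase hj)]
      omega
  have hstates : armStates υ = Function.update (armStates σ) i
      ((armStates σ i).1, bump (armStates σ i).2.1, v) := by
    funext j
    simp only [armStates, h6, h7, hυnode]
    by_cases hj : j = i
    · subst hj
      simp only [if_true, Function.update_self, bump]
      congr 2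
      exact Fin.ext (by dsimp only; omega)
    · simp only [hj, if_false, Function.update_of_ne, ne_eq, not_false_eq_true]
      rfl
  refine achieves_of_pure (τ := υ) (by rw [exec, e7, ofFn_eval_one, e9]) (fun _ => ⟨hint, ?_⟩) ?_
  · intro A h8 hA idx
    rw [hυmem, if_neg (by omega), if_neg (by omega), hmem A hA]
  · rw [hint.total_eq (by omega) hg, hυgain, hstates]

theorem achieves_tryAction {g : (∀ i, ArmState I.budget (Fin (I.numNodes i))) → ℝ}
    (hg : ∀ ω, I.budget ≤ totalPlays ω → g ω = 0) {t τ : ℕ} {i : Fin I.numArms}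
    {ω : ∀ i, ArmState I.budget (Fin (I.numNodes i))} (hτ : (bump (ω i).1).val = τ)
    {m : ℝ} {X U : ℕ → ℝ} (hXdef : ∀ b, X b = (I.input x).real 2 [i, (ω i).2.2, b, τ])
    (hX : ∀ b < I.numActions, 0 ≤ X b) (hm : ∑ b ∈ Finset.range I.numActions, X b ≤ m)
    {b : ℕ} (hb : b < I.numActions)
    (hU : U b = X b / (m - ∑ c ∈ Finset.range b, X c) * actionWorth g i ω b
      + (1 - X b / (m - ∑ c ∈ Finset.range b, X c)) * U (b + 1))
    {σ : Config I} (hσ : σ.clock < I.budget) (h : Trying x t i ω m X b σ)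
    (h11 : σ.mem.nat 11 [] = b) :
    tryAction.Achieves σ (Trying x t i ω m X (b + 1))
      (fun τ => if τ.mem.nat 14 [] = 0 then U (b + 1) else g (armStates τ))
      (σ.gain + if σ.mem.nat 14 [] = 0 then U b else g (armStates σ)) := by
  by_cases h14 : σ.mem.nat 14 [] = 0
  · rw [if_pos h14]
    obtain ⟨hω, hR⟩ := h.idle h14
    set R := m - ∑ c ∈ Finset.range b, X c with hRdef
    have hXR : X b ≤ R := by
      have h1 : ∑ c ∈ Finset.range (b + 1), X c ≤ ∑ c ∈ Finset.range I.numActions, X c :=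
        Finset.sum_le_sum_of_subset_of_nonneg
          (Finset.range_subset_range.2 hb) fun c hc _ => hX c (Finset.mem_range.1 hc)
      rw [Finset.sum_range_succ] at h1
      linarith
    have hR0 : 0 ≤ R := (hX b hb).trans hXR
    have hnode : σ.node i = (ω i).2.2 := by
      have : (armStates σ i).2.2 = (ω i).2.2 := by rw [hω]; simp [afterIdle]
      exact this
    have h4 : σ.mem.nat 4 [i] = (ω i).2.2 := by rw [h.intact.node, hnode]
    have h6 : σ.mem.nat 6 [i] = τ := by
      rw [← h.intact.armStates_time, hω, ← hτ]
      simp [afterIdle]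
    have hx : ∀ υ : Config I, (∀ A idx, A ≠ 14 → υ.mem.nat A idx = σ.mem.nat A idx) →
        υ.mem.real = σ.mem.real →
        (RealExpr.read 2 ![var 9, cell 4 (var 9), var 11, cell 6 (var 9)]).eval υ.mem = X b :=
      fun υ h1 h2 => by
        simp only [RealExpr.eval, ofFn_eval_four, eval_var, eval_cell, h1 _ _ (show 9 ≠ 14 by simp),
          h1 _ _ (show 4 ≠ 14 by simp), h1 _ _ (show 6 ≠ 14 by simp),
          h1 _ _ (show 11 ≠ 14 by simp), h2, h.arm, h4, h6, h11,
          h.intact.real 2 (by norm_num), hXdef]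
    have hval : σ.gain + U b = X b / R * (σ.gain + actionWorth g i ω b)
        + (1 - X b / R) * (σ.gain + U (b + 1)) := by
      rw [hU]
      ring
    rw [hval]
    refine Achieves.ite (fun _ => ?_)
      fun hc => absurd (by simp [Test.holds, eval_const, h14]) hc
    refine achieves_toss_seq ?_ (div_nonneg (hX b hb) hR0) (div_le_one_of_le₀ hXR hR0) ?_ ?_
    · have h1 := hx σ.tick (fun _ _ _ => rfl) rfl
      have h2 : (RealExpr.read 4 ![]).eval σ.tick.mem = R := by
        simp only [RealExpr.eval, ofFn_eval_zero, Config.tick_mem, hR]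
      simp only [RealExpr.eval] at h1 h2 ⊢
      rw [h1, h2]
    · refine Achieves.ite (fun _ => ?_)
        fun hc => absurd (by simp [Test.holds, eval_const]) hc
      set σ₁ := (σ.tick.tick.setNat 14 [] 1).tick with hσ₁
      have hI₁ : Intact x σ₁ := (h.intact.tick.tick.setNat (by norm_num) _ _).tick
      have hworth : σ.gain + actionWorth g i ω b = ∑ v, I.trans i (σ₁.node i) ⟨b, hb⟩ v *
          (σ.gain + I.reward i (ω i).2.2 ⟨b, hb⟩ + g (afterPlay i ω v)) := by
        have : σ₁.node i = (ω i).2.2 := hnode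
        simp only [this, mul_add, Finset.sum_add_distrib, ← Finset.sum_mul, I.trans_sum, one_mul,
          actionWorth, dif_pos hb, add_assoc]
      rw [hworth]
      have hstates : armStates σ₁ = afterIdle i ω := by
        rw [hσ₁, armStates_tick, armStates_setNat (by norm_num), armStates_tick, armStates_tick, hω]
      have hplay := achieves_play_record hg (x := x) (i := i) (a := ⟨b, hb⟩) (σ := σ₁) hσ hI₁
        (by simp [hσ₁, h.arm]) (by simp [hσ₁, h11])
      have hnode₁ : σ₁.node i = (ω i).2.2 := hnode
      simp only [hstates, ← afterPlay_eq, hnode₁] at hplay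
      rw [hnode₁]
      refine hplay.mono fun υ _ hυ => ?_
      have h14' : υ.mem.nat 14 [] = 1 := by
        rw [hυ.2 14 (by norm_num) (by norm_num)]
        simp [hσ₁]
      refine ⟨⟨hυ.1, ?_, ?_, fun h0 => absurd h0 (by omega)⟩, by rw [if_neg (by omega)]⟩
      · rw [hυ.2 8 (by norm_num) (by norm_num)]
        simp [hσ₁, h.round]
      · rw [hυ.2 9 (by norm_num) (by norm_num)]
        simp [hσ₁, h.arm]
    · refine Achieves.ite (fun hc => absurd hc (by simp [Test.holds, eval_const])) fun _ => ?_
      set σ₁ := (σ.tick.tick.setNat 14 [] 0).tick with hσ₁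
      have hI₁ : Intact x σ₁ := (h.intact.tick.tick.setNat (by norm_num) _ _).tick
      have e : (RealExpr.sub (.read 4 ![])
          (.read 2 ![var 9, cell 4 (var 9), var 11, cell 6 (var 9)])).eval σ₁.mem
          = R - X b := by
        have h1 := hx σ₁ (fun A idx hA => by simp [hσ₁, hA]) rfl
        have h2 : (RealExpr.read 4 ![]).eval σ₁.mem = R := by
          simp only [RealExpr.eval, ofFn_eval_zero, ← hR]
          rfl
        simp only [RealExpr.eval] at h1 h2 ⊢
        rw [h1, h2]
      refine achieves_of_pure (by rw [exec, e, ofFn_eval_zero]) (fun _ => ?_) ?_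
      · refine ⟨hI₁.tick.setReal (by norm_num) _ _, by simp [hσ₁, h.round], by simp [hσ₁, h.arm],
          fun _ => ⟨?_, ?_⟩⟩
        · rw [armStates_setReal, armStates_tick, hσ₁, armStates_tick,
            armStates_setNat (by norm_num)]
          exact hω
        · simp [hRdef, Finset.sum_range_succ]
          ring
      · have hlive : (σ₁.tick.setReal 4 [] (R - X b)).clock < I.budget := hσ
        rw [total, if_pos hlive]
        simp [hσ₁]
  · rw [if_neg h14]
    refine Achieves.ite (fun hc => absurd hc (by simp [Test.holds, eval_const, h14])) fun _ => ?_
    have := achieves_skip (Q := Trying x t i ω m X (b + 1))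
      (f := fun τ => if τ.mem.nat 14 [] = 0 then U (b + 1) else g (armStates τ)) (σ := σ.tick) hσ
      ⟨h.intact.tick.tick, h.round, h.arm, fun h0 => absurd h0 h14⟩
    simpa [h14, armStates_tick] using this

theorem achieves_simulateStep (hx : I.PolyFeasible x s)
    {g : (∀ i, ArmState I.budget (Fin (I.numNodes i))) → ℝ}
    (hg : ∀ ω, I.budget ≤ totalPlays ω → g ω = 0) {t : ℕ} {i : Fin I.numArms} {σ : Config I}
    (hσ : σ.clock < I.budget) (h : Intact x σ) (h8 : σ.mem.nat 8 [] = t) (h9 : σ.mem.nat 9 [] = i)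
    (hE : Enabled t (armStates σ i)) :
    simulateStep.Achieves σ
      (fun τ => Intact x τ ∧ τ.mem.nat 8 [] = t ∧ τ.mem.nat 9 [] = i) (fun τ => g (armStates τ))
      (σ.gain + jointStep hx.policy I.reward t i g (armStates σ)) := by
  set ω := armStates σ with hω
  obtain ⟨τ, hτ⟩ : ∃ τ, τ = σ.mem.nat 6 [i] := ⟨_, rfl⟩
  have hτω : (ω i).1.val = τ := by rw [hω, h.armStates_time, hτ]
  have hτB : τ < I.budget := hτω ▸ hE.1
  have hbump : (bump (ω i).1).val = τ + 1 := by rw [bump_val hE.1, hτω]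
  set u := (ω i).2.2 with hu
  have hnode : σ.node i = u := rfl
  set X : ℕ → ℝ := fun b => (I.input x).real 2 [i, u, b, τ + 1] with hXdef
  have hXa : ∀ a : Fin I.numActions, X a = x i u a (τ + 1) := fun a => input_play i u a hτB
  have hX : ∀ b < I.numActions, 0 ≤ X b := fun b hb => by
    have := hXa ⟨b, hb⟩
    dsimp only at this
    rw [this]
    exact hx.play_nonneg hτB _ _ _
  set m := I.nodeProb x i τ u with hm
  have hXm : ∑ b ∈ Finset.range I.numActions, X b ≤ m := by
    rw [Finset.sum_range, Finset.sum_congr rfl fun a _ => hXa a]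
    exact hx.sum_play_le hτB i u
  obtain ⟨U, hUn, hU, hU0⟩ := exists_sequential_choice hX hXm (actionWorth g i ω)
    (g (afterIdle i ω))
  have hact : ∀ a, (hx.policy i).act (ω i).1 u a = X a / m := fun a => by
    rw [hXa, MABInstance.PolyFeasible.policy]
    simp only [hτω, if_pos hτB, hm]
  -- the mean worth of the chosen action
  have hvalue : jointStep hx.policy I.reward t i g ω = U 0 := by
    have htot : totalPlays ω < I.budget := by rw [hω, h.totalPlays_armStates hσ.le]; exact hσ
    rw [jointStep, if_pos hE, if_pos htot, hU0, Finset.sum_range, Finset.sum_range, rewardRate,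
      ArmPolicy.stepMean, ← add_assoc, ← Finset.sum_add_distrib]
    simp only [← hu, hact, actionWorth, Fin.is_lt, dif_pos, Fin.eta, mul_add]
    rfl
  rw [hvalue]
  have hlt : τ + 1 ≤ I.budget := hτB
  -- the initializations
  refine achieves_setNat_seq ?_
  have e1 : ((cell 6 (var 9)).add (const 1)).eval σ.mem = τ + 1 := by
    simp [eval_add, eval_const, h9, hτ]
  rw [e1, ofFn_eval_one, eval_var, h9]
  set σ₁ := σ.tick.setNat 6 [i] (τ + 1) with hσ₁
  have hI₁ : Intact x σ₁ := h.tick.setTime i hlt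
  have hs₁ : armStates σ₁ = afterIdle i ω := by
    rw [hσ₁, armStates_setTime _ i hlt, armStates_tick, ← hω, afterIdle]
    congr 2
    exact Fin.ext hbump.symm
  have m₁ : ∀ A idx, σ₁.mem.nat A idx = if A = 6 ∧ idx = [↑i] then τ + 1 else σ.mem.nat A idx :=
    fun A idx => Config.setNat_mem_nat _ _ _ _ _ _
  have c₁ : σ₁.clock = σ.clock := rfl
  have g₁ : σ₁.gain = σ.gain := rfl
  have r₁ : σ₁.mem.real 3 = σ.mem.real 3 := rfl
  clear_value σ₁
  refine achieves_setNat_seq ?_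
  rw [ofFn_eval_zero, eval_const]
  refine achieves_setReal_seq ?_
  have e2 : (RealExpr.read 3 ![var 9, cell 4 (var 9), cell 6 (var 9)]).eval
      (σ₁.tick.setNat 14 [] 0).mem = m := by
    have h4 : σ.mem.nat 4 [i] = u := by rw [h.node, hnode]
    simp only [RealExpr.eval, ofFn_eval_three, eval_var, eval_cell, Config.setNat_mem_nat,
      Config.setNat_mem_real, Config.tick_mem, m₁, r₁]
    simp [h9, h4, h.table i τ hτB.le u, hm]
  rw [e2, ofFn_eval_zero]
  set σ₂ := (σ₁.tick.setNat 14 [] 0).tick.setReal 4 [] m with hσ₂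
  have htry : Trying x t i ω m X 0 σ₂.tick := by
    refine ⟨((hI₁.tick.setNat (by norm_num) _ _).tick.setReal (by norm_num) _ _).tick, ?_, ?_,
      fun _ => ⟨?_, ?_⟩⟩
    · simp [hσ₂, m₁, h8]
    · simp [hσ₂, m₁, h9]
    · rw [hσ₂, armStates_tick, armStates_setReal, armStates_tick, armStates_setNat (by norm_num),
        armStates_tick, hs₁]
    · simp [hσ₂]
  have key := achieves_loop (A := 11) (N := I.numActions) (e := var 1) (c := tryAction)
    (σ := σ₂) (Trying x t i ω m X)
    (fun b τ => if τ.mem.nat 14 [] = 0 then U b else g (armStates τ))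
    ((eval_var _ _).trans (htry.intact.nat 1 (by norm_num) [])) (c₁ ▸ hσ) htry
    fun b hb υ hυ ht => by
      have e14 : (υ.tick.setNat 11 [] b).mem.nat 14 [] = υ.mem.nat 14 [] := by simp
      have es : armStates (υ.tick.setNat 11 [] b) = armStates υ := by
        rw [armStates_setNat (by norm_num), armStates_tick]
      have := achieves_tryAction hg hbump (fun _ => rfl) hX hXm hb (hU b hb)
        (σ := υ.tick.setNat 11 [] b) (t := t) hυ
        ⟨ht.intact.tick.setNat (by norm_num) _ _, by simp [ht.round], by simp [ht.arm],
          fun h0 => by rw [es]; exact ht.idle (e14 ▸ h0)⟩ (by simp)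
      rwa [e14, es] at this
  have h14 : σ₂.tick.mem.nat 14 [] = 0 := by simp [hσ₂]
  rw [if_pos h14, show σ₂.gain = σ.gain from g₁] at key
  refine key.mono fun υ _ hυ => ⟨⟨hυ.intact, hυ.round, hυ.arm⟩, ?_⟩
  split_ifs with h0
  · rw [hUn, (hυ.idle h0).1]
  · rfl

theorem achieves_advance (hx : I.PolyFeasible x s)
    {g : (∀ i, ArmState I.budget (Fin (I.numNodes i))) → ℝ}
    (hg : ∀ ω, I.budget ≤ totalPlays ω → g ω = 0) {t : ℕ} {i : Fin I.numArms} {σ : Config I}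
    (hσ : σ.clock < I.budget) (h : Intact x σ) (h8 : σ.mem.nat 8 [] = t)
    (h9 : σ.mem.nat 9 [] = i) :
    advance.Achieves σ
      (fun τ => Intact x τ ∧ τ.mem.nat 8 [] = t ∧ τ.mem.nat 9 [] = i) (fun τ => g (armStates τ))
      (σ.gain + jointStep hx.policy I.reward t i g (armStates σ)) := by
  have hE : Enabled t (armStates σ i) ↔
      (Test.and (.natLe ((cell 6 (var 9)).add (const 1)) (var 2))
      (.natLe ((cell 6 (var 9)).add (const 1))
        (((var 8).add (const 1)).add
          (((cell 7 (var 9)).add (cell 7 (var 9))).sub ((var 8).add (const 1)))))).holds σ.mem := by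
    have h2 : σ.mem.nat 2 [] = I.budget := by
      rw [h.nat 2 (by norm_num)]
      rfl
    simp only [Test.holds, Enabled, h.armStates_time, h.armStates_plays hσ.le, eval_add, eval_sub,
      eval_const, eval_cell, eval_var, h8, h9, h2]
    omega
  refine Achieves.ite (fun hc => ?_) fun hc => ?_
  · exact achieves_simulateStep hx hg (σ := σ.tick) hσ h.tick h8 h9 (hE.2 hc)
  · rw [jointStep, if_neg fun h' => hc (hE.1 h')]
    exact achieves_skip (Q := fun τ => Intact x τ ∧ τ.mem.nat 8 [] = t ∧ τ.mem.nat 9 [] = i)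
      (f := fun τ => g (armStates τ)) (σ := σ.tick) hσ ⟨h.tick.tick, h8, h9⟩

/-! ### The rounds -/

theorem totalPlays_le_update {n B : ℕ} {N : Fin n → Type*} (ω : ∀ i, ArmState B (N i)) (i : Fin n)
    {r : ArmState B (N i)} (hr : (ω i).2.1.val ≤ r.2.1.val) :
    totalPlays ω ≤ totalPlays (Function.update ω i r) := by
  refine Finset.sum_le_sum fun j _ => ?_
  by_cases hj : j = i
  · subst hj
    rwa [Function.update_self]
  · rw [Function.update_of_ne hj]

theorem jointStep_eq_zero {n B : ℕ} {N : Fin n → Type*} {A : Type*} [∀ i, Fintype (N i)]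
    [Fintype A] (M : ∀ i, ArmPolicy (N i) A) (r : ∀ i, N i → A → ℝ) (t : ℕ) (i : Fin n)
    {g : (∀ i, ArmState B (N i)) → ℝ} (hg : ∀ ω, B ≤ totalPlays ω → g ω = 0) :
    ∀ ω, B ≤ totalPlays ω → jointStep M r t i g ω = 0 := by
  intro ω hω
  unfold jointStep
  split_ifs with h1 h2
  · omega
  · have e1 : ∀ v, g (Function.update ω i (bump (ω i).1, bump (ω i).2.1, v)) = 0 := fun v =>
      hg _ (hω.trans (totalPlays_le_update ω i (le_bump _)))
    have e2 : g (Function.update ω i (bump (ω i).1, (ω i).2.1, (ω i).2.2)) = 0 :=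
      hg _ (hω.trans (totalPlays_le_update ω i le_rfl))
    simp [ArmPolicy.stepMean, e1, e2]
  · exact hg ω hω

theorem achieves_rounds (hx : I.PolyFeasible x s) {σ : Config I} (hσ : σ.clock < I.budget)
    (h : Intact x σ) :
    rounds.Achieves σ (Intact x) (fun _ => 0)
      (σ.gain + loopOp I.budget (roundValue (B := I.budget) hx.policy I.reward) (fun _ => 0)
        (armStates σ)) := by
  set zeroAtEnd : ((∀ i, ArmState I.budget (Fin (I.numNodes i))) → ℝ) → Prop :=
    fun g => ∀ ω, I.budget ≤ totalPlays ω → g ω = 0 with hz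
  have hbudget : ∀ τ : Config I, Intact x τ → (var 2).eval τ.mem = I.budget := fun τ hτ => by
    rw [eval_var, hτ.nat 2 (by norm_num)]
    rfl
  have harms : ∀ τ : Config I, Intact x τ → (var 0).eval τ.mem = I.numArms := fun τ hτ => by
    rw [eval_var, hτ.nat 0 (by norm_num)]
    rfl
  have hop : ∀ t i g, zeroAtEnd g → zeroAtEnd (if hi : i < I.numArms then
      loopOp I.budget (fun _ => jointStep hx.policy I.reward t ⟨i, hi⟩) g else g) := by
    intro t i g hg
    split_ifs with hi
    · exact loopOp_induction (p := zeroAtEnd)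
        (fun _ _ hg => jointStep_eq_zero hx.policy I.reward t ⟨i, hi⟩ hg) _ hg
    · exact hg
  obtain ⟨F, hF0, hFN, hF, hFz⟩ := exists_loopOp (roundValue (B := I.budget) hx.policy I.reward)
    zeroAtEnd (fun t g hg => loopOp_induction (p := zeroAtEnd) (hop t) _ hg) I.budget (h := fun _ => 0)
    fun _ _ => rfl
  rw [← hF0]
  refine (achieves_loop (fun _ => Intact x) (fun t τ => F t (armStates τ)) (hbudget σ h) hσ
    h.tick ?_).mono fun τ _ hτ => ⟨hτ, by rw [hFN]⟩
  intro t ht τ hτ hI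
  obtain ⟨G, hG0, hGN, hG, hGz⟩ := exists_loopOp (fun i h => if hi : i < I.numArms then
    loopOp I.budget (fun _ => jointStep hx.policy I.reward t ⟨i, hi⟩) h else h) zeroAtEnd (hop t)
    I.numArms (hFz (t + 1))
  rw [hF t ht, roundValue, ← hG0]
  have hI₁ : Intact x (τ.tick.setNat 8 [] t) := hI.tick.setNat le_rfl _ _
  have key := achieves_loop (A := 9) (e := var 0) (c := loop 10 (var 2) advance)
    (fun _ σ => Intact x σ ∧ σ.mem.nat 8 [] = t) (fun i σ => G i (armStates σ)) (harms _ hI₁) hτ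
    ⟨hI₁.tick, by simp⟩ (fun i hi υ hυ hJ => ?_)
  · rw [armStates_tick, armStates_setNat le_rfl, armStates_tick] at key
    exact key.mono fun υ _ hυ => ⟨hυ.1, by rw [hGN]⟩
  obtain ⟨K, hK0, hKN, hK, hKz⟩ := exists_loopOp
    (fun _ => jointStep (B := I.budget) hx.policy I.reward t ⟨i, hi⟩) zeroAtEnd
    (fun _ g hg => jointStep_eq_zero _ _ _ _ hg) I.budget (hGz (i + 1))
  rw [hG i hi, dif_pos hi, ← hK0]
  have hJ₁ : Intact x (υ.tick.setNat 9 [] i) := hJ.1.tick.setNat (by norm_num) _ _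
  have key := achieves_loop (A := 10) (e := var 2) (c := advance)
    (fun _ σ => Intact x σ ∧ σ.mem.nat 8 [] = t ∧ σ.mem.nat 9 [] = i)
    (fun k σ => K k (armStates σ)) (hbudget _ hJ₁) hυ ⟨hJ₁.tick, by simp [hJ.2], by simp⟩
    (fun k hk ρ hρ hL => ?_)
  · rw [armStates_tick, armStates_setNat (by norm_num), armStates_tick] at key
    exact key.mono fun ρ _ hρ => ⟨⟨hρ.1, hρ.2.1⟩, by rw [hKN]⟩
  have := achieves_advance hx (hKz (k + 1)) (t := t) (i := ⟨i, hi⟩) (σ := ρ.tick.setNat 10 [] k) hρ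
    (hL.1.tick.setNat (by norm_num) _ _) (by simp [hL.2.1]) (by simp [hL.2.2])
  rw [armStates_setNat (by norm_num), armStates_tick] at this
  rw [hK k hk]
  exact this

end MABProgram

/-! ### The algorithm on an instance -/

namespace MABProgram

open Cmd

variable {I : MABInstance} {x : I.PlayVar} {s : I.NodeVar}

theorem input_nat_le_size (x : I.PlayVar) {A : ℕ} (hA : A ≤ 3) (idx : List ℕ) :
    (I.input x).nat A idx ≤ I.size := by
  have hnodes : ∀ i : Fin I.numArms, I.numNodes i ≤ I.size := fun i =>
    (Finset.single_le_sum (f := I.numNodes) (fun _ _ => Nat.zero_le _) (Finset.mem_univ i)).trans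
      (Nat.le_add_left _ _)
  unfold MABInstance.size at *
  interval_cases A <;> rcases idx with _ | ⟨i, _ | ⟨j, idx⟩⟩ <;>
    simp only [MABInstance.input, Nat.zero_le] <;> try omega
  split_ifs
  · exact hnodes _
  · exact Nat.zero_le _

theorem steps_program_le (x : I.PlayVar) :
    ∀ σ ∈ (I.outcome program x).support, σ.steps ≤ program.cost.eval I.size := by
  intro σ hσ
  have h := (steps_le I.size program tame_program (I.start x)
    (fun A hA idx => input_nat_le_size x hA idx) σ hσ).2
  simpa [MABInstance.start] using h

theorem le_expectedReward_program (hx : I.PolyFeasible x s) :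
    4 / 27 * I.polyValue x ≤ I.expectedReward program x := by
  rcases Nat.eq_zero_or_pos I.budget with hB | hB
  · have h0 : I.polyValue x = 0 := by simp [MABInstance.polyValue, hB]
    have h1 : I.expectedReward program x = 0 :=
      pmfMean_eq_const (finite_support_exec _ _) fun σ hσ =>
        (exec_of_budget_le program (σ := I.start x) (by rw [hB]; exact Nat.zero_le _) σ hσ).2
    rw [h0, h1, mul_zero]
  · set g := loopOp I.budget (roundValue (B := I.budget) hx.policy I.reward) (fun _ => 0)
    have key : program.Achieves (I.start x) (Intact x) (fun _ => 0)
        ((I.start x).gain + selectValue g fun i => (0, 0, I.root i)) := by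
      refine (achieves_tabulate (selectValue g fun i => (0, 0, I.root i)) hB).seq fun σ hσ h => ?_
      have h1 := achieves_select g hσ h.intact
      rw [h.armStates_eq] at h1
      exact h1.seq fun τ hτ h => achieves_rounds hx hτ h
    have hmain := le_selectValue (B := I.budget) hx.policy I.reward I.reward_nonneg
      fun t ht => hx.sum_expectedPlays_le ht
    rw [hx.sum_future_policy] at hmain
    have hreward : I.expectedReward program x
        = (I.start x).gain + selectValue g fun i => (0, 0, I.root i) := by
      rw [← key.2]
      exact pmfMean_congr fun σ _ => by simp [total]
    rw [hreward]
    exact hmain.trans (le_of_eq (zero_add _).symm)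

end MABProgram

theorem MABInstance.PolyOptimal.optPoly_le {I : MABInstance} {x : I.PlayVar} {s : I.NodeVar}
    (h : I.PolyOptimal x s) : 4 / 27 * I.optPoly ≤ I.expectedReward MABProgram.program x := by
  rw [h.optPoly_eq]
  exact MABProgram.le_expectedReward_program h.1

theorem MABInstance.projectionGap_le : projectionGap ≤ 27 / 4 := by
  refine iSup_le fun I => ENNReal.div_le_of_le_mul ?_
  obtain ⟨x, s, h⟩ := I.exists_polyOptimal
  have h1 := h.optPoly_le.trans (I.expectedReward_le_optExp _ x)
  have h2 : (27 / 4 : ENNReal) = ENNReal.ofReal (27 / 4) := by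
    rw [ENNReal.ofReal_div_of_pos (by norm_num)]
    norm_num
  rw [h2, ← ENNReal.ofReal_mul (by norm_num)]
  exact ENNReal.ofReal_le_ofReal (by linarith)

theorem theorem4p4 :
    (∃ (P : Cmd) (T : Polynomial ℕ), ∀ I : MABInstance,
      (∀ (x : I.PlayVar) (s : I.NodeVar), I.PolyFeasible x s →
        (∀ σ ∈ (I.outcome P x).support, σ.steps ≤ T.eval I.size) ∧
        4 / 27 * I.polyValue x ≤ I.expectedReward P x) ∧
      (∀ (x : I.PlayVar) (s : I.NodeVar), I.PolyOptimal x s →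
        4 / 27 * I.optPoly ≤ I.expectedReward P x ∧
        4 / 27 * I.optExp ≤ I.expectedReward P x)) ∧
    (∀ I : MABInstance, (∃ (x : I.PlayVar) (s : I.NodeVar), I.PolyOptimal x s) ∧
      I.optExp ≤ I.optPoly) ∧
    MABInstance.projectionGap ≤ 27 / 4 := by
  refine ⟨⟨MABProgram.program, MABProgram.program.cost, fun I => ⟨fun x s hx =>
    ⟨MABProgram.steps_program_le x, MABProgram.le_expectedReward_program hx⟩, fun x s hx =>
    ⟨hx.optPoly_le, ?_⟩⟩⟩, fun I => ⟨I.exists_polyOptimal, I.optExp_le_optPoly⟩,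
    MABInstance.projectionGap_le⟩
  exact (mul_le_mul_of_nonneg_left I.optExp_le_optPoly (by norm_num)).trans hx.optPoly_le
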